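/- Let $d,\ell\in\mathbb N$, $\sigma,\beta\in\mathbb R$, $g:\mathbb R^\ell\to\mathbb R^d$, $h:\mathbb R^\ell\to\mathbb R^{d\times d}$ and $f:\mathbb R^d\to\mathbb R$. Assume: (1) $g$ and $h$ are $C^2$, and $g,h$ and their first and second derivatives in $\theta$ are bounded on $\mathbb R^\ell$; (2) $h(\theta)$ is symmetric for every $\theta$, and there is $c>0$ with $x^\top h(\theta)x\ge c|x|^2$ for all $\theta\in\mathbb R^\ell$, $x\in\mathbb R^d$; (3) $f$ is $C^3$, and there are constants $C,m>0$ with $|f(x)|+\sum_{i=1}^3|\nabla^i f(x)|\le C(1+|x|^m)$ for all $x\in\mathbb R^d$. Let $W$ be a standard $d$-dimensional Brownian motion. For $\theta\in\mathbb R^\ell$, $x\in\mathbb R^d$, $\tilde x\in\mathbb R^{d\times\ell}$ let $X^\theta$ and $\tilde X^\theta$ (with values in $\mathbb R^d$ and $\mathbb R^{d\times \ell}$) be continuous processes solving $$dX^\theta_t=(g(\theta)-h(\theta)X^\theta_t)\,dt+\sigma\,dW_t,\quad X^\theta_0=x,\qquad \frac{d\tilde X^\theta_t}{dt}=\nabla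 g(\theta)-\nabla h(\theta)X^\theta_t-h(\theta)\tilde X^\theta_t,\quad \tilde X^\theta_0=\tilde x,$$ where $(\nabla h(\theta)x)_{ij}=\sum_k \frac{\partial h_{ik}}{\partial\theta_j}(\theta)\,x_k$, and let $\mathbf E_{x,\tilde x}$ denote expectation for these initial values. Then, for every $\theta$, $X^\theta$ has a unique stationary distribution $\pi_\theta$; $f$ is $\pi_\theta$-integrable and $\theta\mapsto\mathbf E_{\pi_\theta}f=\int f\,d\pi_\theta$ is differentiable. Put $$G^1(x,\tilde x,\theta)=(\mathbf E_{\pi_\theta}f-\beta)\left(\tilde x^\top\nabla f(x)-\nabla_\theta \mathbf E_{\pi_\theta}f\right)\in\mathbb R^\ell .$$ Then $G^1(X^\theta_t,\tilde X^\theta_t,\theta)$ is integrable for every $t\ge0$ and all initial values, $t\mapsto\mathbf E_{x,\tilde x}G^1(X^\theta_t,\tilde X^\theta_t,\theta)$ is integrable on $(0,\infty)$, and $$v^1(x,\tilde x,\theta)=-\int_0^\infty\mathbf E_{x,\tilde x}\,G^1(X^\theta_t,\tilde X^\theta_t,\theta)\,dt$$ is, for every $\theta$, a classical solution of the Poisson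 equation $$\mathcal L^\theta_{x,\tilde x}u(x,\tilde x,\theta)=G^1(x,\tilde x,\theta)\qquad (x\in\mathbb R^d,\ \tilde x\in\mathbb R^{d\times\ell}),$$ where $\mathcal L^\theta_{x,\tilde x}$ acts on each of the $\ell$ components of $u$ by $$\mathcal L^\theta_{x,\tilde x}\varphi(x,\tilde x)=\left(g(\theta)-h(\theta)x\right)^\top\nabla_x\varphi+\frac{\sigma^2}{2}\Delta_x\varphi+\mathrm{tr}\left((\nabla_{\tilde x}\varphi)^\top\left(\nabla g(\theta)-\nabla h(\theta)x-h(\theta)\tilde x\right)\right).$$ Here "classical solution" means that $v^1$ is $C^1$ in $(x,\tilde x)$ and $C^2$ in $x$, with $\nabla_x^2v^1$ continuous in $(x,\tilde x)$, and that the equation holds at every point. The operator $\mathcal L^\theta_{x,\tilde x}$ (which has no second-order part in $\tilde x$) is the infinitesimal generator of $(X^\theta,\tilde X^\theta)$: for every compactly supported $C^2$ function $\varphi$ and all $x,\tilde x$, $\lim_{t\downarrow0}t^{-1}\left(\mathbf E_{x,\tilde x}\varphi(X^\theta_t,\tilde X^\theta_t)-\varphi(x,\tilde x)\right)=\mathcal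 L^\theta_{x,\tilde x}\varphi(x,\tilde x)$. Moreover $v^1$ is differentiable in $\theta$, and there are constants $C$ and $m'>0$, not depending on $(x,\tilde x,\theta)$, such that for all $x,\tilde x,\theta$ $$|v^1(x,\tilde x,\theta)|+|\nabla_\theta v^1(x,\tilde x,\theta)|+|\nabla_xv^1(x,\tilde x,\theta)|+|\nabla_{\tilde x}v^1(x,\tilde x,\theta)|\le C\left(1+|x|^{m'}+|\tilde x|^{m'}\right).$$ Norms of vectors are Euclidean, and norms of matrices and of derivatives are operator norms. -/

import Mathlib

open MeasureTheory ProbabilityTheory Filter Topology Set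
open scoped NNReal Laplacian

namespace OUPoisson

noncomputable section

/-- Euclidean space `ℝⁿ`. -/
abbrev Vec (n : ℕ) := EuclideanSpace ℝ (Fin n)

/-- The `d × ℓ` real matrices, as linear maps `ℝ^ℓ → ℝ^d`. -/
abbrev Mat (d ℓ : ℕ) := Vec ℓ →L[ℝ] Vec d

variable {Ω : Type*} [MeasurableSpace Ω] {d ℓ : ℕ}

/-- `W` is a standard `d`-dimensional Brownian motion on `(Ω, P)`: its coordinate processes are
independent real Brownian motions. -/
structure IsBrownianVec (P : Measure Ω) (W : ℝ≥0 → Ω → Vec d) : Prop where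
  measurable : ∀ t, Measurable (W t)
  coord : ∀ i, IsBrownianReal (fun t ω => W t ω i) P
  indep : iIndepFun (fun (i : Fin d) (ω : Ω) (t : ℝ≥0) => W t ω i) P

/-- The process `X` solves `dX_t = (a - A X_t) dt + σ dW_t`, `X_0 = x`. Since the noise is additive,
the stochastic integral is `σ W_t` and the equation is a pathwise integral equation. -/
structure IsOUSolution (P : Measure Ω) (W : ℝ≥0 → Ω → Vec d) (a : Vec d) (A : Mat d d) (σ : ℝ)
    (x : Vec d) (X : ℝ≥0 → Ω → Vec d) : Prop where
  measurable : ∀ t, Measurable (X t)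
  path : ∀ᵐ ω ∂P, Continuous (fun t => X t ω) ∧
    ∀ t : ℝ≥0, X t ω = x + (∫ s in (0 : ℝ)..t, (a - A (X s.toNNReal ω))) + σ • W t ω

/-- The drift `∇g(θ) - ∇h(θ) x - h(θ) x̃` of the derivative process: a `d × ℓ` matrix with entries
`∂g_i/∂θ_j - ∑ k, (∂h_ik/∂θ_j) x_k - ∑ k, h_ik x̃_kj`. -/
def tangentDrift (g : Vec ℓ → Vec d) (h : Vec ℓ → Mat d d) (θ : Vec ℓ) (x : Vec d)
    (x' : Mat d ℓ) : Mat d ℓ :=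
  fderiv ℝ g θ - (fderiv ℝ h θ).flip x - (h θ).comp x'

/-- The process `X'` solves `dX'_t/dt = ∇g(θ) - ∇h(θ) X_t - h(θ) X'_t`, `X'_0 = x'`, along the
paths of `X`. -/
structure IsTangentSolution (P : Measure Ω) (g : Vec ℓ → Vec d) (h : Vec ℓ → Mat d d) (θ : Vec ℓ)
    (x' : Mat d ℓ) (X : ℝ≥0 → Ω → Vec d) (X' : ℝ≥0 → Ω → Mat d ℓ) : Prop where
  measurable : ∀ t, Measurable (X' t)
  path : ∀ᵐ ω ∂P, Continuous (fun t => X' t ω) ∧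
    ∀ t : ℝ≥0, X' t ω =
      x' + ∫ s in (0 : ℝ)..t, tangentDrift g h θ (X s.toNNReal ω) (X' s.toNNReal ω)

/-- `μ` is a stationary distribution of the Markov process whose version started at `x` is `X x`:
it is a probability measure with `∫ P(X_t^x ∈ A) μ(dx) = μ(A)` for all `t` and `A`. -/
structure IsStationary (P : Measure Ω) (X : Vec d → ℝ≥0 → Ω → Vec d) (μ : Measure (Vec d)) :
    Prop where
  prob : IsProbabilityMeasure μ
  invariant : ∀ (t : ℝ≥0) (A : Set (Vec d)), MeasurableSet A →
    ∫⁻ x, P {ω | X x t ω ∈ A} ∂μ = μ A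

/-- The operator `φ ↦ ⟨g(θ) - h(θ) x, ∇_x φ⟩ + (σ²/2) Δ_x φ
+ tr((∇_x̃ φ)ᵀ (∇g(θ) - ∇h(θ) x - h(θ) x̃))`; the trace is the derivative of `φ` in `x̃` in the
direction of the drift. -/
def generator (g : Vec ℓ → Vec d) (h : Vec ℓ → Mat d d) (σ : ℝ) (θ : Vec ℓ)
    (φ : Vec d → Mat d ℓ → ℝ) (x : Vec d) (x' : Mat d ℓ) : ℝ :=
  inner ℝ (g θ - h θ x) (gradient (fun y => φ y x') x)
    + σ ^ 2 / 2 * Δ (fun y => φ y x') x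
    + fderiv ℝ (fun y' => φ x y') x' (tangentDrift g h θ x x')

/-- `G(x, x̃, θ) = (E_{π_θ} f - β) (x̃ᵀ ∇f(x) - ∇_θ E_{π_θ} f)`. -/
def G1 (f : Vec d → ℝ) (β : ℝ) (π : Vec ℓ → Measure (Vec d)) (x : Vec d) (x' : Mat d ℓ)
    (θ : Vec ℓ) : Vec ℓ :=
  ((∫ y, f y ∂π θ) - β) •
    (ContinuousLinearMap.adjoint x' (gradient f x) - gradient (fun η => ∫ y, f y ∂π η) θ)

/-- `E_{x, x̃} G(X_t^θ, X̃_t^θ, θ)`; `X θ x` starts at `x` and `X' θ x x̃` starts at `x̃`. -/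
def meanG1 (P : Measure Ω) (X : Vec ℓ → Vec d → ℝ≥0 → Ω → Vec d)
    (X' : Vec ℓ → Vec d → Mat d ℓ → ℝ≥0 → Ω → Mat d ℓ) (f : Vec d → ℝ) (β : ℝ)
    (π : Vec ℓ → Measure (Vec d)) (x : Vec d) (x' : Mat d ℓ) (θ : Vec ℓ) (t : ℝ≥0) : Vec ℓ :=
  ∫ ω, G1 f β π (X θ x t ω) (X' θ x x' t ω) θ ∂P

/-- `v(x, x̃, θ) = - ∫_0^∞ E_{x, x̃} G(X_t^θ, X̃_t^θ, θ) dt`. -/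
def v1 (P : Measure Ω) (X : Vec ℓ → Vec d → ℝ≥0 → Ω → Vec d)
    (X' : Vec ℓ → Vec d → Mat d ℓ → ℝ≥0 → Ω → Mat d ℓ) (f : Vec d → ℝ) (β : ℝ)
    (π : Vec ℓ → Measure (Vec d)) (x : Vec d) (x' : Mat d ℓ) (θ : Vec ℓ) : Vec ℓ :=
  -∫ t in Ioi (0 : ℝ), meanG1 P X X' f β π x x' θ t.toNNReal

/-- `u` is a classical solution of `L u_j = G_j`, `j = 1, …, ℓ`, for an operator `L` of second order
in `x` and first order in `x̃`: the derivatives of `u` up to order two in `x` and of order one in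
`x̃` exist and are continuous in `(x, x̃)`, and the equations hold at every point. -/
structure IsClassicalSolution (L : (Vec d → Mat d ℓ → ℝ) → Vec d → Mat d ℓ → ℝ)
    (u G : Vec d → Mat d ℓ → Vec ℓ) : Prop where
  contDiff_one : ContDiff ℝ 1 (fun p : Vec d × Mat d ℓ => u p.1 p.2)
  contDiff_two : ∀ x', ContDiff ℝ 2 (fun x => u x x')
  continuous_second :
    Continuous (fun p : Vec d × Mat d ℓ => iteratedFDeriv ℝ 2 (fun x => u x p.2) p.1)
  equation : ∀ x x' j, L (fun y y' => u y y' j) x x' = G x x' j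

end

end OUPoisson

/-! The drift is linear, so everything reduces to Gaussian laws with explicit parameters. Write A =
h(θ), a = g(θ). For t > 0 the law of X_t is the image of the standard Gaussian under z ↦ m_t + S_t
z, where m_t = A⁻¹a + e^{-tA}(x − A⁻¹a) and S_t = σ(2A)^{-1/2}(1 − e^{-2tA})^{1/2}; the stationary
law is the image with the limits of m_t and S_t. Hence E f(X_t) = Φ(m_t, S_t), where Φ = `smear` is
as smooth as f. No density is used, and σ = 0 is allowed.

Uniformity in θ: for a suitable K the operators w = 1 − A/K are contractions with a common constant,
so A⁻¹, A^{-1/2} and e^{-tA} are power series in w, and (1 − e^{-2tA})^{1/2} is one in e^{-2tA}. A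
weighted submultiplicative norm on second-order jets in θ makes the powers of w decay geometrically
in C². So m_t (started at 0) and S_t are bounded C² functions of θ that approach their limits
exponentially fast together with two derivatives (`exists_paramBounds`,
`ParamBounds.decayingFamily`).

X' is the derivative of X when (x, θ) moves along (x̃η, η). Therefore E[Df(X_t) X'_t η] is a
directional derivative of Φ(m_t, S_t), and its difference from D(π_θ f)η, called `gap`, decays
exponentially with two derivatives in (x, x̃) and one in θ, up to polynomial factors
(`DecayingFamily.polyBdd_tangentGap`). The time integral U = `gapPotential` thus converges and
inherits smoothness and polynomial growth, and v¹ is −(π_θ f − β) U read as a vector.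

For the Poisson equation, the Chapman-Kolmogorov identity for X alone, differentiated along (x̃η,
η), gives E gap_s(X_t, X'_t) = gap_{s+t}(x, x̃) (`OUSystem.integral_gap`); the joint law of the pair
is never needed. Integrating over s yields E U(X_t, X'_t) = U − ∫_0^t gap_s ds. Divided by t → 0,
the left side produces the operator applied to U (`OUSystem.tendsto_generator`) and the right side
−gap_{0+} = −(Df(x) x̃ − D(π_θ f)).

The generator limit avoids Itô's formula: (X_t, X'_t) differs from (x + σW_t, x̃) by t times the
drift to first order, and Gaussian averaging of a second-order Taylor expansion supplies σ²/2 times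
the Laplacian. The law of X_t comes from a pathwise integration by parts of the Wiener integral and
characteristic functions of Riemann sums. Uniqueness of the stationary law follows by letting n → ∞
in the invariance identity for characteristic functions at time n. -/

namespace OUPoisson

set_option linter.unusedSectionVars false

noncomputable section

/-! ### Calculus of C^n maps with polynomially bounded derivatives. -/

section PolyBdd

universe u

variable {E F G H : Type*} [NormedAddCommGroup E] [NormedSpace ℝ E] [NormedAddCommGroup F]
  [NormedSpace ℝ F] [NormedAddCommGroup G] [NormedSpace ℝ G] [NormedAddCommGroup H]
  [NormedSpace ℝ H]

/-- `φ` is `C^n` and its derivatives up to order `n` are bounded by `C (1 + ‖x‖)^N`. -/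
structure PolyBdd (n : ℕ) (φ : E → F) (C : ℝ) (N : ℕ) : Prop where
  contDiff : ContDiff ℝ n φ
  bound : ∀ i ≤ n, ∀ x, ‖iteratedFDeriv ℝ i φ x‖ ≤ C * (1 + ‖x‖) ^ N

namespace PolyBdd

variable {n m N M : ℕ} {C D : ℝ} {φ : E → F}

lemma nonneg (h : PolyBdd n φ C N) : 0 ≤ C := by
  have := (norm_nonneg _).trans (h.bound 0 (Nat.zero_le _) 0)
  simpa using this

lemma mono (h : PolyBdd n φ C N) (hC : C ≤ D) (hN : N ≤ M) : PolyBdd n φ D M where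
  contDiff := h.contDiff
  bound i hi x := (h.bound i hi x).trans <| by
    have h1 : (1 + ‖x‖) ^ N ≤ (1 + ‖x‖) ^ M :=
      pow_le_pow_right₀ (by linarith [norm_nonneg x]) hN
    have := h.nonneg
    exact mul_le_mul hC h1 (by positivity) (this.trans hC)

lemma of_le (h : PolyBdd n φ C N) (hm : m ≤ n) : PolyBdd m φ C N where
  contDiff := h.contDiff.of_le (by exact_mod_cast hm)
  bound i hi x := h.bound i (hi.trans hm) x

lemma norm_le (h : PolyBdd n φ C N) (x : E) : ‖φ x‖ ≤ C * (1 + ‖x‖) ^ N := by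
  simpa using h.bound 0 (Nat.zero_le _) x

lemma norm_fderiv_le (h : PolyBdd n φ C N) (hn : 1 ≤ n) (x : E) :
    ‖fderiv ℝ φ x‖ ≤ C * (1 + ‖x‖) ^ N := by
  have := h.bound 1 hn x
  rwa [← norm_iteratedFDeriv_fderiv, norm_iteratedFDeriv_zero] at this

lemma differentiable (h : PolyBdd n φ C N) (hn : 1 ≤ n) : Differentiable ℝ φ :=
  h.contDiff.differentiable (by
    rw [Ne, Nat.cast_eq_zero]; omega)

lemma hasFDerivAt (h : PolyBdd n φ C N) (hn : 1 ≤ n) (x : E) :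
    HasFDerivAt φ (fderiv ℝ φ x) x := (h.differentiable hn x).hasFDerivAt

lemma continuous (h : PolyBdd n φ C N) : Continuous φ := h.contDiff.continuous

protected lemma fderiv (h : PolyBdd (n + 1) φ C N) : PolyBdd n (fderiv ℝ φ) C N where
  contDiff := h.contDiff.fderiv_right (by norm_cast)
  bound i hi x := by
    rw [norm_iteratedFDeriv_fderiv]
    exact h.bound (i + 1) (by omega) x

lemma of_fderiv (h0 : ∀ x, ‖φ x‖ ≤ C * (1 + ‖x‖) ^ N) (hd : Differentiable ℝ φ)
    (h : PolyBdd n (_root_.fderiv ℝ φ) C N) : PolyBdd (n + 1) φ C N where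
  contDiff := by
    have := (contDiff_succ_iff_fderiv (𝕜 := ℝ) (f := φ) (n := (n : WithTop ℕ∞))).2
      ⟨hd, by intro h; exact absurd h (by simp), h.contDiff⟩
    exact_mod_cast this
  bound i hi x := by
    rcases i with _ | i
    · simpa using h0 x
    · rw [← norm_iteratedFDeriv_fderiv]
      exact h.bound i (by omega) x

lemma const (c : F) : PolyBdd n (fun _ : E => c) ‖c‖ 0 where
  contDiff := contDiff_const
  bound i _ x := by
    rcases i with _ | i
    · simp
    · simp [iteratedFDeriv_const_of_ne (Nat.succ_ne_zero i)]

lemma add {ψ : E → F} (h : PolyBdd n φ C N) (h' : PolyBdd n ψ D N) :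
    PolyBdd n (fun x => φ x + ψ x) (C + D) N where
  contDiff := h.contDiff.add h'.contDiff
  bound i hi x := by
    have hi' : (i : WithTop ℕ∞) ≤ n := by exact_mod_cast hi
    have : (fun x => φ x + ψ x) = φ + ψ := rfl
    rw [this, iteratedFDeriv_add_apply (h.contDiff.of_le hi').contDiffAt
      (h'.contDiff.of_le hi').contDiffAt, add_mul]
    exact (norm_add_le _ _).trans (add_le_add (h.bound i hi x) (h'.bound i hi x))

lemma clm_comp (L : F →L[ℝ] G) (h : PolyBdd n φ C N) :
    PolyBdd n (fun x => L (φ x)) (‖L‖ * C) N where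
  contDiff := L.contDiff.comp h.contDiff
  bound i hi x := by
    have hi' : (i : WithTop ℕ∞) ≤ n := by exact_mod_cast hi
    refine (L.norm_iteratedFDeriv_comp_left (f := φ) h.contDiff.contDiffAt hi').trans ?_
    rw [mul_assoc]
    gcongr
    exact h.bound i hi x

protected lemma neg (h : PolyBdd n φ C N) : PolyBdd n (fun x => -φ x) C N where
  contDiff := h.contDiff.neg
  bound i hi x := by
    have : (fun x => -φ x) = -φ := rfl
    rw [this, iteratedFDeriv_neg_apply, norm_neg]
    exact h.bound i hi x

lemma prodMk {ψ : E → G} (h : PolyBdd n φ C N) (h' : PolyBdd n ψ D N) :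
    PolyBdd n (fun x => (φ x, ψ x)) (C + D) N := by
  have h1 := h.clm_comp (ContinuousLinearMap.inl ℝ F G)
  have h2 := h'.clm_comp (ContinuousLinearMap.inr ℝ F G)
  refine PolyBdd.mono (C := ‖ContinuousLinearMap.inl ℝ F G‖ * C +
    ‖ContinuousLinearMap.inr ℝ F G‖ * D) ?_ ?_ le_rfl
  · simpa using h1.add h2
  · exact add_le_add
      (mul_le_of_le_one_left h.nonneg (ContinuousLinearMap.norm_inl_le_one ℝ F G))
      (mul_le_of_le_one_left h'.nonneg (ContinuousLinearMap.norm_inr_le_one ℝ F G))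

lemma clm (L : E →L[ℝ] F) : PolyBdd n L ‖L‖ 1 where
  contDiff := L.contDiff
  bound i _ x := by
    have h0 := norm_nonneg x
    have h1 := norm_nonneg L
    rcases i with _ | i
    · simp only [norm_iteratedFDeriv_zero, pow_one]
      exact (L.le_opNorm x).trans (by nlinarith)
    · rw [← norm_iteratedFDeriv_fderiv]
      have : fderiv ℝ L = fun _ => L := by ext1 x; exact L.fderiv
      rw [this]
      have := (PolyBdd.const (n := i) (E := E) L).bound i le_rfl x
      simp only [pow_zero, mul_one] at this
      rw [pow_one]
      nlinarith

lemma bilin (B : F →L[ℝ] G →L[ℝ] H) {ψ : E → G} (h : PolyBdd n φ C N)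
    (h' : PolyBdd n ψ D M) :
    PolyBdd n (fun x => B (φ x) (ψ x)) (‖B‖ * (2 ^ n * C * D)) (N + M) where
  contDiff := (B.contDiff.comp h.contDiff).clm_apply h'.contDiff
  bound i hi x := by
    have hi' : (i : WithTop ℕ∞) ≤ n := by exact_mod_cast hi
    refine (B.norm_iteratedFDeriv_le_of_bilinear h.contDiff h'.contDiff x hi').trans ?_
    have hC := h.nonneg
    have hD := h'.nonneg
    have key : ∑ k ∈ Finset.range (i + 1), (i.choose k : ℝ) * ‖iteratedFDeriv ℝ k φ x‖ *
        ‖iteratedFDeriv ℝ (i - k) ψ x‖ ≤ ∑ k ∈ Finset.range (i + 1), (i.choose k : ℝ) *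
          (C * (1 + ‖x‖) ^ N) * (D * (1 + ‖x‖) ^ M) := by
      refine Finset.sum_le_sum fun k hk => ?_
      have hk' : k ≤ i := by simpa [Nat.lt_succ_iff] using hk
      gcongr
      · exact h.bound k (hk'.trans hi) x
      · exact h'.bound _ ((Nat.sub_le _ _).trans hi) x
    have hsum : ∑ k ∈ Finset.range (i + 1), (i.choose k : ℝ) = 2 ^ i := by
      exact_mod_cast Nat.sum_range_choose i
    rw [← Finset.sum_mul, ← Finset.sum_mul, hsum] at key
    have h2 : (2 : ℝ) ^ i ≤ 2 ^ n := pow_le_pow_right₀ (by norm_num) hi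
    calc _ ≤ ‖B‖ * (2 ^ i * (C * (1 + ‖x‖) ^ N) * (D * (1 + ‖x‖) ^ M)) := by gcongr
      _ ≤ ‖B‖ * (2 ^ n * (C * (1 + ‖x‖) ^ N) * (D * (1 + ‖x‖) ^ M)) := by gcongr
      _ = _ := by rw [pow_add]; ring

lemma comp {ψ : F → G} (hψ : PolyBdd n ψ D M) (h : PolyBdd n φ C N) :
    PolyBdd n (fun x => ψ (φ x)) (n.factorial * D * (1 + C) ^ (M + n)) (N * (M + n)) where
  contDiff := hψ.contDiff.comp h.contDiff
  bound i hi x := by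
    have hi' : (i : WithTop ℕ∞) ≤ n := by exact_mod_cast hi
    have hC := h.nonneg
    have hD := hψ.nonneg
    set s := (1 + ‖x‖) ^ N with hs
    have hs1 : 1 ≤ s := one_le_pow₀ (by linarith [norm_nonneg x])
    -- The composition estimate wants the j-th derivative of the inner map bounded by a j-th power;
    -- with 1 + C in place of C the base is at least 1, so its first power already works.
    have hA : 1 ≤ (1 + C) * s := by nlinarith
    have key := norm_iteratedFDeriv_comp_le (g := ψ) (f := φ) hψ.contDiff h.contDiff hi' x
      (C := D * ((1 + C) * s) ^ M) (D := (1 + C) * s) (fun j hj => by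
        refine (hψ.bound j (hj.trans hi) _).trans ?_
        have := h.norm_le x
        gcongr
        nlinarith) (fun j hj1 hj => by
        refine (h.bound j (hj.trans hi) x).trans ?_
        calc C * s ≤ (1 + C) * s := by nlinarith
          _ ≤ _ := le_self_pow₀ hA (by omega))
    refine key.trans ?_
    have hf : (i.factorial : ℝ) ≤ n.factorial := by exact_mod_cast Nat.factorial_le hi
    have hp : ((1 + C) * s) ^ i ≤ ((1 + C) * s) ^ n := pow_le_pow_right₀ hA hi
    calc _ ≤ (n.factorial : ℝ) * (D * ((1 + C) * s) ^ M) * ((1 + C) * s) ^ n := by gcongr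
      _ = _ := by rw [pow_mul, ← hs, mul_pow, mul_pow, pow_add, pow_add]; ring

end PolyBdd

/-- A family of continuous linear maps on a finite-dimensional space is measurable if it is
pointwise. -/
lemma stronglyMeasurable_clm_of_apply [FiniteDimensional ℝ E] {T : Type*} [MeasurableSpace T]
    {A : T → E →L[ℝ] F} (hA : ∀ v, StronglyMeasurable fun τ => A τ v) : StronglyMeasurable A := by
  let b := Module.finBasis ℝ E
  have : A = fun τ => ∑ i, ContinuousLinearMap.smulRightL ℝ E F
      (LinearMap.toContinuousLinearMap (b.coord i)) (A τ (b i)) := by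
    ext τ v
    conv_lhs => rw [← b.sum_repr v]
    simp only [map_sum, map_smul]
    simp
  rw [this]
  exact Finset.stronglyMeasurable_fun_sum _ fun i _ =>
    (ContinuousLinearMap.continuous _).comp_stronglyMeasurable (hA (b i))

/-- Directional derivatives are limits of difference quotients with steps 1/n, and in finite
dimension they determine the derivative. -/
lemma stronglyMeasurable_fderiv_param [FiniteDimensional ℝ E] {T : Type*} [MeasurableSpace T]
    {Ψ : T → E → F} (hΨ : ∀ x, StronglyMeasurable fun τ => Ψ τ x)
    (hd : ∀ τ, Differentiable ℝ (Ψ τ)) (x : E) :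
    StronglyMeasurable fun τ => fderiv ℝ (Ψ τ) x := by
  refine stronglyMeasurable_clm_of_apply fun v => ?_
  refine stronglyMeasurable_of_tendsto atTop
    (f := fun (n : ℕ) τ => ((n : ℝ)) • (Ψ τ (x + ((n : ℝ))⁻¹ • v) - Ψ τ x))
    (fun n => (((hΨ _).sub (hΨ _)).const_smul _)) ?_
  rw [tendsto_pi_nhds]
  intro τ
  have := (hd τ x).hasFDerivAt
  exact this.lim v (tendsto_norm_atTop_atTop.comp tendsto_natCast_atTop_atTop)

lemma aestronglyMeasurable_clm_of_apply [FiniteDimensional ℝ E] {T : Type*} [MeasurableSpace T]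
    {μ : Measure T} {A : T → E →L[ℝ] F} (hA : ∀ v, AEStronglyMeasurable (fun τ => A τ v) μ) :
    AEStronglyMeasurable A μ := by
  let b := Module.finBasis ℝ E
  have : A = fun τ => ∑ i, ContinuousLinearMap.smulRightL ℝ E F
      (LinearMap.toContinuousLinearMap (b.coord i)) (A τ (b i)) := by
    ext τ v
    conv_lhs => rw [← b.sum_repr v]
    simp only [map_sum, map_smul]
    simp
  rw [this]
  exact Finset.aestronglyMeasurable_fun_sum _ fun i _ =>
    (ContinuousLinearMap.continuous _).comp_aestronglyMeasurable (hA (b i))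

lemma aestronglyMeasurable_fderiv_param [FiniteDimensional ℝ E] {T : Type*} [MeasurableSpace T]
    {μ : Measure T} {Ψ : T → E → F} (hΨ : ∀ x, AEStronglyMeasurable (fun τ => Ψ τ x) μ)
    (hd : ∀ τ, Differentiable ℝ (Ψ τ)) (x : E) :
    AEStronglyMeasurable (fun τ => fderiv ℝ (Ψ τ) x) μ := by
  refine aestronglyMeasurable_clm_of_apply fun v => ?_
  refine aestronglyMeasurable_of_tendsto_ae atTop
    (f := fun (n : ℕ) τ => ((n : ℝ)) • (Ψ τ (x + ((n : ℝ))⁻¹ • v) - Ψ τ x))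
    (fun n => (((hΨ _).sub (hΨ _)).const_smul _)) (ae_of_all _ fun τ => ?_)
  have := (hd τ x).hasFDerivAt
  exact this.lim v (tendsto_norm_atTop_atTop.comp tendsto_natCast_atTop_atTop)

section Integral

variable {T : Type*} [MeasurableSpace T] {μ : Measure T} {κ : T → ℝ} {n N : ℕ}

lemma PolyBdd.integrable {Ψ : T → E → F} (hκ : Integrable κ μ)
    (hΨ : ∀ τ, PolyBdd n (Ψ τ) (κ τ) N) (hm : ∀ x, AEStronglyMeasurable (fun τ => Ψ τ x) μ)
    (x : E) : Integrable (fun τ => Ψ τ x) μ :=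
  (hκ.mul_const ((1 + ‖x‖) ^ N)).mono' (hm x) (ae_of_all _ fun τ => (hΨ τ).norm_le x)

lemma PolyBdd.hasFDerivAt_integral [FiniteDimensional ℝ E] {Ψ : T → E → F} (hκ : Integrable κ μ)
    (hn : 1 ≤ n) (hΨ : ∀ τ, PolyBdd n (Ψ τ) (κ τ) N)
    (hm : ∀ x, AEStronglyMeasurable (fun τ => Ψ τ x) μ) (x : E) :
    HasFDerivAt (fun y => ∫ τ, Ψ τ y ∂μ) (∫ τ, fderiv ℝ (Ψ τ) x ∂μ) x := by
  refine hasFDerivAt_integral_of_dominated_of_fderiv_le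
    (bound := fun τ => κ τ * (1 + (‖x‖ + 1)) ^ N) (Metric.ball_mem_nhds x one_pos)
    (Eventually.of_forall hm) (PolyBdd.integrable hκ hΨ hm x)
    (aestronglyMeasurable_fderiv_param hm (fun τ => (hΨ τ).differentiable hn) x)
    (ae_of_all _ fun τ y hy => ?_) (hκ.mul_const _)
    (ae_of_all _ fun τ y _ => (hΨ τ).hasFDerivAt hn y)
  refine ((hΨ τ).norm_fderiv_le hn y).trans ?_
  have h1 : ‖y‖ ≤ ‖x‖ + 1 := by
    have : ‖y - x‖ < 1 := by simpa [dist_eq_norm] using hy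
    linarith [norm_le_norm_add_norm_sub' y x]
  have := (hΨ τ).nonneg
  gcongr

end Integral

/-- Induction on n: the derivative of the integral is the integral of the derivatives, which satisfy
the same bounds to one order less. The target changes from F to E →L[ℝ] F in each step, so E and F
have to share a universe. -/
lemma PolyBdd.integral {E : Type u} [NormedAddCommGroup E] [NormedSpace ℝ E]
    [FiniteDimensional ℝ E] {T : Type*} [MeasurableSpace T] {μ : Measure T} {κ : T → ℝ} {N : ℕ}
    (hκ : Integrable κ μ) (n : ℕ) :
    ∀ {F : Type u} [NormedAddCommGroup F] [NormedSpace ℝ F] {Ψ : T → E → F}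
      (_ : ∀ τ, PolyBdd n (Ψ τ) (κ τ) N) (_ : ∀ x, AEStronglyMeasurable (fun τ => Ψ τ x) μ),
      PolyBdd n (fun x => ∫ τ, Ψ τ x ∂μ) (∫ τ, κ τ ∂μ) N := by
  have h0 : ∀ {F : Type u} [NormedAddCommGroup F] [NormedSpace ℝ F] {Ψ : T → E → F} {n : ℕ}
      (_ : ∀ τ, PolyBdd n (Ψ τ) (κ τ) N), ∀ x,
      ‖∫ τ, Ψ τ x ∂μ‖ ≤ (∫ τ, κ τ ∂μ) * (1 + ‖x‖) ^ N := by
    intro F _ _ Ψ n hΨ x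
    rw [← integral_mul_const]
    exact norm_integral_le_of_norm_le (hκ.mul_const _) (ae_of_all _ fun τ => (hΨ τ).norm_le x)
  induction n with
  | zero =>
    intro F _ _ Ψ hΨ hm
    refine ⟨?_, fun i hi x => ?_⟩
    · simp only [Nat.cast_zero, contDiff_zero]
      rw [continuous_iff_continuousAt]
      intro x
      refine continuousAt_of_dominated (bound := fun τ => κ τ * (1 + (‖x‖ + 1)) ^ N)
        (Eventually.of_forall hm) ?_ (hκ.mul_const _)
        (ae_of_all _ fun τ => (hΨ τ).continuous.continuousAt)
      filter_upwards [Metric.ball_mem_nhds x one_pos] with y hy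
      refine ae_of_all _ fun τ => ((hΨ τ).norm_le y).trans ?_
      have h1 : ‖y‖ ≤ ‖x‖ + 1 := by
        have : ‖y - x‖ < 1 := by simpa [dist_eq_norm] using hy
        linarith [norm_le_norm_add_norm_sub' y x]
      have := (hΨ τ).nonneg
      gcongr
    · obtain rfl : i = 0 := by omega
      simpa using h0 hΨ x
  | succ n ih =>
    intro F _ _ Ψ hΨ hm
    have hd := fun x => PolyBdd.hasFDerivAt_integral hκ (Nat.succ_pos n) hΨ hm x
    refine PolyBdd.of_fderiv (h0 hΨ) (fun x => (hd x).differentiableAt) ?_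
    have : fderiv ℝ (fun x => ∫ τ, Ψ τ x ∂μ) = fun x => ∫ τ, fderiv ℝ (Ψ τ) x ∂μ := by
      ext1 x; exact (hd x).fderiv
    rw [this]
    exact ih (fun τ => (hΨ τ).fderiv)
      (aestronglyMeasurable_fderiv_param hm (fun τ => (hΨ τ).differentiable (Nat.succ_pos n)))

lemma PolyBdd.tsum [CompleteSpace F] {ι : Type*} {n : ℕ} {u : ι → ℝ} {f : ι → E → F}
    (hu : Summable u) (hf : ∀ k, PolyBdd n (f k) (u k) 0) :
    PolyBdd n (fun x => ∑' k, f k x) (∑' k, u k) 0 := by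
  have hb : ∀ (i : ℕ) (k : ι) (x : E), (i : ℕ∞) ≤ n → ‖iteratedFDeriv ℝ i (f k) x‖ ≤ u k := by
    intro i k x hi
    simpa using (hf k).bound i (by exact_mod_cast hi) x
  have hc : ∀ k, ContDiff ℝ ((n : ℕ∞) : WithTop ℕ∞) (f k) := fun k => by exact_mod_cast (hf k).contDiff
  refine ⟨?_, fun i hi x => ?_⟩
  · have := contDiff_tsum (𝕜 := ℝ) (N := n) (v := fun _ => u) hc (fun _ _ => hu) hb
    exact_mod_cast this
  · have hi' : (i : ℕ∞) ≤ n := by exact_mod_cast hi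
    rw [iteratedFDeriv_tsum_apply (𝕜 := ℝ) (N := n) (v := fun _ => u) hc (fun _ _ => hu) hb hi']
    rw [pow_zero, mul_one]
    exact tsum_of_norm_bounded hu.hasSum fun k => hb i k x hi'

end PolyBdd

/-! ### Binomial series for (1 - z)^(-1/2) and (1 - z)^(1/2) in a Banach algebra. -/

section BinomialSeries

/-- The coefficients of the power series of `(1 - z)^(-1/2)`. -/
def rootCoeff (k : ℕ) : ℝ := k.centralBinom / 4 ^ k

lemma rootCoeff_zero : rootCoeff 0 = 1 := by simp [rootCoeff]

lemma rootCoeff_nonneg (k : ℕ) : 0 ≤ rootCoeff k := by unfold rootCoeff; positivity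

lemma rootCoeff_succ (k : ℕ) : (2 * k + 2) * rootCoeff (k + 1) = (2 * k + 1) * rootCoeff k := by
  have h : ((k : ℝ) + 1) * (k + 1).centralBinom = 2 * (2 * k + 1) * k.centralBinom := by
    exact_mod_cast Nat.succ_mul_centralBinom_succ k
  unfold rootCoeff
  rw [pow_succ]
  field_simp
  linarith

lemma rootCoeff_succ_le (k : ℕ) : rootCoeff (k + 1) ≤ rootCoeff k := by
  have h := rootCoeff_succ k
  have h0 := rootCoeff_nonneg k
  have hk : (0 : ℝ) ≤ k := k.cast_nonneg
  by_contra hlt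
  push Not at hlt
  nlinarith

lemma rootCoeff_le_one (k : ℕ) : rootCoeff k ≤ 1 := by
  induction k with
  | zero => exact rootCoeff_zero.le
  | succ k ih => exact (rootCoeff_succ_le k).trans ih

/-- The square of (1 - z)^(-1/2) is the geometric series. If S_n is this sum, symmetry gives n S_n =
2 ∑ p₁ c_{p₁} c_{p₂}; shifting p₁ and using the recursion of the coefficients turns (n + 1) S_{n+1}
into ∑ (2p₁ + 1) c_{p₁} c_{p₂} = (n + 1) S_n. -/
lemma sum_antidiagonal_rootCoeff (n : ℕ) :
    ∑ p ∈ Finset.HasAntidiagonal.antidiagonal n, rootCoeff p.1 * rootCoeff p.2 = 1 := by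
  induction n with
  | zero => simp [rootCoeff_zero]
  | succ n ih =>
    have swap : ∀ m : ℕ, ∑ p ∈ Finset.HasAntidiagonal.antidiagonal m, (p.2 : ℝ) * (rootCoeff p.1 * rootCoeff p.2)
        = ∑ p ∈ Finset.HasAntidiagonal.antidiagonal m, (p.1 : ℝ) * (rootCoeff p.1 * rootCoeff p.2) := by
      intro m
      rw [← Finset.Nat.sum_antidiagonal_swap]
      exact Finset.sum_congr rfl fun p _ => by simp [mul_comm]
    have total : ∀ m : ℕ, (m : ℝ) * ∑ p ∈ Finset.HasAntidiagonal.antidiagonal m, rootCoeff p.1 * rootCoeff p.2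
        = 2 * ∑ p ∈ Finset.HasAntidiagonal.antidiagonal m, (p.1 : ℝ) * (rootCoeff p.1 * rootCoeff p.2) := by
      intro m
      rw [two_mul]
      nth_rewrite 2 [← swap m]
      rw [← Finset.sum_add_distrib, Finset.mul_sum]
      refine Finset.sum_congr rfl fun p hp => ?_
      rw [← Finset.HasAntidiagonal.mem_antidiagonal.1 hp]
      push_cast
      ring
    have h1 := total (n + 1)
    rw [Finset.Nat.sum_antidiagonal_succ
      (f := fun p => (p.1 : ℝ) * (rootCoeff p.1 * rootCoeff p.2))] at h1
    have h2 : 2 * ∑ p ∈ Finset.HasAntidiagonal.antidiagonal n, (((p.1 + 1 : ℕ)) : ℝ) *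
        (rootCoeff (p.1 + 1) * rootCoeff p.2) =
        ∑ p ∈ Finset.HasAntidiagonal.antidiagonal n, (2 * (p.1 : ℝ) + 1) * (rootCoeff p.1 * rootCoeff p.2) := by
      rw [Finset.mul_sum]
      refine Finset.sum_congr rfl fun p _ => ?_
      have := rootCoeff_succ p.1
      push_cast
      linear_combination rootCoeff p.2 * this
    have h3 : ∑ p ∈ Finset.HasAntidiagonal.antidiagonal n, (2 * (p.1 : ℝ) + 1) * (rootCoeff p.1 * rootCoeff p.2)
        = (n : ℝ) * ∑ p ∈ Finset.HasAntidiagonal.antidiagonal n, rootCoeff p.1 * rootCoeff p.2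
          + ∑ p ∈ Finset.HasAntidiagonal.antidiagonal n, rootCoeff p.1 * rootCoeff p.2 := by
      rw [total n, Finset.mul_sum, ← Finset.sum_add_distrib]
      exact Finset.sum_congr rfl fun p _ => by ring
    simp only [Nat.cast_zero, zero_mul, zero_add] at h1
    rw [h2, h3, ih] at h1
    have hn : ((n + 1 : ℕ) : ℝ) ≠ 0 := by positivity
    apply mul_left_cancel₀ hn
    rw [h1]; push_cast; ring

/-- The negatives of the coefficients of `(1 - z)^(1/2)`, without the constant term. -/
def sqrtCoeff (k : ℕ) : ℝ := rootCoeff k - rootCoeff (k + 1)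

lemma sqrtCoeff_nonneg (k : ℕ) : 0 ≤ sqrtCoeff k := sub_nonneg.2 (rootCoeff_succ_le k)

/-- The sum telescopes. Unlike the series for (1 - z)^(-1/2), the one for the square root therefore
converges absolutely up to norm one, which keeps the covariance root under control as t → 0. -/
lemma summable_sqrtCoeff : Summable sqrtCoeff := by
  refine summable_of_sum_range_le sqrtCoeff_nonneg (c := 1) fun n => ?_
  have : ∑ i ∈ Finset.range n, sqrtCoeff i = rootCoeff 0 - rootCoeff n :=
    Finset.sum_range_sub' rootCoeff n
  rw [this, rootCoeff_zero]
  linarith [rootCoeff_nonneg n]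

variable {𝔸 : Type*} [NormedRing 𝔸] [NormedAlgebra ℝ 𝔸] [CompleteSpace 𝔸]

/-- The power series of `(1 - A)^(-1/2)`. -/
def invSqrt (A : 𝔸) : 𝔸 := ∑' k, rootCoeff k • A ^ k

lemma summable_norm_pow {A : 𝔸} (hA : ‖A‖ < 1) : Summable fun k : ℕ => ‖A ^ k‖ := by
  rw [← summable_nat_add_iff 1]
  refine Summable.of_nonneg_of_le (fun _ => norm_nonneg _) (fun k => norm_pow_le' A k.succ_pos)
    ((summable_nat_add_iff 1).2 (summable_geometric_of_lt_one (norm_nonneg _) hA))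

lemma summable_norm_invSqrt {A : 𝔸} (hA : ‖A‖ < 1) :
    Summable fun k => ‖rootCoeff k • A ^ k‖ := by
  refine Summable.of_nonneg_of_le (fun _ => norm_nonneg _) (fun k => ?_) (summable_norm_pow hA)
  rw [norm_smul, Real.norm_of_nonneg (rootCoeff_nonneg k)]
  exact mul_le_of_le_one_left (norm_nonneg _) (rootCoeff_le_one k)

lemma invSqrt_mul_self {A : 𝔸} (hA : ‖A‖ < 1) : invSqrt A * invSqrt A = ∑' k, A ^ k := by
  unfold invSqrt
  rw [tsum_mul_tsum_eq_tsum_sum_antidiagonal_of_summable_norm (summable_norm_invSqrt hA)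
    (summable_norm_invSqrt hA)]
  refine tsum_congr fun n => ?_
  have : ∀ p ∈ Finset.HasAntidiagonal.antidiagonal n, (rootCoeff p.1 • A ^ p.1) * (rootCoeff p.2 • A ^ p.2)
      = (rootCoeff p.1 * rootCoeff p.2) • A ^ n := by
    intro p hp
    rw [smul_mul_smul_comm, ← pow_add, Finset.HasAntidiagonal.mem_antidiagonal.1 hp]
  rw [Finset.sum_congr rfl this, ← Finset.sum_smul, sum_antidiagonal_rootCoeff, one_smul]

lemma invSqrt_mul_self_mul {A : 𝔸} (hA : ‖A‖ < 1) : invSqrt A * invSqrt A * (1 - A) = 1 := by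
  rw [invSqrt_mul_self hA, geom_series_mul_neg A hA]

lemma Commute.invSqrt_right {A B : 𝔸} (h : Commute B A) : Commute B (invSqrt A) :=
  Commute.tsum_right _ fun k => (h.pow_right k).smul_right _

/-- The left side is (1 - A)^(1/2); multiplying the series by 1 - A turns its coefficients into
consecutive differences. -/
lemma one_sub_mul_invSqrt {A : 𝔸} (hA : ‖A‖ < 1) :
    (1 - A) * invSqrt A = 1 - ∑' k, sqrtCoeff k • A ^ (k + 1) := by
  have hs : Summable fun k => rootCoeff k • A ^ k := (summable_norm_invSqrt hA).of_norm
  have hs1 : Summable fun k => rootCoeff (k + 1) • A ^ (k + 1) := (summable_nat_add_iff 1).2 hs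
  have hs2 : Summable fun k => rootCoeff k • A ^ (k + 1) := by
    have := hs.mul_left A
    simpa only [mul_smul_comm, ← pow_succ'] using this
  have h1 : invSqrt A = 1 + ∑' k, rootCoeff (k + 1) • A ^ (k + 1) := by
    unfold invSqrt
    rw [hs.tsum_eq_zero_add]
    simp [rootCoeff_zero]
  have h2 : A * invSqrt A = ∑' k, rootCoeff k • A ^ (k + 1) := by
    unfold invSqrt
    rw [← hs.tsum_mul_left]
    simp only [mul_smul_comm, ← pow_succ']
  rw [sub_mul, one_mul, h2]
  unfold sqrtCoeff
  simp only [sub_smul]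
  rw [hs2.tsum_sub hs1, h1]
  abel

lemma sq_one_sub_tsum_sqrtCoeff {A : 𝔸} (hA : ‖A‖ < 1) :
    (1 - ∑' k, sqrtCoeff k • A ^ (k + 1)) * (1 - ∑' k, sqrtCoeff k • A ^ (k + 1)) = 1 - A := by
  rw [← one_sub_mul_invSqrt hA]
  have hc : Commute (1 - A) (invSqrt A) :=
    Commute.invSqrt_right (((Commute.one_left A).sub_left (Commute.refl A)))
  calc (1 - A) * invSqrt A * ((1 - A) * invSqrt A)
      = (1 - A) * (invSqrt A * (1 - A)) * invSqrt A := by noncomm_ring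
    _ = (1 - A) * ((1 - A) * invSqrt A) * invSqrt A := by rw [hc.eq]
    _ = (1 - A) * ((1 - A) * (invSqrt A * invSqrt A)) := by noncomm_ring
    _ = (1 - A) * ((invSqrt A * invSqrt A) * (1 - A)) := by
        rw [(hc.mul_right hc).eq]
    _ = 1 - A := by rw [invSqrt_mul_self_mul hA, mul_one]

end BinomialSeries

/-! ### Operator families: geometric decay of powers in C², and exponentials. -/

section Families

variable {E 𝔸 : Type*} [NormedAddCommGroup E] [NormedSpace ℝ E] [NormedRing 𝔸] [NormedAlgebra ℝ 𝔸]

lemma PolyBdd.mul {n N M : ℕ} {C D : ℝ} {f g : E → 𝔸} (hf : PolyBdd n f C N)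
    (hg : PolyBdd n g D M) : PolyBdd n (fun x => f x * g x) (2 ^ n * C * D) (N + M) := by
  refine (hf.bilin (ContinuousLinearMap.mul ℝ 𝔸) hg).mono ?_ le_rfl
  have := hf.nonneg
  have := hg.nonneg
  exact mul_le_of_le_one_left (by positivity) (ContinuousLinearMap.opNorm_mul_le ℝ 𝔸)

/-- The second-order jet of `f` at `x`, measured by a norm that is submultiplicative. -/
def jetNorm (ε : ℝ) (f : E → 𝔸) (x : E) : ℝ :=
  ‖f x‖ + ε * ‖iteratedFDeriv ℝ 1 f x‖ + ε ^ 2 / 2 * ‖iteratedFDeriv ℝ 2 f x‖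

/-- With weights ε^k / k! the Leibniz rule becomes the product of two polynomials in ε truncated at
order two; the discarded terms are nonnegative. -/
lemma jetNorm_mul_le {ε : ℝ} (hε : 0 ≤ ε) {f g : E → 𝔸} (hf : ContDiff ℝ 2 f)
    (hg : ContDiff ℝ 2 g) (x : E) :
    jetNorm ε (fun y => f y * g y) x ≤ jetNorm ε f x * jetNorm ε g x := by
  have h1 : ‖iteratedFDeriv ℝ 1 (fun y => f y * g y) x‖ ≤ ‖f x‖ * ‖iteratedFDeriv ℝ 1 g x‖ +
      ‖iteratedFDeriv ℝ 1 f x‖ * ‖g x‖ :=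
    (norm_iteratedFDeriv_mul_le hf hg x (n := 1) (by norm_num)).trans_eq
      (by simp [Finset.sum_range_succ])
  have h2 : ‖iteratedFDeriv ℝ 2 (fun y => f y * g y) x‖ ≤ ‖f x‖ * ‖iteratedFDeriv ℝ 2 g x‖ +
      2 * ‖iteratedFDeriv ℝ 1 f x‖ * ‖iteratedFDeriv ℝ 1 g x‖ +
      ‖iteratedFDeriv ℝ 2 f x‖ * ‖g x‖ :=
    (norm_iteratedFDeriv_mul_le hf hg x (n := 2) (by norm_num)).trans_eq
      (by simp [Finset.sum_range_succ])
  have h0 := norm_mul_le (f x) (g x)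
  unfold jetNorm
  set a0 := ‖f x‖
  set b0 := ‖g x‖
  set a1 := ‖iteratedFDeriv ℝ 1 f x‖
  set b1 := ‖iteratedFDeriv ℝ 1 g x‖
  set a2 := ‖iteratedFDeriv ℝ 2 f x‖
  set b2 := ‖iteratedFDeriv ℝ 2 g x‖
  have ha0 : 0 ≤ a0 := norm_nonneg _
  have hb0 : 0 ≤ b0 := norm_nonneg _
  have ha1 : 0 ≤ a1 := norm_nonneg _
  have hb1 : 0 ≤ b1 := norm_nonneg _
  have ha2 : 0 ≤ a2 := norm_nonneg _
  have hb2 : 0 ≤ b2 := norm_nonneg _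
  have e1 := mul_le_mul_of_nonneg_left h1 hε
  have e2 := mul_le_mul_of_nonneg_left h2 (show 0 ≤ ε ^ 2 / 2 by positivity)
  have r1 : 0 ≤ ε ^ 3 * (a1 * b2) := by positivity
  have r2 : 0 ≤ ε ^ 3 * (a2 * b1) := by positivity
  have r3 : 0 ≤ ε ^ 4 * (a2 * b2) := by positivity
  nlinarith

/-- Powers of a family of operators with norm less than one decay geometrically in `C²`. -/
lemma PolyBdd.exists_pow_bound (h1 : ‖(1 : 𝔸)‖ ≤ 1) {w : E → 𝔸} {C ρ : ℝ} (hw : PolyBdd 2 w C 0)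
    (hρ : ρ < 1) (hρ0 : 0 ≤ ρ) (hwρ : ∀ x, ‖w x‖ ≤ ρ) :
    ∃ C' r : ℝ, 0 < r ∧ r < 1 ∧ ∀ n : ℕ, PolyBdd 2 (fun x => w x ^ n) (C' * r ^ n) 0 := by
  have hC := hw.nonneg
  -- Small enough that the derivative terms add at most 2εC ≤ (1 - ρ)/2 to ‖w‖ ≤ ρ, so the jet norm
  -- of w is at most r = (1 + ρ)/2 < 1.
  set ε : ℝ := (1 - ρ) / (4 * (C + 1)) with hε
  have hε0 : 0 < ε := by have : 0 < 1 - ρ := by linarith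
                         positivity
  have hεC : ε * (C + 1) = (1 - ρ) / 4 := by rw [hε]; field_simp
  have hε1 : ε ≤ 1 := by nlinarith
  set r : ℝ := (1 + ρ) / 2 with hr
  have hb : ∀ n : ℕ, ContDiff ℝ 2 (fun x => w x ^ n) ∧ ∀ x, jetNorm ε (fun x => w x ^ n) x ≤ r ^ n := by
    intro n
    induction n with
    | zero =>
      refine ⟨by simpa using contDiff_const, fun x => ?_⟩
      simp only [pow_zero, jetNorm]
      rw [iteratedFDeriv_const_of_ne one_ne_zero, iteratedFDeriv_const_of_ne two_ne_zero]
      simpa using h1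
    | succ n ih =>
      have hw2 : ContDiff ℝ 2 w := hw.contDiff
      refine ⟨by simpa only [pow_succ] using ih.1.mul hw2, fun x => ?_⟩
      simp only [pow_succ]
      refine (jetNorm_mul_le hε0.le ih.1 hw2 x).trans ?_
      have hwx : jetNorm ε w x ≤ r := by
        have b1 := hw.bound 1 (by norm_num) x
        have b2 := hw.bound 2 le_rfl x
        rw [pow_zero, mul_one] at b1 b2
        have e1 := mul_le_mul_of_nonneg_left b1 hε0.le
        have e2 := mul_le_mul_of_nonneg_left b2 (show 0 ≤ ε ^ 2 / 2 by positivity)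
        have e3 : ε ^ 2 / 2 * C ≤ ε * C := by
          have : ε ^ 2 ≤ ε * 1 := by rw [sq]; gcongr
          nlinarith
        unfold jetNorm
        nlinarith [hwρ x]
      have hn : 0 ≤ jetNorm ε (fun x => w x ^ n) x := by unfold jetNorm; positivity
      exact mul_le_mul (ih.2 x) hwx (by unfold jetNorm; positivity) (by positivity)
  -- The three summands undo the weights 1, ε and ε²/2 of the jet norm.
  refine ⟨1 + 1 / ε + 2 / ε ^ 2, r, by positivity, by linarith, fun n => ⟨(hb n).1, ?_⟩⟩
  intro i hi x
  have hj := (hb n).2 x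
  unfold jetNorm at hj
  have hrn : 0 < r ^ n := by positivity
  have n0 : 0 ≤ ‖w x ^ n‖ := norm_nonneg _
  have n1 := norm_nonneg (iteratedFDeriv ℝ 1 (fun x => w x ^ n) x)
  have n2 := norm_nonneg (iteratedFDeriv ℝ 2 (fun x => w x ^ n) x)
  have p1 : 0 < 1 / ε := by positivity
  have p2 : 0 < 2 / ε ^ 2 := by positivity
  rw [pow_zero, mul_one]
  have m1 : 0 ≤ ε * ‖iteratedFDeriv ℝ 1 (fun x => w x ^ n) x‖ := by positivity
  have m2 : 0 ≤ ε ^ 2 / 2 * ‖iteratedFDeriv ℝ 2 (fun x => w x ^ n) x‖ := by positivity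
  interval_cases i
  · rw [norm_iteratedFDeriv_zero]
    nlinarith
  · have : ‖iteratedFDeriv ℝ 1 (fun x => w x ^ n) x‖ ≤ 1 / ε * r ^ n := by
      rw [one_div, inv_mul_eq_div, le_div_iff₀ hε0]; nlinarith
    nlinarith
  · have : ‖iteratedFDeriv ℝ 2 (fun x => w x ^ n) x‖ ≤ 2 / ε ^ 2 * r ^ n := by
      rw [div_mul_eq_mul_div, le_div_iff₀ (by positivity)]; nlinarith
    nlinarith

variable [CompleteSpace 𝔸]

lemma PolyBdd.const_smul {F : Type*} [NormedAddCommGroup F] [NormedSpace ℝ F] {n N : ℕ} {C : ℝ}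
    {φ : E → F} (h : PolyBdd n φ C N) (a : ℝ) : PolyBdd n (fun x => a • φ x) (|a| * C) N := by
  have := h.clm_comp (a • ContinuousLinearMap.id ℝ F)
  refine PolyBdd.mono (by simpa using this) ?_ le_rfl
  have h1 : ‖a • ContinuousLinearMap.id ℝ F‖ ≤ |a| := by
    rw [norm_smul, Real.norm_eq_abs]
    exact mul_le_of_le_one_right (abs_nonneg a) ContinuousLinearMap.norm_id_le
  exact mul_le_mul_of_nonneg_right h1 h.nonneg

lemma PolyBdd.invSqrt {w : E → 𝔸} {C r : ℝ} (hr0 : 0 ≤ r) (hr : r < 1)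
    (hw : ∀ n : ℕ, PolyBdd 2 (fun x => w x ^ n) (C * r ^ n) 0) :
    PolyBdd 2 (fun x => invSqrt (w x)) (C / (1 - r)) 0 := by
  have hC : 0 ≤ C := by simpa using (hw 0).nonneg
  have hs : Summable fun n => C * r ^ n := (summable_geometric_of_lt_one hr0 hr).mul_left C
  have := PolyBdd.tsum hs (f := fun k x => rootCoeff k • w x ^ k) (n := 2) (fun k => by
    refine ((hw k).const_smul (rootCoeff k)).mono ?_ le_rfl
    rw [abs_of_nonneg (rootCoeff_nonneg k)]
    exact mul_le_of_le_one_left (by positivity) (rootCoeff_le_one k))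
  rwa [tsum_mul_left, tsum_geometric_of_lt_one hr0 hr, ← div_eq_mul_inv] at this

lemma exp_add_smul (x : 𝔸) (s t : ℝ) :
    NormedSpace.exp ((s + t) • x) = NormedSpace.exp (s • x) * NormedSpace.exp (t • x) := by
  let _ : NormedAlgebra ℚ 𝔸 := NormedAlgebra.restrictScalars ℚ ℝ 𝔸
  rw [add_smul]
  exact NormedSpace.exp_add_of_commute (((Commute.refl x).smul_left s).smul_right t)

/-- Since A = K(1 - w), the exponential is e^{-tK} e^{tKw}: an average of the powers of w with
Poisson weights of mean tK. Bounds on powers thus become bounds on the semigroup. -/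
lemma exp_neg_smul_eq_tsum {A w : 𝔸} {K t : ℝ} (hw : w = 1 - K⁻¹ • A) (hK : K ≠ 0) :
    NormedSpace.exp (-t • A) = ∑' n : ℕ, (Real.exp (-(t * K)) * ((t * K) ^ n / n.factorial)) • w ^ n := by
  let _ : NormedAlgebra ℚ 𝔸 := NormedAlgebra.restrictScalars ℚ ℝ 𝔸
  have hA : -t • A = algebraMap ℝ 𝔸 (-(t * K)) + (t * K) • w := by
    rw [hw, Algebra.algebraMap_eq_smul_one, smul_sub, smul_smul, mul_assoc, mul_inv_cancel₀ hK,
      mul_one, neg_smul, neg_smul]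
    abel
  rw [hA, NormedSpace.exp_add_of_commute (Algebra.commutes _ _),
    ← NormedSpace.algebraMap_exp_comm, ← Real.exp_eq_exp_ℝ, Algebra.algebraMap_eq_smul_one,
    smul_mul_assoc, one_mul, NormedSpace.exp_eq_tsum ℝ, ← tsum_const_smul'']
  refine tsum_congr fun n => ?_
  rw [smul_pow, smul_smul, smul_smul]
  congr 1
  ring

lemma hasSum_exp_weights (K t r : ℝ) : HasSum (fun n : ℕ => Real.exp (-(t * K)) *
    ((t * K) ^ n / n.factorial) * r ^ n) (Real.exp (-(K * (1 - r) * t))) := by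
  have h := (NormedSpace.exp_series_hasSum_exp' (𝕂 := ℝ) (t * K * r)).mul_left (Real.exp (-(t * K)))
  rw [← Real.exp_eq_exp_ℝ, ← Real.exp_add] at h
  have e : -(t * K) + t * K * r = -(K * (1 - r) * t) := by ring
  rw [e] at h
  refine h.congr_fun ?_
  intro n
  rw [mul_pow _ r, smul_eq_mul, div_eq_mul_inv]
  ring

/-- The Poisson average of r^n is exp(-K(1 - r)t), so geometric decay of the powers in C² becomes
exponential decay of the semigroup in C², uniformly in the parameter. -/
lemma PolyBdd.exp {A w : E → 𝔸} {C r K : ℝ} (hK : 0 < K)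
    (hw : ∀ n : ℕ, PolyBdd 2 (fun x => w x ^ n) (C * r ^ n) 0)
    (hA : ∀ x, w x = 1 - K⁻¹ • A x) (t : ℝ≥0) :
    PolyBdd 2 (fun x => NormedSpace.exp (-(t : ℝ) • A x)) (C * Real.exp (-(K * (1 - r) * t))) 0 := by
  have hs := (hasSum_exp_weights K t r).mul_left C
  have h0 : ∀ n : ℕ, 0 ≤ Real.exp (-((t : ℝ) * K)) * (((t : ℝ) * K) ^ n / n.factorial) := by
    intro n; positivity
  have := PolyBdd.tsum hs.summable (n := 2) (f := fun n x =>
    (Real.exp (-((t : ℝ) * K)) * (((t : ℝ) * K) ^ n / n.factorial)) • w x ^ n) (fun n => by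
      have h := (hw n).const_smul (Real.exp (-((t : ℝ) * K)) * (((t : ℝ) * K) ^ n / n.factorial))
      rw [abs_of_nonneg (h0 n)] at h
      exact h.mono (le_of_eq (by ring)) le_rfl)
  rw [hs.tsum_eq] at this
  simpa only [exp_neg_smul_eq_tsum (hA _) hK.ne'] using this

lemma norm_exp_neg_smul_lt_one {A : 𝔸} {K ρ : ℝ} (h1 : ‖(1 : 𝔸)‖ ≤ 1) (hK : 0 < K) (hρ : ρ < 1)
    (hA : ‖1 - K⁻¹ • A‖ ≤ ρ) {t : ℝ} (ht : 0 < t) : ‖NormedSpace.exp (-t • A)‖ < 1 := by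
  have hρ0 : 0 ≤ ρ := (norm_nonneg _).trans hA
  rw [exp_neg_smul_eq_tsum (w := 1 - K⁻¹ • A) rfl hK.ne']
  refine (tsum_of_norm_bounded (hasSum_exp_weights K t ρ) fun n => ?_).trans_lt ?_
  · rw [norm_smul, Real.norm_of_nonneg (by positivity)]
    gcongr
    rcases n with _ | n
    · simpa using h1
    · exact (norm_pow_le' _ n.succ_pos).trans (pow_le_pow_left₀ (norm_nonneg _) hA _)
  · rw [Real.exp_lt_one_iff, neg_lt_zero]
    have : 0 < 1 - ρ := by linarith
    positivity

end Families

/-! ### The semigroup, the stationary covariance root and the root at time t. -/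

section Operators

variable {H : Type*} [NormedAddCommGroup H] [InnerProductSpace ℝ H] [CompleteSpace H]

/-- `A` is a self-adjoint matrix such that `1 - K⁻¹ A` is a contraction with constant `ρ < 1`. -/
structure IsStable (K ρ : ℝ) (A : H →L[ℝ] H) : Prop where
  pos : 0 < K
  lt_one : ρ < 1
  norm_le : ‖1 - K⁻¹ • A‖ ≤ ρ
  symm : IsSelfAdjoint A

/-- Expanding ‖x - sAx‖² gives at most (1 - 2cs + M²s²)‖x‖², which is smallest at s = c/M²; hence K
= M²/c. -/
lemma norm_one_sub_le {A : H →L[ℝ] H} {c M : ℝ} (hc : 0 < c) (hcM : c ≤ M) (hM : ‖A‖ ≤ M)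
    (hA : ∀ x, c * ‖x‖ ^ 2 ≤ inner ℝ x (A x)) :
    ‖1 - (M ^ 2 / c)⁻¹ • A‖ ≤ √(1 - c ^ 2 / M ^ 2) := by
  have hM0 : 0 < M := hc.trans_le hcM
  have h0 : 0 ≤ 1 - c ^ 2 / M ^ 2 := by
    rw [sub_nonneg, div_le_one (by positivity)]
    gcongr
  refine ContinuousLinearMap.opNorm_le_bound _ (Real.sqrt_nonneg _) fun x => ?_
  refine abs_le_of_sq_le_sq' ?_ (by positivity) |>.2
  rw [mul_pow, Real.sq_sqrt h0]
  have e : (1 - (M ^ 2 / c)⁻¹ • A) x = x - (c / M ^ 2) • A x := by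
    simp [inv_div]
  rw [e, norm_sub_sq_real, norm_smul, inner_smul_right, mul_pow, Real.norm_eq_abs, sq_abs]
  have h1 : ‖A x‖ ≤ M * ‖x‖ := (A.le_opNorm x).trans (by gcongr)
  have h2 : ‖A x‖ ^ 2 ≤ M ^ 2 * ‖x‖ ^ 2 := by rw [← mul_pow]; gcongr
  have h3 : (c / M ^ 2) ^ 2 * ‖A x‖ ^ 2 ≤ c ^ 2 / M ^ 2 * ‖x‖ ^ 2 := by
    calc _ ≤ (c / M ^ 2) ^ 2 * (M ^ 2 * ‖x‖ ^ 2) := by gcongr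
      _ = _ := by field_simp
  have h4 : c ^ 2 / M ^ 2 * ‖x‖ ^ 2 ≤ c / M ^ 2 * inner ℝ x (A x) := by
    calc _ = c / M ^ 2 * (c * ‖x‖ ^ 2) := by ring
      _ ≤ _ := by gcongr; exact hA x
  linarith

/-- The semigroup `exp (-tA)`. -/
def flow (A : H →L[ℝ] H) (t : ℝ) : H →L[ℝ] H := NormedSpace.exp (-t • A)

/-- `σ (2A)^(-1/2)`, the square root of the stationary covariance. -/
def statRoot (K σ : ℝ) (A : H →L[ℝ] H) : H →L[ℝ] H := (σ / √(2 * K)) • invSqrt (1 - K⁻¹ • A)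

/-- The inverse of `A`. -/
def invOp (K : ℝ) (A : H →L[ℝ] H) : H →L[ℝ] H :=
  K⁻¹ • (invSqrt (1 - K⁻¹ • A) * invSqrt (1 - K⁻¹ • A))

/-- `1 - (1 - exp (-2tA))^(1/2)`. -/
def rootDefect (A : H →L[ℝ] H) (t : ℝ) : H →L[ℝ] H :=
  ∑' k : ℕ, sqrtCoeff k • flow A (2 * (k + 1) * t)

/-- The square root of the covariance at time `t`. -/
def covRoot (K σ : ℝ) (A : H →L[ℝ] H) (t : ℝ) : H →L[ℝ] H := statRoot K σ A * (1 - rootDefect A t)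

/-- The mean at time `t` of the process started at `x`. -/
def ouMean (K : ℝ) (A : H →L[ℝ] H) (a x : H) (t : ℝ) : H :=
  invOp K A a + flow A t (x - invOp K A a)

lemma flow_zero (A : H →L[ℝ] H) : flow A 0 = 1 := by simp [flow, NormedSpace.exp_zero]

lemma flow_add (A : H →L[ℝ] H) (s t : ℝ) : flow A (s + t) = flow A s * flow A t := by
  unfold flow
  rw [neg_add]
  exact exp_add_smul A (-s) (-t)

lemma flow_pow (A : H →L[ℝ] H) (t : ℝ) (n : ℕ) : flow A t ^ n = flow A (n * t) := by
  induction n with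
  | zero => simp [flow_zero]
  | succ n ih => rw [pow_succ, ih, ← flow_add]; congr 1; push_cast; ring

lemma hasDerivAt_flow (A : H →L[ℝ] H) (t : ℝ) : HasDerivAt (flow A) (-(A * flow A t)) t := by
  have := (hasDerivAt_exp_smul_const' (𝕂 := ℝ) A (-t)).scomp t (hasDerivAt_neg t)
  rw [neg_smul, one_smul] at this
  exact this

lemma continuous_flow (A : H →L[ℝ] H) : Continuous (flow A) :=
  continuous_iff_continuousAt.2 fun t => (hasDerivAt_flow A t).continuousAt

lemma commute_flow_self (A : H →L[ℝ] H) (t : ℝ) : Commute A (flow A t) :=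
  ((Commute.refl A).smul_right _).exp_right

lemma commute_flow {A B : H →L[ℝ] H} (h : Commute B A) (t : ℝ) : Commute B (flow A t) :=
  (h.smul_right _).exp_right

lemma isSelfAdjoint_smul {A : H →L[ℝ] H} (h : IsSelfAdjoint A) (a : ℝ) : IsSelfAdjoint (a • A) :=
  IsSelfAdjoint.smul (IsSelfAdjoint.all a) h

lemma isSelfAdjoint_flow {A : H →L[ℝ] H} (h : IsSelfAdjoint A) (t : ℝ) :
    IsSelfAdjoint (flow A t) :=
  (isSelfAdjoint_smul h (-t)).exp

lemma isSelfAdjoint_tsum {ι : Type*} {f : ι → H →L[ℝ] H} (h : ∀ i, IsSelfAdjoint (f i)) :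
    IsSelfAdjoint (∑' i, f i) := by
  unfold IsSelfAdjoint
  rw [tsum_star]
  exact tsum_congr fun i => (h i)

lemma isSelfAdjoint_invSqrt {A : H →L[ℝ] H} (h : IsSelfAdjoint A) : IsSelfAdjoint (invSqrt A) :=
  isSelfAdjoint_tsum fun k => isSelfAdjoint_smul (h.pow k) _

lemma isSelfAdjoint_one_sub {A : H →L[ℝ] H} (h : IsSelfAdjoint A) : IsSelfAdjoint (1 - A) :=
  IsSelfAdjoint.sub (R := H →L[ℝ] H) (IsSelfAdjoint.one (H →L[ℝ] H)) h

lemma commute_one_sub {A B : H →L[ℝ] H} (h : Commute B A) : Commute B (1 - A) :=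
  (Commute.one_right B).sub_right h

lemma commute_statRoot {A B : H →L[ℝ] H} (h : Commute B A) (K σ : ℝ) :
    Commute B (statRoot K σ A) :=
  (Commute.invSqrt_right (commute_one_sub (h.smul_right _))).smul_right _

lemma commute_rootDefect {A B : H →L[ℝ] H} (h : Commute B A) (t : ℝ) :
    Commute B (rootDefect A t) :=
  Commute.tsum_right _ fun _ => (commute_flow h _).smul_right _

lemma norm_one_le : ‖(1 : H →L[ℝ] H)‖ ≤ 1 := ContinuousLinearMap.norm_id_le

namespace IsStable

variable {K ρ σ : ℝ} {A : H →L[ℝ] H}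

lemma norm_lt_one (h : IsStable K ρ A) : ‖1 - K⁻¹ • A‖ < 1 := h.norm_le.trans_lt h.lt_one

lemma norm_flow_lt_one (h : IsStable K ρ A) {t : ℝ} (ht : 0 < t) : ‖flow A t‖ < 1 :=
  norm_exp_neg_smul_lt_one norm_one_le h.pos h.lt_one h.norm_le ht

lemma norm_flow_le_one (h : IsStable K ρ A) {t : ℝ} (ht : 0 ≤ t) : ‖flow A t‖ ≤ 1 := by
  rcases ht.eq_or_lt with rfl | ht
  · rw [flow_zero]; exact norm_one_le
  · exact (h.norm_flow_lt_one ht).le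

lemma selfAdjoint_statRoot (h : IsStable K ρ A) : IsSelfAdjoint (statRoot K σ A) :=
  isSelfAdjoint_smul (isSelfAdjoint_invSqrt (isSelfAdjoint_one_sub
    (isSelfAdjoint_smul h.symm _))) _

lemma commute_statRoot_rootDefect (t : ℝ) : Commute (statRoot K σ A) (rootDefect A t) :=
  commute_rootDefect (commute_statRoot (Commute.refl A) K σ).symm t

lemma selfAdjoint_covRoot (h : IsStable K ρ A) (t : ℝ) : IsSelfAdjoint (covRoot K σ A t) :=
  (IsSelfAdjoint.commute_iff h.selfAdjoint_statRoot (isSelfAdjoint_one_sub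
    (isSelfAdjoint_tsum fun _ => isSelfAdjoint_smul (isSelfAdjoint_flow h.symm _) _))).1
    (commute_one_sub (commute_statRoot_rootDefect t))

lemma mul_invOp (h : IsStable K ρ A) : A * invOp K A = 1 := by
  have hc : Commute A (invSqrt (1 - K⁻¹ • A)) :=
    Commute.invSqrt_right (commute_one_sub ((Commute.refl A).smul_right _))
  have e := invSqrt_mul_self_mul h.norm_lt_one
  rw [sub_sub_cancel] at e
  unfold invOp
  rw [mul_smul_comm, (hc.mul_right hc).eq, ← mul_smul_comm, e]

lemma apply_invOp (h : IsStable K ρ A) (a : H) : A (invOp K A a) = a := by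
  have := congrArg (fun B : H →L[ℝ] H => B a) h.mul_invOp
  simpa using this

/-- The Lyapunov equation of the stationary covariance, for a root that commutes with A. -/
lemma statRoot_sq_mul (h : IsStable K ρ A) :
    statRoot K σ A * statRoot K σ A * A = (σ ^ 2 / 2) • (1 : H →L[ℝ] H) := by
  have e := invSqrt_mul_self_mul h.norm_lt_one
  rw [sub_sub_cancel, mul_smul_comm] at e
  have hK := h.pos
  unfold statRoot
  rw [smul_mul_smul_comm, div_mul_div_comm, Real.mul_self_sqrt (by positivity), smul_mul_assoc]
  have : (σ * σ / (2 * K)) = σ ^ 2 / 2 * K⁻¹ := by field_simp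
  rw [this, ← smul_smul, e]

lemma rootDefect_eq (t : ℝ) :
    rootDefect A t = ∑' k : ℕ, sqrtCoeff k • flow A (2 * t) ^ (k + 1) := by
  unfold rootDefect
  refine tsum_congr fun k => ?_
  rw [flow_pow]
  congr 2
  push_cast
  ring

/-- All factors are functions of A and commute. Positivity of t makes e^{-2tA} a strict contraction,
as the power series of the square root requires. -/
lemma covRoot_sq (h : IsStable K ρ A) {t : ℝ} (ht : 0 < t) :
    covRoot K σ A t * covRoot K σ A t
      = statRoot K σ A * statRoot K σ A * (1 - flow A (2 * t)) := by
  have hc : Commute (1 - rootDefect A t) (statRoot K σ A) :=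
    (commute_one_sub (commute_statRoot_rootDefect t)).symm
  have hs := sq_one_sub_tsum_sqrtCoeff (h.norm_flow_lt_one (t := 2 * t) (by positivity))
  rw [← rootDefect_eq] at hs
  unfold covRoot
  rw [← hs]
  calc _ = statRoot K σ A * ((1 - rootDefect A t) * statRoot K σ A) * (1 - rootDefect A t) := by
        noncomm_ring
    _ = _ := by rw [hc.eq]; noncomm_ring

lemma inner_self_apply {B : H →L[ℝ] H} (hB : IsSelfAdjoint B) (ξ : H) :
    ‖B ξ‖ ^ 2 = inner ℝ ξ ((B * B) ξ) := by
  have hs := (ContinuousLinearMap.isSelfAdjoint_iff_isSymmetric.1 hB) ξ (B ξ)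
  rw [← real_inner_self_eq_norm_sq]
  simpa using hs

/-- Stationary variance minus the part still carried by the initial value. In this form
Chapman-Kolmogorov for the covariances and the invariance of the limit law are telescoping
identities. -/
lemma norm_covRoot_sq (h : IsStable K ρ A) {t : ℝ} (ht : 0 < t) (ξ : H) :
    ‖covRoot K σ A t ξ‖ ^ 2 = ‖statRoot K σ A ξ‖ ^ 2 - ‖statRoot K σ A (flow A t ξ)‖ ^ 2 := by
  have hc : Commute (flow A t) (statRoot K σ A) :=
    commute_statRoot (commute_flow_self A t).symm K σ
  have hsf : IsSelfAdjoint (statRoot K σ A * flow A t) :=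
    (IsSelfAdjoint.commute_iff h.selfAdjoint_statRoot (isSelfAdjoint_flow h.symm t)).1 hc.symm
  have e2 : ‖statRoot K σ A (flow A t ξ)‖ ^ 2
      = inner ℝ ξ ((statRoot K σ A * flow A t * (statRoot K σ A * flow A t)) ξ) :=
    inner_self_apply hsf ξ
  rw [inner_self_apply (h.selfAdjoint_covRoot t), h.covRoot_sq ht,
    inner_self_apply h.selfAdjoint_statRoot, e2, ← inner_sub_right]
  congr 1
  have : statRoot K σ A * flow A t * (statRoot K σ A * flow A t)
      = statRoot K σ A * statRoot K σ A * flow A (2 * t) := by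
    rw [two_mul, flow_add]
    calc _ = statRoot K σ A * (flow A t * statRoot K σ A) * flow A t := by noncomm_ring
      _ = _ := by rw [hc.eq]; noncomm_ring
  rw [this, mul_sub, mul_one]
  simp

lemma norm_covRoot_add (h : IsStable K ρ A) {s t : ℝ} (hs : 0 < s) (ht : 0 < t) (ξ : H) :
    ‖covRoot K σ A (s + t) ξ‖ ^ 2
      = ‖covRoot K σ A s ξ‖ ^ 2 + ‖covRoot K σ A t (flow A s ξ)‖ ^ 2 := by
  rw [h.norm_covRoot_sq (add_pos hs ht), h.norm_covRoot_sq hs, h.norm_covRoot_sq ht, add_comm s t,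
    flow_add]
  simp

/-- Differentiating the semigroup produces a factor A, and the Lyapunov equation S²A = σ²/2 removes
S and A together. -/
lemma hasDerivAt_norm_statRoot_flow (h : IsStable K ρ A) (ξ : H) (t : ℝ) :
    HasDerivAt (fun s => -‖statRoot K σ A (flow A s ξ)‖ ^ 2) (σ ^ 2 * ‖flow A t ξ‖ ^ 2) t := by
  have h1 : HasDerivAt (fun s => flow A s ξ) (-(A (flow A t ξ))) t := by
    have := (hasDerivAt_flow A t).clm_apply (hasDerivAt_const t ξ)
    simpa using this
  have h2 : HasDerivAt (fun s => statRoot K σ A (flow A s ξ))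
      (statRoot K σ A (-(A (flow A t ξ)))) t := (statRoot K σ A).hasFDerivAt.comp_hasDerivAt t h1
  have h3 := (h2.norm_sq).fun_neg
  have hs := (ContinuousLinearMap.isSelfAdjoint_iff_isSymmetric.1
    (h.selfAdjoint_statRoot (σ := σ))) (flow A t ξ) (statRoot K σ A (-(A (flow A t ξ))))
  have e : statRoot K σ A (statRoot K σ A (A (flow A t ξ))) = (σ ^ 2 / 2) • flow A t ξ := by
    have := congrArg (fun B : H →L[ℝ] H => B (flow A t ξ)) (h.statRoot_sq_mul (σ := σ))
    simpa using this
  simp only [ContinuousLinearMap.coe_coe] at hs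
  rw [hs, map_neg, map_neg, e, inner_neg_right, inner_smul_right, real_inner_self_eq_norm_sq] at h3
  exact h3.congr_deriv (by ring)

/-- The left side is the variance that Itô's isometry assigns to the Wiener integral in direction ξ;
this identifies the root `covRoot`. -/
lemma integral_norm_flow_sq (h : IsStable K ρ A) (ξ : H) {t : ℝ} (ht : 0 < t) :
    ∫ s in (0 : ℝ)..t, σ ^ 2 * ‖flow A s ξ‖ ^ 2 = ‖covRoot K σ A t ξ‖ ^ 2 := by
  rw [intervalIntegral.integral_eq_sub_of_hasDerivAt
    (fun s _ => h.hasDerivAt_norm_statRoot_flow ξ s), h.norm_covRoot_sq ht, flow_zero]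
  · simp; ring
  · refine Continuous.intervalIntegrable ?_ _ _
    have := continuous_flow A
    fun_prop

end IsStable

end Operators

/-! ### Increments of a smooth function under small perturbations of its argument. -/

section Decay

variable {E F G : Type*} [NormedAddCommGroup E] [NormedSpace ℝ E] [NormedAddCommGroup F]
  [NormedSpace ℝ F] [NormedAddCommGroup G] [NormedSpace ℝ G]

lemma PolyBdd.norm_sub_le {n N : ℕ} {C : ℝ} {φ : E → F} (h : PolyBdd n φ C N) (hn : 1 ≤ n)
    (x y : E) : ‖φ x - φ y‖ ≤ C * (1 + (‖x‖ + ‖y‖)) ^ N * ‖x - y‖ := by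
  have hC := h.nonneg
  refine (convex_closedBall (0 : E) (‖x‖ + ‖y‖)).norm_image_sub_le_of_norm_fderiv_le
    (𝕜 := ℝ) (fun z _ => h.differentiable hn z) (fun z hz => ?_) ?_ ?_
  · refine (h.norm_fderiv_le hn z).trans ?_
    have : ‖z‖ ≤ ‖x‖ + ‖y‖ := by simpa using hz
    gcongr
  · simp
  · simp

/-- A smooth function along a small affine perturbation of a constant. -/
lemma PolyBdd.affine_sub_const {T : E → F} {CT D δ : ℝ} {N : ℕ} (hT : PolyBdd 2 T CT N)
    {y α : E} {Λ : G →L[ℝ] E} (hy : ‖y‖ ≤ D) (hδ : 0 ≤ δ) (hδD : δ ≤ D) (hα : ‖α‖ ≤ δ)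
    (hΛ : ‖Λ‖ ≤ δ) :
    PolyBdd 2 (fun p => T (y + (α + Λ p)) - T y) (2 * CT * (1 + 3 * D) ^ (N + 1) * δ) (N + 1) where
  contDiff := ((hT.contDiff.comp (contDiff_const.add (contDiff_const.add Λ.contDiff)))).sub
    contDiff_const
  bound i hi p := by
    have hCT := hT.nonneg
    have hD : 0 ≤ D := hδ.trans hδD
    have hp := norm_nonneg p
    have hz : ‖α + Λ p‖ ≤ δ * (1 + ‖p‖) := by
      refine (norm_add_le _ _).trans ?_
      have := (Λ.le_opNorm p).trans (mul_le_mul_of_nonneg_right hΛ hp)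
      linarith
    have hz' : ‖α + Λ p‖ ≤ D * (1 + ‖p‖) := hz.trans (by gcongr)
    have hyz : ‖y + (α + Λ p)‖ ≤ D + D * (1 + ‖p‖) := (norm_add_le _ _).trans (add_le_add hy hz')
    have hb : 1 + (‖y + (α + Λ p)‖ + ‖y‖) ≤ (1 + 3 * D) * (1 + ‖p‖) := by nlinarith
    have hone : 1 ≤ (1 + 3 * D) * (1 + ‖p‖) := by nlinarith
    rcases i with _ | i
    · rw [norm_iteratedFDeriv_zero]
      refine (hT.norm_sub_le (by norm_num) _ _).trans ?_
      rw [add_sub_cancel_left]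
      calc CT * (1 + (‖y + (α + Λ p)‖ + ‖y‖)) ^ N * ‖α + Λ p‖
          ≤ CT * ((1 + 3 * D) * (1 + ‖p‖)) ^ N * (δ * (1 + ‖p‖)) := by gcongr
        _ = CT * (1 + 3 * D) ^ N * 1 * δ * (1 + ‖p‖) ^ (N + 1) := by rw [mul_pow]; ring
        _ ≤ 2 * CT * (1 + 3 * D) ^ N * (1 + 3 * D) * δ * (1 + ‖p‖) ^ (N + 1) := by
            gcongr
            · nlinarith [show 0 ≤ CT * (1 + 3 * D) ^ N by positivity]
            · linarith
        _ = _ := by ring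
    · have hi2 : ((i + 1 : ℕ) : WithTop ℕ∞) ≤ 2 := by exact_mod_cast hi
      have hf : ContDiff ℝ 2 (fun p => y + (α + Λ p)) :=
        contDiff_const.add (contDiff_const.add Λ.contDiff)
      have e : (fun p => T (y + (α + Λ p)) - T y) = (T ∘ fun p => y + (α + Λ p)) - fun _ => T y :=
        rfl
      have hT2 : ContDiff ℝ 2 T := hT.contDiff
      rw [e, iteratedFDeriv_sub_apply ((hT2.comp hf).of_le hi2).contDiffAt
        contDiff_const.contDiffAt, iteratedFDeriv_const_of_ne (Nat.succ_ne_zero i), Pi.zero_apply,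
        sub_zero]
      have hfd : fderiv ℝ (fun p => y + (α + Λ p)) = fun _ => Λ := by
        ext1 q
        simp
      refine (norm_iteratedFDeriv_comp_le hT2 hf hi2 p
        (C := CT * ((1 + 3 * D) * (1 + ‖p‖)) ^ N) (D := δ) (fun j hj => ?_)
        (fun j hj1 hj => ?_)).trans ?_
      · refine (hT.bound j (hj.trans hi) _).trans ?_
        gcongr
        linarith [norm_nonneg y]
      · obtain ⟨j, rfl⟩ := Nat.exists_eq_succ_of_ne_zero (show j ≠ 0 by omega)
        rw [Nat.succ_eq_add_one, ← norm_iteratedFDeriv_fderiv, hfd]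
        rcases j with _ | j
        · simpa using hΛ
        · rw [iteratedFDeriv_const_of_ne (Nat.succ_ne_zero j)]
          simp only [Pi.zero_apply, norm_zero]
          positivity
      · have hf2 : ((i + 1).factorial : ℝ) ≤ 2 := by
          exact_mod_cast (Nat.factorial_le hi)
        -- One factor δ is kept as the decay rate; any further factor is only bounded.
        have hpow : δ ^ (i + 1) ≤ δ * (1 + 3 * D) := by
          have hi1 : i ≤ 1 := by omega
          rw [pow_succ']
          gcongr
          calc δ ^ i ≤ (1 + 3 * D) ^ i := by gcongr; linarith
            _ ≤ (1 + 3 * D) ^ 1 := pow_le_pow_right₀ (by linarith) hi1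
            _ = _ := pow_one _
        calc _ ≤ 2 * (CT * ((1 + 3 * D) * (1 + ‖p‖)) ^ N) * (δ * (1 + 3 * D)) := by gcongr
          _ = 2 * CT * (1 + 3 * D) ^ (N + 1) * δ * (1 + ‖p‖) ^ N * 1 := by
              rw [mul_pow]; ring
          _ ≤ 2 * CT * (1 + 3 * D) ^ (N + 1) * δ * (1 + ‖p‖) ^ N * (1 + ‖p‖) := by
              gcongr; linarith
          _ = _ := by ring

/-- A smooth function along a small perturbation of a bounded family. -/
lemma PolyBdd.comp_add_sub_comp {T : E → F} {CT D δ : ℝ} {N : ℕ} (hT : PolyBdd 2 T CT N)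
    {A z : G → E} (hA : PolyBdd 1 A D 0) (hz : PolyBdd 1 z δ 0) :
    PolyBdd 1 (fun θ => T (A θ + z θ) - T (A θ))
      (CT * (1 + 2 * D + δ) ^ N * (1 + D) * δ) 0 := by
  have hCT := hT.nonneg
  have hD := hA.nonneg
  have hδ := hz.nonneg
  have hA0 : ∀ θ, ‖A θ‖ ≤ D := fun θ => by simpa using hA.norm_le θ
  have hz0 : ∀ θ, ‖z θ‖ ≤ δ := fun θ => by simpa using hz.norm_le θ
  have hA1 : ∀ θ, ‖fderiv ℝ A θ‖ ≤ D := fun θ => by simpa using hA.norm_fderiv_le le_rfl θ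
  have hz1 : ∀ θ, ‖fderiv ℝ z θ‖ ≤ δ := fun θ => by simpa using hz.norm_fderiv_le le_rfl θ
  have hb : ∀ θ, 1 + (‖A θ + z θ‖ + ‖A θ‖) ≤ 1 + 2 * D + δ := fun θ => by
    linarith [norm_add_le (A θ) (z θ), hA0 θ, hz0 θ]
  have key : ∀ θ, ‖T (A θ + z θ) - T (A θ)‖ ≤ CT * (1 + 2 * D + δ) ^ N * δ := fun θ => by
    refine (hT.norm_sub_le (by norm_num) _ _).trans ?_
    rw [add_sub_cancel_left]
    have := hb θ
    have := hz0 θ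
    gcongr
  refine ⟨((hT.of_le one_le_two).contDiff.comp (hA.contDiff.add hz.contDiff)).sub
    ((hT.of_le one_le_two).contDiff.comp hA.contDiff), fun i hi θ => ?_⟩
  rw [pow_zero, mul_one]
  interval_cases i
  · rw [norm_iteratedFDeriv_zero]
    refine (key θ).trans ?_
    nlinarith [show 0 ≤ CT * (1 + 2 * D + δ) ^ N * δ * D by positivity]
  · have hd : HasFDerivAt (fun θ => T (A θ + z θ) - T (A θ))
        ((fderiv ℝ T (A θ + z θ)).comp (fderiv ℝ A θ + fderiv ℝ z θ) -
          (fderiv ℝ T (A θ)).comp (fderiv ℝ A θ)) θ :=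
      ((hT.hasFDerivAt (by norm_num) _).comp θ
        ((hA.hasFDerivAt le_rfl θ).add (hz.hasFDerivAt le_rfl θ))).sub
        ((hT.hasFDerivAt (by norm_num) _).comp θ (hA.hasFDerivAt le_rfl θ))
    rw [← norm_iteratedFDeriv_fderiv, norm_iteratedFDeriv_zero, hd.fderiv]
    -- Split so that each summand has a small factor: an increment of the derivative of T, or the
    -- derivative of z.
    have e : (fderiv ℝ T (A θ + z θ)).comp (fderiv ℝ A θ + fderiv ℝ z θ) -
          (fderiv ℝ T (A θ)).comp (fderiv ℝ A θ) =
        (fderiv ℝ T (A θ + z θ) - fderiv ℝ T (A θ)).comp (fderiv ℝ A θ) +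
          (fderiv ℝ T (A θ + z θ)).comp (fderiv ℝ z θ) := by
      ext v; simp; abel
    rw [e]
    have h1 : ‖fderiv ℝ T (A θ + z θ) - fderiv ℝ T (A θ)‖ ≤ CT * (1 + 2 * D + δ) ^ N * δ := by
      refine (hT.fderiv.norm_sub_le le_rfl _ _).trans ?_
      rw [add_sub_cancel_left]
      have := hb θ
      have := hz0 θ
      gcongr
    have h2 : ‖fderiv ℝ T (A θ + z θ)‖ ≤ CT * (1 + 2 * D + δ) ^ N := by
      refine (hT.norm_fderiv_le (by norm_num) _).trans ?_
      have h3 : 1 + ‖A θ + z θ‖ ≤ 1 + 2 * D + δ := by linarith [hb θ, norm_nonneg (A θ)]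
      exact mul_le_mul_of_nonneg_left (pow_le_pow_left₀ (by positivity) h3 N) hCT
    calc _ ≤ (CT * (1 + 2 * D + δ) ^ N * δ) * D + (CT * (1 + 2 * D + δ) ^ N) * δ := by
          refine (norm_add_le _ _).trans (add_le_add ?_ ?_)
          · refine (ContinuousLinearMap.opNorm_comp_le _ _).trans ?_
            have := hA1 θ
            gcongr
          · refine (ContinuousLinearMap.opNorm_comp_le _ _).trans ?_
            have := hz1 θ
            gcongr
      _ = _ := by ring

end Decay

/-! ### Uniform C² bounds and exponential decay of the law parameters. -/

section ParamBounds

variable {H Θ : Type*} [NormedAddCommGroup H] [InnerProductSpace ℝ H] [CompleteSpace H]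
  [NormedAddCommGroup Θ] [NormedSpace ℝ Θ]

/-- The mean vector and the square root of the covariance are bounded `C²` functions of the
parameter, and their time-dependent parts decay exponentially. -/
structure ParamBounds (K σ : ℝ) (g : Θ → H) (h : Θ → H →L[ℝ] H) (C c : ℝ) : Prop where
  rate_pos : 0 < c
  polyBdd_flow : ∀ t : ℝ≥0, PolyBdd 2 (fun θ => flow (h θ) t) (C * Real.exp (-(c * t))) 0
  polyBdd_defect : ∀ t : ℝ≥0, PolyBdd 2 (fun θ => rootDefect (h θ) t) (C * Real.exp (-(c * t))) 0
  polyBdd_root : PolyBdd 2 (fun θ => statRoot K σ (h θ)) C 0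
  polyBdd_mean : PolyBdd 2 (fun θ => invOp K (h θ) (g θ)) C 0

lemma exists_paramBounds {K ρ σ Cg Ch : ℝ} {g : Θ → H} {h : Θ → H →L[ℝ] H}
    (hg : PolyBdd 2 g Cg 0) (hh : PolyBdd 2 h Ch 0) (hs : ∀ θ, IsStable K ρ (h θ)) :
    ∃ C c : ℝ, ParamBounds K σ g h C c := by
  have hK : 0 < K := (hs 0).pos
  have hρ0 : 0 ≤ ρ := (norm_nonneg _).trans (hs 0).norm_le
  have hw : PolyBdd 2 (fun θ => 1 - K⁻¹ • h θ) (‖(1 : H →L[ℝ] H)‖ + |K⁻¹| * Ch) 0 := by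
    have := (PolyBdd.const (n := 2) (E := Θ) (1 : H →L[ℝ] H)).add (hh.const_smul K⁻¹).neg
    simpa only [← sub_eq_add_neg] using this
  obtain ⟨C₀, r, hr0, hr1, hpow⟩ := hw.exists_pow_bound norm_one_le (hs 0).lt_one hρ0
    (fun θ => (hs θ).norm_le)
  have hC₀ : 0 ≤ C₀ := by simpa using (hpow 0).nonneg
  set c : ℝ := K * (1 - r) with hc
  have hc0 : 0 < c := mul_pos hK (by linarith)
  have hflow : ∀ t : ℝ≥0, PolyBdd 2 (fun θ => flow (h θ) t)
      (C₀ * Real.exp (-(c * t))) 0 := fun t => PolyBdd.exp hK hpow (fun θ => rfl) t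
  have hR := PolyBdd.invSqrt hr0.le hr1 hpow
  have hroot : PolyBdd 2 (fun θ => statRoot K σ (h θ)) (|σ / √(2 * K)| * (C₀ / (1 - r))) 0 :=
    hR.const_smul _
  have hinv := (hR.mul hR).const_smul K⁻¹
  have hmean := hinv.bilin (ContinuousLinearMap.id ℝ (H →L[ℝ] H)) hg
  have hdef : ∀ t : ℝ≥0, PolyBdd 2 (fun θ => rootDefect (h θ) t)
      ((∑' k, sqrtCoeff k) * C₀ * Real.exp (-(c * t))) 0 := by
    intro t
    have hsum : Summable fun k => sqrtCoeff k * (C₀ * Real.exp (-(c * t))) :=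
      summable_sqrtCoeff.mul_right _
    have := PolyBdd.tsum hsum (n := 2)
      (f := fun k θ => sqrtCoeff k • flow (h θ) (2 * (k + 1) * t)) (fun k => by
        have h1 := (hflow (2 * (k + 1) * t)).const_smul (sqrtCoeff k)
        rw [abs_of_nonneg (sqrtCoeff_nonneg k)] at h1
        have h2 : PolyBdd 2 (fun θ => sqrtCoeff k • flow (h θ) (2 * (k + 1) * t))
            (sqrtCoeff k * (C₀ * Real.exp (-(c * (2 * (k + 1) * t))))) 0 := by
          simpa using h1
        refine h2.mono ?_ le_rfl
        have ht : (0 : ℝ) ≤ t := t.2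
        -- Every term of the root series decays at least like the semigroup at time t; the summable
        -- coefficients then give one constant for all t ≥ 0.
        have h3 : (t : ℝ) ≤ 2 * (k + 1) * t := by nlinarith [(Nat.cast_nonneg k : (0 : ℝ) ≤ k)]
        have := sqrtCoeff_nonneg k
        gcongr)
    rw [tsum_mul_right, ← mul_assoc] at this
    exact this
  obtain ⟨C, hC⟩ : ∃ C, C₀ ≤ C ∧ (∑' k, sqrtCoeff k) * C₀ ≤ C ∧
      |σ / √(2 * K)| * (C₀ / (1 - r)) ≤ C ∧
      ‖ContinuousLinearMap.id ℝ (H →L[ℝ] H)‖ * (2 ^ 2 * (|K⁻¹| * (2 ^ 2 * (C₀ / (1 - r)) *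
        (C₀ / (1 - r)))) * Cg) ≤ C :=
    ⟨_, (le_max_left _ (max _ (max _ _))), (le_max_left _ (max _ _)).trans (le_max_right _ _),
      (le_max_left _ _).trans ((le_max_right _ _).trans (le_max_right _ _)),
      (le_max_right _ _).trans ((le_max_right _ _).trans (le_max_right _ _))⟩
  refine ⟨C, c, hc0, fun t => (hflow t).mono ?_ le_rfl, fun t => (hdef t).mono ?_ le_rfl,
    hroot.mono hC.2.2.1 le_rfl, PolyBdd.mono hmean hC.2.2.2 le_rfl⟩
  · have := hC.1; gcongr
  · have := hC.2.1; gcongr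

end ParamBounds

/-! ### Means as functions of the law parameters; the gap and its time integral. -/

section Potential

variable {H Θ : Type} [NormedAddCommGroup H] [InnerProductSpace ℝ H] [FiniteDimensional ℝ H]
  [MeasurableSpace H] [BorelSpace H] [NormedAddCommGroup Θ] [NormedSpace ℝ Θ]
  [FiniteDimensional ℝ Θ] {V : Type} [NormedAddCommGroup V] [NormedSpace ℝ V]

/-- The expectation of `f (m + S Z)` as a function of `(m, S)`, where `Z` has law `γ`. -/
def smear (γ : Measure H) (f : H → ℝ) (a : H × (H →L[ℝ] H)) : ℝ := ∫ z, f (a.1 + a.2 z) ∂γ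

/-- The map `(m, S) ↦ m + S z`. -/
def affineEval (z : H) : (H × (H →L[ℝ] H)) →L[ℝ] H :=
  ContinuousLinearMap.fst ℝ H (H →L[ℝ] H) +
    (ContinuousLinearMap.apply ℝ H z).comp (ContinuousLinearMap.snd ℝ H (H →L[ℝ] H))

lemma affineEval_apply (z : H) (a : H × (H →L[ℝ] H)) : affineEval z a = a.1 + a.2 z := by
  simp [affineEval]

lemma norm_affineEval_le (z : H) : ‖affineEval z‖ ≤ 1 + ‖z‖ := by
  refine ContinuousLinearMap.opNorm_le_bound _ (by positivity) fun a => ?_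
  rw [affineEval_apply]
  have h1 : ‖a.1‖ ≤ ‖a‖ := norm_fst_le a
  have h2 : ‖a.2‖ ≤ ‖a‖ := norm_snd_le a
  calc _ ≤ ‖a.1‖ + ‖a.2‖ * ‖z‖ := (norm_add_le _ _).trans (by gcongr; exact a.2.le_opNorm z)
    _ ≤ ‖a‖ + ‖a‖ * ‖z‖ := by gcongr
    _ = _ := by ring

lemma PolyBdd.comp_affineEval {f : H → ℝ} {n N : ℕ} {C : ℝ} (hf : PolyBdd n f C N) (z : H) :
    PolyBdd n (fun a : H × (H →L[ℝ] H) => f (a.1 + a.2 z))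
      (n.factorial * C * (2 + ‖z‖) ^ (N + n)) (N + n) := by
  have h1 : PolyBdd n (affineEval z) (1 + ‖z‖) 1 :=
    (PolyBdd.clm (affineEval z)).mono (norm_affineEval_le z) le_rfl
  have := hf.comp h1
  simp only [affineEval_apply, one_mul] at this
  refine this.mono (le_of_eq ?_) le_rfl
  congr 2
  ring

/-- The parameters enter f through a map linear in (m, S), with norm at most 1 + ‖z‖.
Differentiating under the integral costs no derivative of f, and S may be degenerate; the norm of z
is absorbed by Gaussian moments. -/
lemma smear_polyBdd {γ : Measure H} (hγ : ∀ N : ℕ, Integrable (fun z => (2 + ‖z‖) ^ N) γ)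
    {f : H → ℝ} {n N : ℕ} {C : ℝ} (hf : PolyBdd n f C N) :
    ∃ C', PolyBdd n (smear γ f) C' (N + n) :=
  ⟨_, PolyBdd.integral ((hγ (N + n)).const_mul (n.factorial * C)) n
    (fun z => hf.comp_affineEval z)
    (fun a => (hf.continuous.comp (by fun_prop)).aestronglyMeasurable)⟩

/-- The differential of `Φ` composed with a linear map. -/
def tangentMap (Φ : V → ℝ)
    (y : V × (Θ →L[ℝ] V)) : Θ →L[ℝ] ℝ :=
  (fderiv ℝ Φ y.1).comp y.2

lemma tangentMap_polyBdd {Φ : V → ℝ} {n N : ℕ} {C : ℝ}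
    (hΦ : PolyBdd (n + 1) Φ C N) : ∃ C' N', PolyBdd n (tangentMap (Θ := Θ) Φ) C' N' := by
  have h1 := hΦ.fderiv.comp (PolyBdd.clm (ContinuousLinearMap.fst ℝ V
    (Θ →L[ℝ] V)))
  have h2 := h1.bilin (ContinuousLinearMap.compL ℝ Θ V ℝ)
    (PolyBdd.clm (ContinuousLinearMap.snd ℝ V (Θ →L[ℝ] V)))
  exact ⟨_, _, h2⟩

variable (ι : H →L[ℝ] V) (lim : Θ → V) (diff : ℝ≥0 → Θ → V) (h : Θ → H →L[ℝ] H)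

/-- The parameters of the law at time `t` of the process started at `x`. -/
def lawPair (t : ℝ≥0) (q : H × Θ) : V := (lim q.2 + diff t q.2) + ι (flow (h q.2) t q.1)

/-- A family of parameters that converges exponentially together with its derivatives. -/
structure DecayingFamily (D c : ℝ) : Prop where
  rate_pos : 0 < c
  polyBdd_lim : PolyBdd 2 lim D 0
  polyBdd_diff : ∀ t, PolyBdd 2 (diff t) (D * Real.exp (-(c * t))) 0
  polyBdd_flow : ∀ t : ℝ≥0, PolyBdd 2 (fun θ => flow (h θ) t) (D * Real.exp (-(c * t))) 0
  measurable_diff : ∀ θ, StronglyMeasurable fun t => diff t θ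

/-- The part of the first-order jet of `lawPair` that comes from the value of the semigroup. -/
def jetFlow (ι : H →L[ℝ] V) : (H →L[ℝ] H) →L[ℝ] (H × (Θ →L[ℝ] H)) →L[ℝ] (V × (Θ →L[ℝ] V)) :=
  (ContinuousLinearMap.compL ℝ (H × (Θ →L[ℝ] H)) H (V × (Θ →L[ℝ] V))
      ((ContinuousLinearMap.inl ℝ V (Θ →L[ℝ] V)).comp ι)).comp
    ((ContinuousLinearMap.compL ℝ (H × (Θ →L[ℝ] H)) H H).flip
      (ContinuousLinearMap.fst ℝ H (Θ →L[ℝ] H))) +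
  (ContinuousLinearMap.compL ℝ (H × (Θ →L[ℝ] H)) (Θ →L[ℝ] V) (V × (Θ →L[ℝ] V))
      (ContinuousLinearMap.inr ℝ V (Θ →L[ℝ] V))).comp
    (((ContinuousLinearMap.compL ℝ (H × (Θ →L[ℝ] H)) (Θ →L[ℝ] H) (Θ →L[ℝ] V)).flip
      (ContinuousLinearMap.snd ℝ H (Θ →L[ℝ] H))).comp
        ((ContinuousLinearMap.compL ℝ Θ H V).comp (ContinuousLinearMap.compL ℝ H H V ι)))

lemma jetFlow_apply (ι : H →L[ℝ] V) (E : H →L[ℝ] H) (p : H × (Θ →L[ℝ] H)) :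
    jetFlow ι E p = (ι (E p.1), (ι.comp E).comp p.2) := by
  simp [jetFlow]

/-- The part of the first-order jet of `lawPair` that comes from the derivative of the
semigroup. -/
def jetFlowDeriv (ι : H →L[ℝ] V) :
    (Θ →L[ℝ] (H →L[ℝ] H)) →L[ℝ] (H × (Θ →L[ℝ] H)) →L[ℝ] (V × (Θ →L[ℝ] V)) :=
  (ContinuousLinearMap.compL ℝ (H × (Θ →L[ℝ] H)) (Θ →L[ℝ] V) (V × (Θ →L[ℝ] V))
      (ContinuousLinearMap.inr ℝ V (Θ →L[ℝ] V))).comp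
    (((ContinuousLinearMap.compL ℝ (H × (Θ →L[ℝ] H)) H (Θ →L[ℝ] V)).flip
      (ContinuousLinearMap.fst ℝ H (Θ →L[ℝ] H))).comp
      ((ContinuousLinearMap.compL ℝ H (Θ →L[ℝ] H) (Θ →L[ℝ] V)
        (ContinuousLinearMap.compL ℝ Θ H V ι)).comp
          (ContinuousLinearMap.flipₗᵢ ℝ Θ H H : (Θ →L[ℝ] (H →L[ℝ] H)) →L[ℝ] (H →L[ℝ] (Θ →L[ℝ] H)))))

lemma jetFlowDeriv_apply (ι : H →L[ℝ] V) (D : Θ →L[ℝ] (H →L[ℝ] H)) (p : H × (Θ →L[ℝ] H)) :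
    jetFlowDeriv ι D p = (0, ι.comp (D.flip p.1)) := by
  simp [jetFlowDeriv]

/-- Only that the constant depends on L alone matters: L is applied to families indexed by time, and
their decay has to survive with one factor. -/
lemma PolyBdd.exists_clm_comp {E F G : Type*} [NormedAddCommGroup E] [NormedSpace ℝ E]
    [NormedAddCommGroup F] [NormedSpace ℝ F] [NormedAddCommGroup G] [NormedSpace ℝ G]
    (L : F →L[ℝ] G) : ∃ k : ℝ, ∀ {n N : ℕ} {φ : E → F} {C : ℝ}, PolyBdd n φ C N →
      PolyBdd n (fun x => L (φ x)) (k * C) N :=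
  ⟨‖L‖, fun h => h.clm_comp L⟩

/-- The first-order jet of `limPair`. -/
def jetLim (θ : Θ) : V × (Θ →L[ℝ] V) :=
  (lim θ, fderiv ℝ (lim) θ)

/-- The first-order jet of `diffPair`. -/
def jetDiff (t : ℝ≥0) (θ : Θ) : V × (Θ →L[ℝ] V) :=
  (diff t θ, fderiv ℝ (diff t) θ)

/-- The linear part in the initial values of the first-order jet of `lawPair`. -/
def jetLin (t : ℝ≥0) (θ : Θ) : (H × (Θ →L[ℝ] H)) →L[ℝ]
    (V × (Θ →L[ℝ] V)) :=
  jetFlow ι (flow (h θ) t) +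
    jetFlowDeriv ι (fderiv ℝ (fun η => flow (h η) t) θ)

/-- The directional derivative of the mean of `Φ` minus the one of its limit. -/
def tangentGap (Φ : V → ℝ) (t : ℝ≥0) (p : H × (Θ →L[ℝ] H)) (θ : Θ) : Θ →L[ℝ] ℝ :=
  tangentMap Φ (jetLim lim θ + (jetDiff diff t θ + jetLin ι h t θ p)) -
    tangentMap Φ (jetLim lim θ)

variable {ι lim diff h} {C c : ℝ}

lemma DecayingFamily.nonneg (hB : DecayingFamily lim diff h C c) : 0 ≤ C := hB.polyBdd_lim.nonneg

lemma DecayingFamily.polyBdd_jetLim (hB : DecayingFamily lim diff h C c) :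
    PolyBdd 1 (jetLim lim) (4 * C) 0 :=
  ((hB.polyBdd_lim.of_le one_le_two).prodMk hB.polyBdd_lim.fderiv).mono
    (by linarith [hB.nonneg]) le_rfl

lemma DecayingFamily.exists_jet_bound (hB : DecayingFamily lim diff h C c) :
    ∃ D, (∀ t, PolyBdd 1 (jetDiff diff t) (D * Real.exp (-(c * t))) 0) ∧
      ∀ t, PolyBdd 1 (jetLin ι h t) (D * Real.exp (-(c * t))) 0 := by
  have hC := hB.nonneg
  obtain ⟨k₁, hk₁⟩ := PolyBdd.exists_clm_comp (E := Θ) (F := H →L[ℝ] H)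
    (G := (H × (Θ →L[ℝ] H)) →L[ℝ] (V × (Θ →L[ℝ] V))) (jetFlow (Θ := Θ) ι)
  obtain ⟨k₂, hk₂⟩ := PolyBdd.exists_clm_comp (E := Θ) (F := Θ →L[ℝ] (H →L[ℝ] H))
    (G := (H × (Θ →L[ℝ] H)) →L[ℝ] (V × (Θ →L[ℝ] V))) (jetFlowDeriv (Θ := Θ) ι)
  refine ⟨max (2 * C) (k₁ * C + k₂ * C), fun t => ?_, fun t => ?_⟩
  · refine (((hB.polyBdd_diff t).of_le one_le_two).prodMk (hB.polyBdd_diff t).fderiv).mono ?_ le_rfl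
    rw [← two_mul, ← mul_assoc]
    gcongr
    exact le_max_left _ _
  · have h1 := hk₁ ((hB.polyBdd_flow t).of_le one_le_two)
    have h2 := hk₂ (hB.polyBdd_flow t).fderiv
    refine (h1.add h2).mono ?_ le_rfl
    rw [← mul_assoc, ← mul_assoc, ← add_mul]
    gcongr
    exact le_max_right _ _

/-- The gap decays exponentially, with its derivatives up to order two in the initial values and
of order one in the parameter. -/
lemma DecayingFamily.polyBdd_tangentGap (hB : DecayingFamily lim diff h C c) {Φ : V → ℝ} {N : ℕ}
    {CΦ : ℝ} (hΦ : PolyBdd 3 Φ CΦ N) :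
    ∃ (C' : ℝ) (N' : ℕ),
      (∀ t θ, PolyBdd 2 (fun p => tangentGap ι lim diff h Φ t p θ) (C' * Real.exp (-(c * t))) N') ∧
      ∀ t p, PolyBdd 1 (fun θ => tangentGap ι lim diff h Φ t p θ)
        (C' * (1 + ‖p‖) ^ N' * Real.exp (-(c * t))) 0 := by
  obtain ⟨CT, NT, hT⟩ := tangentMap_polyBdd (Θ := Θ) (n := 2) hΦ
  obtain ⟨D, hD1, hD2⟩ := hB.exists_jet_bound
  have hC := hB.nonneg
  have hCT := hT.nonneg
  have hD0 : 0 ≤ D := by simpa using (hD2 0).nonneg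
  have hc := hB.rate_pos
  set M := max (4 * C) D with hM
  have hM0 : 0 ≤ M := hD0.trans (le_max_right _ _)
  have hexp : ∀ t : ℝ≥0, Real.exp (-(c * t)) ≤ 1 := fun t => by
    rw [Real.exp_le_one_iff, neg_nonpos]; positivity
  have hDM : ∀ t : ℝ≥0, D * Real.exp (-(c * t)) ≤ M := fun t =>
    (mul_le_of_le_one_right hD0 (hexp t)).trans (le_max_right _ _)
  -- The constant for a perturbation of size δ = D exp(-ct) around points of norm at most M, with
  -- the exponential split off.
  refine ⟨2 * CT * (1 + 3 * M) ^ (NT + 1) * D, NT + 1, fun t θ => ?_, fun t p => ?_⟩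
  · refine (hT.affine_sub_const (y := jetLim lim θ) (D := M) (δ := D * Real.exp (-(c * t)))
      ?_ (by positivity) (hDM t) ?_ ?_).mono (le_of_eq (by ring)) le_rfl
    · have := hB.polyBdd_jetLim.norm_le θ
      rw [pow_zero, mul_one] at this
      exact this.trans (le_max_left _ _)
    · simpa using (hD1 t).norm_le θ
    · simpa using (hD2 t).norm_le θ
  · have hz : PolyBdd 1 (fun θ => jetDiff diff t θ + jetLin ι h t θ p)
        (D * Real.exp (-(c * t)) * (1 + ‖p‖)) 0 := by
      have h1 := (hD2 t).clm_comp (ContinuousLinearMap.apply ℝ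
        (V × (Θ →L[ℝ] V)) p)
      have hn : ‖ContinuousLinearMap.apply ℝ
        (V × (Θ →L[ℝ] V)) p‖ ≤ ‖p‖ :=
        ContinuousLinearMap.opNorm_le_bound _ (norm_nonneg p) fun L => by
          rw [mul_comm]; exact L.le_opNorm p
      refine ((hD1 t).add h1).mono ?_ le_rfl
      have : 0 ≤ D * Real.exp (-(c * t)) := by positivity
      nlinarith
    have hlim : PolyBdd 1 (jetLim lim) M 0 := hB.polyBdd_jetLim.mono (le_max_left _ _) le_rfl
    refine (hT.comp_add_sub_comp hlim hz).mono ?_ le_rfl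
    have hp := norm_nonneg p
    -- For fixed p the perturbation is small only up to the factor 1 + ‖p‖; that factor is moved
    -- into the polynomial weight.
    have hb : 1 + 2 * M + D * Real.exp (-(c * t)) * (1 + ‖p‖) ≤ (1 + 3 * M) * (1 + ‖p‖) := by
      nlinarith [hDM t]
    have hb' : 1 + M ≤ (1 + 3 * M) := by linarith
    have he := Real.exp_pos (-(c * t))
    calc _ ≤ CT * ((1 + 3 * M) * (1 + ‖p‖)) ^ NT * (1 + 3 * M) *
          (D * Real.exp (-(c * t)) * (1 + ‖p‖)) := by gcongr
      _ = 1 * CT * (1 + 3 * M) ^ (NT + 1) * D * (1 + ‖p‖) ^ (NT + 1) *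
          Real.exp (-(c * t)) := by rw [mul_pow]; ring
      _ ≤ _ := by gcongr; norm_num

lemma DecayingFamily.hasFDerivAt_lawPair (hB : DecayingFamily lim diff h C c) (t : ℝ≥0) (q : H × Θ) :
    HasFDerivAt (lawPair ι lim diff h t)
      (((fderiv ℝ (lim) q.2 +
        fderiv ℝ (diff t) q.2).comp (ContinuousLinearMap.snd ℝ H Θ)) +
      ι.comp
        ((flow (h q.2) t).comp (ContinuousLinearMap.fst ℝ H Θ) +
        ((fderiv ℝ (fun η => flow (h η) t) q.2).comp
          (ContinuousLinearMap.snd ℝ H Θ)).flip q.1)) q := by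
  have h1 := ((hB.polyBdd_lim.hasFDerivAt one_le_two q.2).add
    ((hB.polyBdd_diff t).hasFDerivAt one_le_two q.2)).comp q (ContinuousLinearMap.snd ℝ H Θ).hasFDerivAt
  have h2 : HasFDerivAt (fun q : H × Θ => flow (h q.2) t)
      ((fderiv ℝ (fun η => flow (h η) t) q.2).comp (ContinuousLinearMap.snd ℝ H Θ)) q :=
    ((hB.polyBdd_flow t).hasFDerivAt one_le_two q.2).comp q (ContinuousLinearMap.snd ℝ H Θ).hasFDerivAt
  have h3 := h2.clm_apply (ContinuousLinearMap.fst ℝ H Θ).hasFDerivAt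
  exact h1.add (ι.hasFDerivAt.comp q h3)

/-- The tangent gap is the derivative of the mean along `η ↦ (x + x̃ η, θ + η)` minus the derivative
of the stationary mean. -/
lemma DecayingFamily.tangentGap_apply (hB : DecayingFamily lim diff h C c) {Φ : V → ℝ}
    (hΦ : Differentiable ℝ Φ) (t : ℝ≥0) (p : H × (Θ →L[ℝ] H)) (θ η : Θ) :
    tangentGap ι lim diff h Φ t p θ η =
      fderiv ℝ (fun q => Φ (lawPair ι lim diff h t q)) (p.1, θ) (p.2 η, η) -
        fderiv ℝ (fun θ => Φ (lim θ)) θ η := by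
  have h1 := ((hΦ _).hasFDerivAt.comp (p.1, θ) (hB.hasFDerivAt_lawPair (ι := ι) t (p.1, θ))).fderiv
  have h2 := ((hΦ _).hasFDerivAt.comp θ (hB.polyBdd_lim.hasFDerivAt one_le_two θ)).fderiv
  simp only [Function.comp_def] at h1 h2
  rw [h1, h2]
  unfold tangentGap tangentMap
  rw [ContinuousLinearMap.sub_apply]
  congr 1
  have e1 : (jetLim lim θ + (jetDiff diff t θ + jetLin ι h t θ p)).1 =
      lawPair ι lim diff h t (p.1, θ) := by
    simp only [jetLim, jetDiff, jetLin, ContinuousLinearMap.add_apply, jetFlow_apply,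
      jetFlowDeriv_apply, Prod.fst_add, lawPair, add_zero, add_assoc]
  rw [e1, ContinuousLinearMap.comp_apply, ContinuousLinearMap.comp_apply]
  congr 1
  simp only [jetLim, jetDiff, jetLin, ContinuousLinearMap.add_apply, jetFlow_apply,
    jetFlowDeriv_apply, Prod.snd_add, ContinuousLinearMap.comp_apply, map_add,
    ContinuousLinearMap.coe_snd', ContinuousLinearMap.coe_fst', ContinuousLinearMap.flip_apply]
  abel

lemma DecayingFamily.stronglyMeasurable_tangentGap (hB : DecayingFamily lim diff h C c) {Φ : V → ℝ} {N : ℕ} {CΦ : ℝ}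
    (hΦ : PolyBdd 3 Φ CΦ N) (p : H × (Θ →L[ℝ] H)) (θ : Θ) :
    StronglyMeasurable fun t => tangentGap ι lim diff h Φ t p θ := by
  obtain ⟨CT, NT, hT⟩ := tangentMap_polyBdd (Θ := Θ) (n := 2) hΦ
  have hf : ∀ θ, StronglyMeasurable fun t : ℝ≥0 => flow (h θ) t := fun θ =>
    ((continuous_flow (h θ)).comp NNReal.continuous_coe).stronglyMeasurable
  have hdp := hB.measurable_diff
  have h1 : StronglyMeasurable fun t => jetDiff diff t θ :=
    (hdp θ).prodMk (stronglyMeasurable_fderiv_param hdp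
      (fun t => (hB.polyBdd_diff t).differentiable one_le_two) θ)
  have h2 : StronglyMeasurable fun t : ℝ≥0 => jetLin ι h t θ :=
    ((jetFlow _).continuous.comp_stronglyMeasurable (hf θ)).add
      ((jetFlowDeriv _).continuous.comp_stronglyMeasurable (stronglyMeasurable_fderiv_param hf
        (fun t => (hB.polyBdd_flow t).differentiable one_le_two) θ))
  have h3 : StronglyMeasurable fun t : ℝ≥0 => jetLin ι h t θ p :=
    (ContinuousLinearMap.apply ℝ (V × (Θ →L[ℝ] V))
      p).continuous.comp_stronglyMeasurable h2
  exact (hT.continuous.comp_stronglyMeasurable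
    (stronglyMeasurable_const.add (h1.add h3))).sub stronglyMeasurable_const

variable (ι lim diff h) in
/-- The time integral of the tangent gap. -/
def potential (Φ : V → ℝ) (p : H × (Θ →L[ℝ] H)) (θ : Θ) : Θ →L[ℝ] ℝ :=
  ∫ t in Ioi (0 : ℝ), tangentGap ι lim diff h Φ t.toNNReal p θ

lemma integrableOn_exp_toNNReal {c : ℝ} (hc : 0 < c) (C : ℝ) :
    IntegrableOn (fun t : ℝ => C * Real.exp (-(c * t.toNNReal))) (Ioi 0) := by
  have h1 : IntegrableOn (fun t : ℝ => C * Real.exp (-c * t)) (Ioi 0) :=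
    (exp_neg_integrableOn_Ioi 0 hc).const_mul C
  refine h1.congr_fun (fun t ht => ?_) measurableSet_Ioi
  have : (t.toNNReal : ℝ) = t := Real.coe_toNNReal t (le_of_lt ht)
  simp [this]

/-- The bounds on the gap and its derivatives are integrable in time, so derivatives pass through
the time integral. Smoothness in the initial values and in the parameter is recorded separately:
order two for the former, one for the latter. -/
lemma DecayingFamily.polyBdd_potential (hB : DecayingFamily lim diff h C c) {Φ : V → ℝ} {N : ℕ} {CΦ : ℝ}
    (hΦ : PolyBdd 3 Φ CΦ N) :
    ∃ (C' : ℝ) (N' : ℕ),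
      (∀ θ, PolyBdd 2 (fun p => potential ι lim diff h Φ p θ) C' N') ∧
      ∀ p, PolyBdd 1 (fun θ => potential ι lim diff h Φ p θ) (C' * (1 + ‖p‖) ^ N') 0 := by
  obtain ⟨C', N', h1, h2⟩ := hB.polyBdd_tangentGap hΦ
  have hm : ∀ p θ, AEStronglyMeasurable
      (fun t : ℝ => tangentGap ι lim diff h Φ t.toNNReal p θ)
      (volume.restrict (Ioi 0)) := fun p θ =>
    ((hB.stronglyMeasurable_tangentGap hΦ p θ).comp_measurable
      measurable_real_toNNReal).aestronglyMeasurable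
  refine ⟨∫ t in Ioi (0 : ℝ), C' * Real.exp (-(c * t.toNNReal)), N', fun θ => ?_, fun p => ?_⟩
  · exact PolyBdd.integral (integrableOn_exp_toNNReal hB.rate_pos C') 2
      (fun t => h1 t.toNNReal θ) (fun p => hm p θ)
  · have := PolyBdd.integral (integrableOn_exp_toNNReal hB.rate_pos (C' * (1 + ‖p‖) ^ N')) 1
      (fun t => h2 t.toNNReal p) (fun θ => hm p θ)
    refine this.mono (le_of_eq ?_) le_rfl
    rw [← integral_mul_const]
    congr 1
    ext t
    ring

end Potential

/-! ### The mean and covariance root as an exponentially converging family. -/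

section Law

variable {H Θ : Type} [NormedAddCommGroup H] [InnerProductSpace ℝ H] [FiniteDimensional ℝ H]
  [NormedAddCommGroup Θ] [NormedSpace ℝ Θ]

lemma IsStable.stronglyMeasurable_rootDefect {K ρ : ℝ} {A : H →L[ℝ] H} (hA : IsStable K ρ A) :
    StronglyMeasurable fun t : ℝ≥0 => rootDefect A t := by
  refine stronglyMeasurable_of_tendsto atTop
    (f := fun n (t : ℝ≥0) => ∑ k ∈ Finset.range n, sqrtCoeff k • flow A (2 * (k + 1) * t))
    (fun n => ?_) ?_
  · refine Continuous.stronglyMeasurable ?_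
    have := continuous_flow A
    fun_prop
  · rw [tendsto_pi_nhds]
    intro t
    refine HasSum.tendsto_sum_nat (Summable.hasSum ?_)
    refine Summable.of_norm_bounded summable_sqrtCoeff fun k => ?_
    rw [norm_smul, Real.norm_of_nonneg (sqrtCoeff_nonneg k)]
    exact mul_le_of_le_one_right (sqrtCoeff_nonneg k) (hA.norm_flow_le_one (by positivity))

variable (K σ : ℝ) (g : Θ → H) (h : Θ → H →L[ℝ] H)

/-- The mean and the square root of the covariance of the stationary distribution. -/
def limPair (θ : Θ) : H × (H →L[ℝ] H) := (invOp K (h θ) (g θ), statRoot K σ (h θ))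

/-- The difference of the law parameters at time `t` for the process started at `0` and those of
the stationary distribution. -/
def diffPair (t : ℝ≥0) (θ : Θ) : H × (H →L[ℝ] H) :=
  (-(flow (h θ) t (invOp K (h θ) (g θ))), -(statRoot K σ (h θ) * rootDefect (h θ) t))

variable {K σ g h} {C c : ℝ}

lemma lawPair_eq (t : ℝ≥0) (q : H × Θ) :
    lawPair (ContinuousLinearMap.inl ℝ H (H →L[ℝ] H)) (limPair K σ g h) (diffPair K σ g h) h t q =
      (ouMean K (h q.2) (g q.2) q.1 t, covRoot K σ (h q.2) t) := by
  unfold lawPair limPair diffPair ouMean covRoot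
  ext1
  · simp only [Prod.fst_add, ContinuousLinearMap.inl_apply, map_sub]; abel
  · simp only [Prod.snd_add, ContinuousLinearMap.inl_apply, mul_sub, mul_one]; abel

lemma ParamBounds.polyBdd_limPair (hB : ParamBounds K σ g h C c) :
    PolyBdd 2 (limPair K σ g h) (C + C) 0 := hB.polyBdd_mean.prodMk hB.polyBdd_root

lemma ParamBounds.nonneg (hB : ParamBounds K σ g h C c) : 0 ≤ C := hB.polyBdd_mean.nonneg

lemma ParamBounds.polyBdd_diffPair (hB : ParamBounds K σ g h C c) :
    ∃ D, ∀ t, PolyBdd 2 (diffPair K σ g h t) (D * Real.exp (-(c * t))) 0 := by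
  refine ⟨‖ContinuousLinearMap.id ℝ (H →L[ℝ] H)‖ * (2 ^ 2 * C * C) + 2 ^ 2 * C * C, fun t => ?_⟩
  have h1 := ((hB.polyBdd_flow t).bilin (ContinuousLinearMap.id ℝ (H →L[ℝ] H)) hB.polyBdd_mean).neg
  have h2 := (hB.polyBdd_root.mul (hB.polyBdd_defect t)).neg
  exact PolyBdd.mono (h1.prodMk h2) (le_of_eq (by ring)) le_rfl

lemma stronglyMeasurable_diffPair {ρ : ℝ} (hs : ∀ θ, IsStable K ρ (h θ)) (θ : Θ) :
    StronglyMeasurable fun t : ℝ≥0 => diffPair K σ g h t θ := by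
  have hf : StronglyMeasurable fun t : ℝ≥0 => flow (h θ) t :=
    ((continuous_flow (h θ)).comp NNReal.continuous_coe).stronglyMeasurable
  refine StronglyMeasurable.prodMk ?_ ?_
  · exact ((ContinuousLinearMap.apply ℝ H
      (invOp K (h θ) (g θ))).continuous.comp_stronglyMeasurable hf).neg
  · exact ((hs θ).stronglyMeasurable_rootDefect.const_mul _).neg

/-- The law parameters are bounded `C²` functions of the parameter and converge exponentially. -/
lemma ParamBounds.decayingFamily (hB : ParamBounds K σ g h C c) {ρ : ℝ}
    (hs : ∀ θ, IsStable K ρ (h θ)) :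
    ∃ D, DecayingFamily (limPair K σ g h) (diffPair K σ g h) h D c := by
  obtain ⟨D, hD⟩ := hB.polyBdd_diffPair
  refine ⟨max (C + C) D, hB.rate_pos, hB.polyBdd_limPair.mono (le_max_left _ _) le_rfl,
    fun t => (hD t).mono (by gcongr; exact le_max_right _ _) le_rfl,
    fun t => (hB.polyBdd_flow t).mono ?_ le_rfl, stronglyMeasurable_diffPair hs⟩
  have := hB.nonneg
  gcongr
  exact le_trans (by linarith) (le_max_left _ _)

end Law

/-! ### Characteristic functions of Wiener integrals of step functions. -/

section Noise

variable {Ω : Type*} [MeasurableSpace Ω] {H : Type} [NormedAddCommGroup H] [InnerProductSpace ℝ H]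
  [MeasurableSpace H] [BorelSpace H]

/-- The properties of a Brownian motion with values in `H` that determine the laws of Wiener
integrals of step functions. -/
structure IsNoise (P : Measure Ω) (W : ℝ≥0 → Ω → H) : Prop where
  measurable : ∀ t, Measurable (W t)
  path : ∀ᵐ ω ∂P, Continuous (fun t => W t ω) ∧ W 0 ω = 0
  charFun_sum : ∀ (δ : ℝ≥0) (n : ℕ) (ξ : ℕ → H),
    ∫ ω, Complex.exp (((∑ j ∈ Finset.range n,
      inner ℝ (ξ j) (W ((j + 1 : ℕ) * δ) ω - W (j * δ) ω) : ℝ) : ℂ) * Complex.I) ∂P =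
        Complex.exp ((-(∑ j ∈ Finset.range n, δ * ‖ξ j‖ ^ 2) / 2 : ℝ))

/-- Increments over the grid of mesh δ are independent Gaussians of variance δ, so the
characteristic functions multiply. -/
lemma IsBrownianReal.charFun_sum {P : Measure Ω} {B : ℝ≥0 → Ω → ℝ}
    (hB : IsBrownianReal B P) (hm : ∀ t, Measurable (B t)) (δ : ℝ≥0) (n : ℕ) (ξ : ℕ → ℝ) :
    charFun (P.map fun ω => ∑ j ∈ Finset.range n,
      ξ j * (B ((j + 1 : ℕ) * δ) ω - B (j * δ) ω)) 1 =
        Complex.exp ((-(∑ j ∈ Finset.range n, δ * ξ j ^ 2) / 2 : ℝ)) := by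
  have hmono : Monotone fun j : ℕ => (j : ℝ≥0) * δ := fun i j hij => by
    dsimp only; gcongr
  have hind : iIndepFun (fun (j : ℕ) ω => ξ j * (B ((j + 1 : ℕ) * δ) ω - B (j * δ) ω)) P :=
    (hB.hasIndepIncrements.nat hmono).comp (fun j x => ξ j * x) (fun j => measurable_const_mul _)
  have hmeas : ∀ j : ℕ, Measurable fun ω => ξ j * (B ((j + 1 : ℕ) * δ) ω - B (j * δ) ω) :=
    fun j => ((hm _).sub (hm _)).const_mul _
  rw [iIndepFun.charFun_map_fun_finsetSum_eq_prod
    (fun j _ => (hmeas j).aemeasurable) (hind.restrict _),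
    Finset.prod_apply]
  have key : ∀ j : ℕ, charFun (P.map fun ω =>
      ξ j * (B ((j + 1 : ℕ) * δ) ω - B (j * δ) ω)) 1 = Complex.exp ((-(δ * ξ j ^ 2) / 2 : ℝ)) := by
    intro j
    have h1 := (gaussianReal_const_mul (hB.hasLaw_sub ((j + 1 : ℕ) * δ) (j * δ)) (ξ j)).map_eq
    simp only [Pi.sub_apply] at h1
    have h2 : nndist ((j + 1 : ℕ) * δ : ℝ≥0).1 (j * δ : ℝ≥0).1 = δ := by
      ext
      rw [coe_nndist, Real.dist_eq]
      change |(((j + 1 : ℕ) * δ : ℝ≥0) : ℝ) - ((j * δ : ℝ≥0) : ℝ)| = δ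
      push_cast
      rw [show ((j : ℝ) + 1) * δ - j * δ = δ by ring, abs_of_nonneg δ.coe_nonneg]
    rw [h2] at h1
    rw [h1, charFun_gaussianReal]
    congr 1
    push_cast
    ring
  simp_rw [key]
  rw [← Complex.exp_sum]
  congr 1
  push_cast
  rw [← Finset.sum_neg_distrib, Finset.sum_div]

/-- Independence of the coordinates turns the characteristic function into a product of
one-dimensional ones; interchanging the sums over time and coordinates gives inner products and
Euclidean norms. -/
lemma IsBrownianVec.isNoise {d : ℕ} {P : Measure Ω} [IsProbabilityMeasure P]
    {W : ℝ≥0 → Ω → Vec d} (hW : IsBrownianVec P W) : IsNoise P W where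
  measurable := hW.measurable
  path := by
    have h1 : ∀ᵐ ω ∂P, ∀ i, Continuous (fun t => W t ω i) :=
      ae_all_iff.2 fun i => (hW.coord i).cont
    have h2 : ∀ᵐ ω ∂P, ∀ i, W 0 ω i = 0 := ae_all_iff.2 fun i => (hW.coord i).eval_zero_ae_eq_zero
    filter_upwards [h1, h2] with ω h1 h2
    refine ⟨?_, by ext i; simpa using h2 i⟩
    exact (PiLp.continuous_toLp 2 _).comp (continuous_pi h1)
  charFun_sum δ n ξ := by
    have hm : ∀ t i, Measurable fun ω => W t ω i := fun t i =>
      (EuclideanSpace.proj (𝕜 := ℝ) i).continuous.measurable.comp (hW.measurable t)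
    set Y : Fin d → Ω → ℝ := fun c ω => ∑ j ∈ Finset.range n,
      ξ j c * (W ((j + 1 : ℕ) * δ) ω c - W (j * δ) ω c) with hY
    have hYm : ∀ c, Measurable (Y c) := fun c =>
      Finset.measurable_sum _ fun j _ => ((hm _ c).sub (hm _ c)).const_mul _
    have hind : iIndepFun Y P := by
      refine hW.indep.comp (fun c w => ∑ j ∈ Finset.range n,
        ξ j c * (w ((j + 1 : ℕ) * δ) - w (j * δ))) fun c => ?_
      fun_prop
    have h1 : charFun (P.map fun ω => ∑ c, Y c ω) 1 =
        ∏ c, charFun (P.map (Y c)) 1 := by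
      rw [iIndepFun.charFun_map_fun_sum_eq_prod (fun c => (hYm c).aemeasurable) hind,
        Finset.prod_apply]
    have h2 : ∀ c, charFun (P.map (Y c)) 1 =
        Complex.exp ((-(∑ j ∈ Finset.range n, δ * ξ j c ^ 2) / 2 : ℝ)) := fun c =>
      IsBrownianReal.charFun_sum (hW.coord c) (fun t => hm t c) δ n fun j => ξ j c
    simp_rw [h2] at h1
    rw [← Complex.exp_sum, charFun_apply_real, integral_map
      (Finset.measurable_sum _ fun c _ => hYm c).aemeasurable
      (by fun_prop)] at h1
    convert h1 using 1
    · congr 1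
      ext ω
      congr 2
      rw [Complex.ofReal_one, one_mul]
      congr 1
      simp only [hY]
      rw [Finset.sum_comm]
      refine Finset.sum_congr rfl fun j _ => ?_
      rw [PiLp.inner_apply]
      refine Finset.sum_congr rfl fun c _ => ?_
      simp [mul_comm]
    · congr 1
      rw [← Complex.ofReal_sum]
      congr 1
      rw [← Finset.sum_div, Finset.sum_neg_distrib, Finset.sum_comm]
      congr 2
      refine Finset.sum_congr rfl fun j _ => ?_
      rw [← Finset.mul_sum, EuclideanSpace.norm_sq_eq]
      simp

end Noise

/-! ### Riemann sums with one frozen variable. -/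

section Riemann

/-- Riemann sums in which the second variable is frozen on each interval of the partition. -/
lemma tendsto_sum_integral_frozen {F : ℝ → ℝ → ℝ} (hF : Continuous (Function.uncurry F)) {t : ℝ}
    (ht : 0 ≤ t) {τ : ℕ → ℕ → ℝ}
    (hτ : ∀ n j : ℕ, j < n → τ n j ∈ Icc (j * (t / n)) ((j + 1) * (t / n))) :
    Tendsto (fun n : ℕ => ∑ j ∈ Finset.range n,
        ∫ s in (j * (t / n))..((j + 1) * (t / n)), F s (τ n j)) atTop
      (𝓝 (∫ s in (0 : ℝ)..t, F s s)) := by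
  have hFd : Continuous fun s => F s s := hF.comp (continuous_id.prodMk continuous_id)
  have hFc : ∀ u, Continuous fun s => F s u := fun u => hF.comp (continuous_id.prodMk continuous_const)
  have huc := (isCompact_Icc.prod isCompact_Icc : IsCompact (Icc 0 t ×ˢ Icc 0 t)).uniformContinuousOn_of_continuous
    hF.continuousOn
  rw [Metric.uniformContinuousOn_iff] at huc
  rw [Metric.tendsto_atTop]
  intro ε hε
  obtain ⟨δ, hδ, h⟩ := huc (ε / (t + 1)) (by positivity)
  obtain ⟨N, hN⟩ := exists_nat_gt (t / δ)
  refine ⟨N + 1, fun n hn => ?_⟩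
  have hn0 : (0 : ℝ) < n := by exact_mod_cast (by omega : 0 < n)
  have htn : t / n < δ := by
    rw [div_lt_iff₀ hn0]
    have : (N : ℝ) ≤ n := by exact_mod_cast (by omega : N ≤ n)
    rw [div_lt_iff₀ hδ] at hN
    nlinarith
  have hsum : ∑ j ∈ Finset.range n, ∫ s in (j * (t / n))..((j + 1) * (t / n)), F s s =
      ∫ s in (0 : ℝ)..t, F s s := by
    have := intervalIntegral.sum_integral_adjacent_intervals (f := fun s => F s s) (μ := volume)
      (a := fun j : ℕ => j * (t / n)) (n := n) (fun k _ => hFd.intervalIntegrable _ _)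
    simp only [Nat.cast_add, Nat.cast_one, Nat.cast_zero, zero_mul] at this
    rw [this]
    congr 1
    field_simp
  rw [Real.dist_eq, ← hsum, ← Finset.sum_sub_distrib]
  have hterm : ∀ j ∈ Finset.range n,
      |(∫ s in (j * (t / n))..((j + 1) * (t / n)), F s (τ n j)) -
        ∫ s in (j * (t / n))..((j + 1) * (t / n)), F s s| ≤ ε / (t + 1) * (t / n) := by
    intro j hj
    have hjn : j < n := Finset.mem_range.1 hj
    rw [← intervalIntegral.integral_sub ((hFc _).intervalIntegrable _ _)
      (hFd.intervalIntegrable _ _), ← Real.norm_eq_abs]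
    have hlen : ((j : ℝ) + 1) * (t / n) - j * (t / n) = t / n := by ring
    have htn0 : 0 ≤ t / n := by positivity
    have hle : (j : ℝ) * (t / n) ≤ (j + 1) * (t / n) := by linarith
    have hup : ((j : ℝ) + 1) * (t / n) ≤ t := by
      have : (j : ℝ) + 1 ≤ n := by exact_mod_cast hjn
      calc _ ≤ (n : ℝ) * (t / n) := by gcongr
        _ = t := by field_simp
    refine (intervalIntegral.norm_integral_le_of_norm_le_const (C := ε / (t + 1))
      fun s hs => ?_).trans (le_of_eq ?_)
    · rw [uIoc_of_le hle] at hs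
      have hτj := hτ n j hjn
      have h0 : 0 ≤ (j : ℝ) * (t / n) := by positivity
      have := h (s, τ n j) ⟨⟨by linarith [hs.1], by linarith [hs.2]⟩,
        ⟨by linarith [hτj.1], by linarith [hτj.2]⟩⟩ (s, s)
        ⟨⟨by linarith [hs.1], by linarith [hs.2]⟩, ⟨by linarith [hs.1], by linarith [hs.2]⟩⟩ ?_
      · rw [Real.norm_eq_abs, ← Real.dist_eq]; exact this.le
      · rw [Prod.dist_eq, dist_self, max_lt_iff]
        refine ⟨hδ, ?_⟩
        rw [Real.dist_eq, abs_lt]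
        constructor <;> linarith [hs.1, hs.2, hτj.1, hτj.2]
    · rw [hlen, abs_of_nonneg htn0]
  calc _ ≤ ∑ j ∈ Finset.range n, ε / (t + 1) * (t / n) :=
        (Finset.abs_sum_le_sum_abs _ _).trans (Finset.sum_le_sum hterm)
    _ = ε * (t / (t + 1)) := by
        rw [Finset.sum_const, Finset.card_range, nsmul_eq_mul]; field_simp
    _ < ε := by
        have : t / (t + 1) < 1 := by rw [div_lt_one (by positivity)]; linarith
        nlinarith

end Riemann

/-! ### Pathwise solution of the linear equation. -/

section Paths

variable {H : Type} [NormedAddCommGroup H] [InnerProductSpace ℝ H] [CompleteSpace H]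

/-- Variation of constants. -/
lemma variation_of_constants {A : H →L[ℝ] H} {y b : ℝ → H} (hy : Continuous y) (hb : Continuous b)
    {y₀ : H} (h : ∀ τ, 0 ≤ τ → y τ = y₀ + ∫ s in (0 : ℝ)..τ, (b s - A (y s))) {t : ℝ}
    (ht : 0 ≤ t) :
    y t = flow A t y₀ + ∫ s in (0 : ℝ)..t, flow A (t - s) (b s) := by
  have hE : Continuous fun s => flow A (t - s) := (continuous_flow A).comp (by fun_prop)
  have hcont : Continuous fun s => b s - A (y s) := by fun_prop
  -- The derivative of the semigroup cancels the term A y, so only the forcing b remains.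
  have hd : ∀ s ∈ Ioo 0 t, HasDerivAt (fun s => flow A (t - s) (y s)) (flow A (t - s) (b s)) s := by
    intro s hs
    have h1 : HasDerivAt y (b s - A (y s)) s := by
      have := (intervalIntegral.integral_hasDerivAt_right (hcont.intervalIntegrable 0 s)
        (hcont.stronglyMeasurableAtFilter _ _) hcont.continuousAt).const_add y₀
      refine this.congr_of_eventuallyEq ?_
      filter_upwards [lt_mem_nhds hs.1] with τ hτ using h τ hτ.le
    have h2 : HasDerivAt (fun s => flow A (t - s)) (A * flow A (t - s)) s := by
      have := (hasDerivAt_flow A (t - s)).scomp s ((hasDerivAt_id s).const_sub t)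
      simpa [Function.comp_def] using this
    refine (h2.clm_apply h1).congr_deriv ?_
    rw [map_sub, (commute_flow_self A (t - s)).eq]
    simp
  have := intervalIntegral.integral_eq_sub_of_hasDerivAt_of_le ht
    (hE.clm_apply hy).continuousOn hd ((hE.clm_apply hb).intervalIntegrable 0 t)
  have h0 : y 0 = y₀ := by simpa using h 0 le_rfl
  rw [this, sub_self, flow_zero, sub_zero, h0]
  simp

lemma norm_le_of_variation_of_constants {K ρ : ℝ} {A : H →L[ℝ] H} (hA : IsStable K ρ A)
    {y b : ℝ → H} (hy : Continuous y) (hb : Continuous b) {y₀ : H}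
    (h : ∀ τ, 0 ≤ τ → y τ = y₀ + ∫ s in (0 : ℝ)..τ, (b s - A (y s))) {t : ℝ} (ht : 0 ≤ t) :
    ‖y t‖ ≤ ‖y₀‖ + ∫ s in (0 : ℝ)..t, ‖b s‖ := by
  have hE : Continuous fun s => flow A (t - s) := (continuous_flow A).comp (by fun_prop)
  rw [variation_of_constants hy hb h ht]
  refine (norm_add_le _ _).trans (add_le_add ?_ ?_)
  · exact ((flow A t).le_opNorm _).trans
      (mul_le_of_le_one_left (norm_nonneg _) (hA.norm_flow_le_one ht))
  · refine (intervalIntegral.norm_integral_le_integral_norm ht).trans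
      (intervalIntegral.integral_mono_on ht ((hE.clm_apply hb).norm.intervalIntegrable _ _)
        (hb.norm.intervalIntegrable _ _) fun s hs => ?_)
    exact ((flow A _).le_opNorm _).trans
      (mul_le_of_le_one_left (norm_nonneg _) (hA.norm_flow_le_one (by linarith [hs.2])))

/-- The Wiener integral `∫_0^t exp (-(t-s)A) dw_s`, integrated by parts. -/
def wienerConv (A : H →L[ℝ] H) (w : ℝ → H) (t : ℝ) : H :=
  w t - ∫ s in (0 : ℝ)..t, flow A (t - s) (A (w s))

/-- Subtracting the noise σw and the equilibrium A⁻¹a leaves a path that solves a linear equation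
with the continuous forcing -σAw. The stochastic integral is thereby replaced by an ordinary one. -/
lemma eq_ouMean_add_wienerConv {K ρ : ℝ} {A : H →L[ℝ] H} (hA : IsStable K ρ A) {a x₀ : H} {σ : ℝ}
    {x w : ℝ → H} (hx : Continuous x) (hw : Continuous w)
    (h : ∀ τ, 0 ≤ τ → x τ = x₀ + (∫ s in (0 : ℝ)..τ, (a - A (x s))) + σ • w τ) {t : ℝ}
    (ht : 0 ≤ t) : x t = ouMean K A a x₀ t + σ • wienerConv A w t := by
  have key := variation_of_constants (A := A) (y := fun τ => x τ - σ • w τ - invOp K A a)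
    (b := fun s => -(σ • A (w s))) (y₀ := x₀ - invOp K A a) (by fun_prop) (by fun_prop)
    (fun τ hτ => by
      rw [h τ hτ]
      have e : ∀ s, -(σ • A (w s)) - A (x s - σ • w s - invOp K A a) = a - A (x s) := fun s => by
        rw [map_sub, map_sub, map_smul, hA.apply_invOp]; abel
      simp_rw [e]
      abel) ht
  have e2 : ∀ s, flow A (t - s) (-(σ • A (w s))) = -(σ • flow A (t - s) (A (w s))) := fun s => by
    rw [map_neg, map_smul]
  simp_rw [e2] at key
  rw [intervalIntegral.integral_neg, intervalIntegral.integral_smul] at key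
  unfold ouMean wienerConv
  rw [sub_eq_iff_eq_add, sub_eq_iff_eq_add] at key
  rw [key, smul_sub]
  abel

lemma sum_inner_sub_by_parts (ξ : H) (E : ℕ → H →L[ℝ] H) (w : ℕ → H) (n : ℕ) :
    ∑ j ∈ Finset.range n, inner ℝ ξ (E j (w (j + 1) - w j)) =
      inner ℝ ξ (E n (w n)) - inner ℝ ξ (E 0 (w 0)) -
        ∑ j ∈ Finset.range n, inner ℝ ξ ((E (j + 1) - E j) (w (j + 1))) := by
  induction n with
  | zero => simp
  | succ n ih =>
    rw [Finset.sum_range_succ, ih, Finset.sum_range_succ]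
    simp only [map_sub, inner_sub_right, ContinuousLinearMap.sub_apply]
    ring

/-- Stieltjes sums against the rough path w converge after summation by parts, which moves the
increments onto the smooth semigroup. This is what links the convolution with independent
increments. -/
lemma tendsto_sum_inner_wienerConv (A : H →L[ℝ] H) {w : ℝ → H} (hw : Continuous w) (h0 : w 0 = 0)
    {t : ℝ} (ht : 0 ≤ t) (ξ : H) :
    Tendsto (fun n : ℕ => ∑ j ∈ Finset.range n, inner ℝ ξ (flow A (t - j * (t / n))
      (w ((j + 1 : ℕ) * (t / n)) - w (j * (t / n))))) atTop (𝓝 (inner ℝ ξ (wienerConv A w t))) := by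
  have hE : Continuous fun s => flow A (t - s) := (continuous_flow A).comp (by fun_prop)
  have hF : Continuous (Function.uncurry fun s u : ℝ => inner ℝ ξ (flow A (t - s) (A (w u)))) := by
    refine continuous_const.inner ?_
    exact (hE.comp continuous_fst).clm_apply ((A.continuous.comp hw).comp continuous_snd)
  -- Right endpoints, because summation by parts leaves the value of w at the end of each interval.
  have key := tendsto_sum_integral_frozen hF ht (τ := fun n j => (j + 1) * (t / n))
    (fun n j _ => ⟨by gcongr; linarith, le_rfl⟩)
  have hd : ∀ v s, HasDerivAt (fun s => (inner ℝ ξ (flow A (t - s) v) : ℝ))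
      (inner ℝ ξ (flow A (t - s) (A v))) s := by
    intro v s
    have h2 : HasDerivAt (fun s => flow A (t - s)) (A * flow A (t - s)) s := by
      have := (hasDerivAt_flow A (t - s)).scomp s ((hasDerivAt_id s).const_sub t)
      simpa [Function.comp_def] using this
    rw [(commute_flow_self A (t - s)).eq] at h2
    have h3 := (innerSL ℝ ξ).hasFDerivAt.comp_hasDerivAt s
      (((ContinuousLinearMap.apply ℝ H v).hasFDerivAt).comp_hasDerivAt s h2)
    exact h3
  have hlim : (inner ℝ ξ (wienerConv A w t) : ℝ) = inner ℝ ξ (w t) -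
      ∫ s in (0 : ℝ)..t, inner ℝ ξ (flow A (t - s) (A (w s))) := by
    unfold wienerConv
    rw [inner_sub_right]
    congr 1
    exact ((innerSL ℝ ξ).intervalIntegral_comp_comm
      ((hE.clm_apply (A.continuous.comp hw)).intervalIntegrable 0 t)).symm
  rw [hlim]
  refine (tendsto_const_nhds.sub key).congr' ?_
  filter_upwards [eventually_gt_atTop 0] with n hn
  have hn0 : (n : ℝ) ≠ 0 := by positivity
  rw [sum_inner_sub_by_parts ξ (fun j => flow A (t - j * (t / n))) (fun j => w (j * (t / n))),
    mul_div_cancel₀ _ hn0, sub_self, flow_zero]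
  simp only [Nat.cast_zero, zero_mul, h0, map_zero, inner_zero_right, sub_zero,
    ContinuousLinearMap.one_apply]
  congr 1
  refine Finset.sum_congr rfl fun j _ => ?_
  rw [intervalIntegral.integral_eq_sub_of_hasDerivAt (fun s _ => hd _ s)]
  · rw [ContinuousLinearMap.sub_apply, inner_sub_right]
    push_cast
    rfl
  · refine Continuous.intervalIntegrable ?_ _ _
    exact continuous_const.inner (hE.clm_apply continuous_const)

lemma tendsto_sum_norm_flow_sq (A : H →L[ℝ] H) {t : ℝ} (ht : 0 ≤ t) (ξ : H) :
    Tendsto (fun n : ℕ => ∑ j ∈ Finset.range n, t / n * ‖flow A (t - j * (t / n)) ξ‖ ^ 2) atTop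
      (𝓝 (∫ s in (0 : ℝ)..t, ‖flow A s ξ‖ ^ 2)) := by
  have hE : Continuous fun s => flow A (t - s) := (continuous_flow A).comp (by fun_prop)
  have hF : Continuous (Function.uncurry fun _ u : ℝ => ‖flow A (t - u) ξ‖ ^ 2) :=
    (((hE.comp continuous_snd).clm_apply continuous_const).norm.pow 2)
  have key := tendsto_sum_integral_frozen hF ht (τ := fun n j => j * (t / n))
    (fun n j _ => ⟨le_rfl, by gcongr; linarith⟩)
  have e : ∫ s in (0 : ℝ)..t, ‖flow A (t - s) ξ‖ ^ 2 = ∫ s in (0 : ℝ)..t, ‖flow A s ξ‖ ^ 2 := by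
    rw [intervalIntegral.integral_comp_sub_left (fun s => ‖flow A s ξ‖ ^ 2) t]
    simp
  rw [e] at key
  refine key.congr fun n => Finset.sum_congr rfl fun j _ => ?_
  rw [intervalIntegral.integral_const, smul_eq_mul]
  ring

end Paths

/-! ### The Gaussian law of X at a positive time. -/

section GaussianLaw

variable {Ω : Type*} [MeasurableSpace Ω] {P : Measure Ω} [IsProbabilityMeasure P]
  {H : Type} [NormedAddCommGroup H] [InnerProductSpace ℝ H]
  [MeasurableSpace H] [BorelSpace H] [FiniteDimensional ℝ H] {W : ℝ≥0 → Ω → H}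

/-- The Stieltjes sums have known characteristic functions; bounded convergence passes to the limit
on one side, Riemann sums of ‖e^{-sA}ξ‖² on the other. -/
lemma IsNoise.integral_exp_wienerConv (hW : IsNoise P W) {A : H →L[ℝ] H} (hA : IsSelfAdjoint A)
    (t : ℝ≥0) (ξ : H) :
    ∫ ω, Complex.exp (((inner ℝ ξ (wienerConv A (fun s => W s.toNNReal ω) t) : ℝ) : ℂ) *
      Complex.I) ∂P = Complex.exp ((-(∫ s in (0 : ℝ)..t, ‖flow A s ξ‖ ^ 2) / 2 : ℝ)) := by
  have hsa : ∀ s (v : H), (inner ℝ ξ (flow A s v) : ℝ) = inner ℝ (flow A s ξ) v := fun s v =>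
    ((ContinuousLinearMap.isSelfAdjoint_iff_isSymmetric.1 (isSelfAdjoint_flow hA s)) ξ v).symm
  have hcast : ∀ n j : ℕ, ((j : ℝ) * (t / n)).toNNReal = j * (t / n) := fun n j => by
    rw [← NNReal.coe_natCast j, ← NNReal.coe_natCast n, ← NNReal.coe_div, ← NNReal.coe_mul,
      Real.toNNReal_coe]
  have h1 : Tendsto (fun n : ℕ => ∫ ω, Complex.exp (((∑ j ∈ Finset.range n,
      inner ℝ (flow A (t - j * (t / n)) ξ) (W ((j + 1 : ℕ) * (t / n)) ω - W (j * (t / n)) ω) : ℝ)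
        : ℂ) * Complex.I) ∂P) atTop
      (𝓝 (∫ ω, Complex.exp (((inner ℝ ξ (wienerConv A (fun s => W s.toNNReal ω) t) : ℝ) : ℂ) *
      Complex.I) ∂P)) := by
    refine tendsto_integral_of_dominated_convergence (fun _ => 1) (fun n => ?_)
      (integrable_const _) (fun n => ae_of_all _ fun ω => ?_) ?_
    · refine Measurable.aestronglyMeasurable ?_
      have : Measurable fun ω => (∑ j ∈ Finset.range n,
        inner ℝ (flow A (t - j * (t / n)) ξ)
          (W ((j + 1 : ℕ) * (t / n)) ω - W (j * (t / n)) ω) : ℝ) :=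
        Finset.measurable_sum _ fun j _ =>
          measurable_const.inner ((hW.measurable _).sub (hW.measurable _))
      exact ((Complex.measurable_ofReal.comp this).mul_const _).cexp
    · rw [Complex.norm_exp_ofReal_mul_I]
    · filter_upwards [hW.path] with ω hω
      have hw : Continuous fun s : ℝ => W s.toNNReal ω := hω.1.comp continuous_real_toNNReal
      have := tendsto_sum_inner_wienerConv A hw (by simpa using hω.2) t.coe_nonneg ξ
      have hc : Continuous fun r : ℝ => Complex.exp ((r : ℂ) * Complex.I) := by fun_prop
      refine ((hc.tendsto _).comp this).congr fun n => ?_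
      simp only [Function.comp_apply, hcast, hsa]
  have h2 := ((Complex.continuous_ofReal.comp ((continuous_neg.div_const (2 : ℝ)))).cexp.tendsto
    _).comp (tendsto_sum_norm_flow_sq A t.coe_nonneg ξ)
  refine tendsto_nhds_unique h1 (h2.congr fun n => ?_)
  rw [hW.charFun_sum (t / n) n fun j => flow A (t - j * (t / n)) ξ]
  simp

/-- The Gaussian measure with mean `a.1` and covariance root `a.2`. -/
def gaussianOf (a : H × (H →L[ℝ] H)) : Measure H := (stdGaussian H).map fun z => a.1 + a.2 z

lemma measurable_affine (a : H × (H →L[ℝ] H)) : Measurable fun z => a.1 + a.2 z :=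
  (a.2.continuous.const_add a.1 |>.congr fun _ => rfl).measurable

instance (a : H × (H →L[ℝ] H)) : IsProbabilityMeasure (gaussianOf a) :=
  Measure.isProbabilityMeasure_map (measurable_affine a).aemeasurable

lemma charFun_gaussianOf {a : H × (H →L[ℝ] H)} (ha : IsSelfAdjoint a.2) (ξ : H) :
    charFun (gaussianOf a) ξ =
      Complex.exp ((inner ℝ ξ a.1 : ℝ) * Complex.I) * Complex.exp ((-‖a.2 ξ‖ ^ 2 / 2 : ℝ)) := by
  have hs : ∀ z, (inner ℝ (a.2 z) ξ : ℝ) = inner ℝ z (a.2 ξ) := fun z =>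
    (ContinuousLinearMap.isSelfAdjoint_iff_isSymmetric.1 ha) z ξ
  have h1 := charFun_stdGaussian (a.2 ξ)
  rw [charFun_apply] at h1 ⊢
  rw [gaussianOf, integral_map (measurable_affine a).aemeasurable (by fun_prop)]
  simp_rw [inner_add_left, hs]
  push_cast
  simp_rw [add_mul, Complex.exp_add]
  rw [integral_const_mul, h1, real_inner_comm]

lemma integral_gaussianOf (a : H × (H →L[ℝ] H)) {f : H → ℝ} (hf : Continuous f) :
    ∫ y, f y ∂gaussianOf a = smear (stdGaussian H) f a :=
  integral_map (measurable_affine a).aemeasurable hf.aestronglyMeasurable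

/-- The law of the process. -/
lemma IsNoise.map_eq_gaussianOf (hW : IsNoise P W) {K ρ σ : ℝ} {A : H →L[ℝ] H}
    (hA : IsStable K ρ A) {a x : H} {X : ℝ≥0 → Ω → H} (hm : ∀ t, Measurable (X t))
    (hX : ∀ᵐ ω ∂P, Continuous (fun t => X t ω) ∧ ∀ t : ℝ≥0,
      X t ω = x + (∫ s in (0 : ℝ)..t, (a - A (X s.toNNReal ω))) + σ • W t ω)
    {t : ℝ≥0} (ht : 0 < t) :
    P.map (X t) = gaussianOf (ouMean K A a x t, covRoot K σ A t) := by
  have : IsProbabilityMeasure (P.map (X t)) :=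
    Measure.isProbabilityMeasure_map (hm t).aemeasurable
  refine Measure.ext_of_charFun (funext fun ξ => ?_)
  rw [charFun_gaussianOf (a := (ouMean K A a x t, covRoot K σ A t)) (hA.selfAdjoint_covRoot t), charFun_apply,
    integral_map (hm t).aemeasurable (by fun_prop)]
  -- The factor σ in front of the convolution is moved onto the test vector.
  have key := hW.integral_exp_wienerConv hA.symm t (σ • ξ)
  have e1 : (∫ s in (0 : ℝ)..t, ‖flow A s (σ • ξ)‖ ^ 2) = ‖covRoot K σ A t ξ‖ ^ 2 := by
    rw [← hA.integral_norm_flow_sq (σ := σ) ξ (NNReal.coe_pos.2 ht)]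
    congr 1
    ext s
    rw [map_smul, norm_smul, mul_pow, Real.norm_eq_abs, sq_abs]
  rw [e1] at key
  rw [← key, ← integral_const_mul]
  refine integral_congr_ae ?_
  filter_upwards [hX, hW.path] with ω hω hw
  have := eq_ouMean_add_wienerConv hA (x := fun s => X s.toNNReal ω)
    (w := fun s => W s.toNNReal ω) (hω.1.comp continuous_real_toNNReal)
    (hw.1.comp continuous_real_toNNReal) (fun τ hτ => by
      have := hω.2 τ.toNNReal
      rwa [Real.coe_toNNReal τ hτ] at this) t.coe_nonneg
  simp only [Real.toNNReal_coe] at this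
  rw [this, ← Complex.exp_add, ← add_mul, ← Complex.ofReal_add]
  congr 3
  rw [inner_add_left, real_inner_smul_left, real_inner_smul_left, real_inner_comm ξ,
    real_inner_comm ξ (wienerConv _ _ _)]

end GaussianLaw

/-! ### Moments of time averages, and convergence of means under an L² bound. -/

section Moments

variable {Ω : Type*} [MeasurableSpace Ω] {P : Measure Ω} [IsProbabilityMeasure P]
  {H : Type*} [NormedAddCommGroup H]

lemma integral_pow_le_of_eLpNorm_le {Z : Ω → H} {N : ℕ} {M : ℝ≥0}
    (hZ : eLpNorm Z N P ≤ M) : ∫ ω, ‖Z ω‖ ^ N ∂P ≤ M ^ N := by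
  rcases Nat.eq_zero_or_pos N with rfl | hN
  · simp
  have h1 := eLpNorm_norm_rpow (p := 1) (μ := P) Z (q := N) (by exact_mod_cast hN)
  rw [one_mul, ENNReal.ofReal_natCast] at h1
  simp only [Real.rpow_natCast, ENNReal.rpow_natCast] at h1
  have h2 : ‖∫ ω, ‖Z ω‖ ^ N ∂P‖ₑ ≤ M ^ N := by
    refine (enorm_integral_le_lintegral_enorm _).trans ?_
    rw [← eLpNorm_one_eq_lintegral_enorm, h1]
    gcongr
  have h3 : ‖∫ ω, ‖Z ω‖ ^ N ∂P‖ ≤ (M ^ N : ℝ≥0) := by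
    rw [← ENNReal.coe_pow] at h2
    exact_mod_cast (enorm_le_coe.1 h2)
  exact (Real.le_norm_self _).trans (by simpa using h3)

/-- Time averages of a process have the moments of the process. -/
lemma eLpNorm_integral_norm_le {Y : ℝ≥0 → Ω → H} (hY : ∀ s, AEStronglyMeasurable (Y s) P)
    (hc : ∀ᵐ ω ∂P, Continuous fun s => Y s ω) {p : ENNReal} (hp : 1 ≤ p) {M : ℝ≥0}
    (hM : ∀ s, eLpNorm (Y s) p P ≤ M) (t : ℝ≥0) :
    AEStronglyMeasurable (fun ω => ∫ s in (0 : ℝ)..t, ‖Y s.toNNReal ω‖) P ∧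
      eLpNorm (fun ω => ∫ s in (0 : ℝ)..t, ‖Y s.toNNReal ω‖) p P ≤ (t * M : ℝ≥0) := by
  set S : ℕ → Ω → ℝ := fun n => ∑ j ∈ Finset.range n,
    fun ω => (t / n : ℝ) * ‖Y (j * (t / n)) ω‖ with hS
  have hcast : ∀ n j : ℕ, ((j : ℝ) * (t / n)).toNNReal = j * (t / n) := fun n j => by
    rw [← NNReal.coe_natCast j, ← NNReal.coe_natCast n, ← NNReal.coe_div, ← NNReal.coe_mul,
      Real.toNNReal_coe]
  have hSm : ∀ n, AEStronglyMeasurable (S n) P := fun n =>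
    Finset.aestronglyMeasurable_sum _ fun j _ => ((hY _).norm.const_mul _)
  have hlim : ∀ᵐ ω ∂P, Tendsto (fun n => S n ω) atTop
      (𝓝 (∫ s in (0 : ℝ)..t, ‖Y s.toNNReal ω‖)) := by
    filter_upwards [hc] with ω hω
    have hF : Continuous (Function.uncurry fun _ u : ℝ => ‖Y u.toNNReal ω‖) :=
      (hω.comp (continuous_real_toNNReal.comp continuous_snd)).norm
    refine (tendsto_sum_integral_frozen hF t.coe_nonneg (τ := fun n j => j * (t / n))
      (fun n j _ => ⟨le_rfl, by gcongr; linarith⟩)).congr fun n => ?_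
    simp only [hS, Finset.sum_apply]
    refine Finset.sum_congr rfl fun j _ => ?_
    rw [intervalIntegral.integral_const, smul_eq_mul, hcast]
    ring
  -- Fatou along Riemann sums: continuity of the paths replaces joint measurability in time and
  -- chance.
  refine ⟨aestronglyMeasurable_of_tendsto_ae _ hSm hlim,
    (Lp.eLpNorm_lim_le_liminf_eLpNorm hSm _ hlim).trans ?_⟩
  refine liminf_le_of_le (by isBoundedDefault) fun b hb => ?_
  obtain ⟨n, hn, hn0⟩ := (hb.and (eventually_gt_atTop 0)).exists
  refine hn.trans ?_
  refine (eLpNorm_sum_le (fun j _ => ((hY _).norm.const_mul _)) hp).trans ?_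
  calc _ ≤ ∑ j ∈ Finset.range n, ((t / n * M : ℝ≥0) : ENNReal) := by
        refine Finset.sum_le_sum fun j _ => ?_
        refine (eLpNorm_le_mul_eLpNorm_of_ae_le_mul' (c := t / n) (g := Y (j * (t / n)))
          (ae_of_all _ fun ω => ?_) p).trans ?_
        · rw [enorm_mul, enorm_norm]
          gcongr
          rw [← NNReal.coe_natCast, ← NNReal.coe_div, NNReal.enorm_eq]
        · rw [ENNReal.coe_mul]
          gcongr
          exact hM _
    _ ≤ _ := by
        rw [Finset.sum_const, Finset.card_range, nsmul_eq_mul]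
        rw [← ENNReal.coe_natCast, ← ENNReal.coe_mul, ENNReal.coe_le_coe]
        have : (n : ℝ≥0) ≠ 0 := by positivity
        refine le_of_eq ?_
        field_simp

/-- A sequence that tends to zero almost everywhere and is bounded in `L²` tends to zero in
mean. -/
lemma tendsto_integral_zero_of_sq_bounded {ι : Type*} {l : Filter ι} [l.IsCountablyGenerated]
    {G : ι → Ω → ℝ} {M : ℝ} (hm : ∀ᶠ i in l, AEStronglyMeasurable (G i) P)
    (hi : ∀ᶠ i in l, Integrable (fun ω => G i ω ^ 2) P) (hM : ∀ᶠ i in l, ∫ ω, G i ω ^ 2 ∂P ≤ M)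
    (hG : ∀ᵐ ω ∂P, Tendsto (fun i => G i ω) l (𝓝 0)) :
    Tendsto (fun i => ∫ ω, G i ω ∂P) l (𝓝 0) := by
  rw [Metric.tendsto_nhds]
  intro ε hε
  -- Truncation level: |G| ≤ min(|G|, R) + G²/R, and the last term has mean below ε/2.
  set R : ℝ := 2 * (|M| + 1) / ε with hR
  have hR0 : 0 < R := by positivity
  have h1 : Tendsto (fun i => ∫ ω, min |G i ω| R ∂P) l (𝓝 (∫ _, 0 ∂P)) := by
    refine tendsto_integral_filter_of_dominated_convergence (fun _ => R) ?_ ?_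
      (integrable_const _) ?_
    · filter_upwards [hm] with i hi
      exact (continuous_abs.min continuous_const).comp_aestronglyMeasurable hi
    · refine Eventually.of_forall fun i => ae_of_all _ fun ω => ?_
      rw [Real.norm_of_nonneg (le_min (abs_nonneg _) hR0.le)]
      exact min_le_right _ _
    · filter_upwards [hG] with ω hω
      have : Continuous fun x : ℝ => min |x| R := continuous_abs.min continuous_const
      have := (this.tendsto 0).comp hω
      simpa [Function.comp_def, hR0.le] using this
  rw [integral_zero, Metric.tendsto_nhds] at h1
  filter_upwards [h1 (ε / 2) (by positivity), hm, hi, hM] with i h1 hm hi hM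
  have hmi : AEStronglyMeasurable (fun ω => min |G i ω| R) P :=
    (continuous_abs.min continuous_const).comp_aestronglyMeasurable hm
  have hint : Integrable (fun ω => min |G i ω| R) P := by
    refine (integrable_const R).mono' hmi (ae_of_all _ fun ω => ?_)
    rw [Real.norm_of_nonneg (le_min (abs_nonneg _) hR0.le)]
    exact min_le_right _ _
  have hle : ∀ x : ℝ, |x| ≤ min |x| R + R⁻¹ * x ^ 2 := by
    intro x
    rcases le_total |x| R with h | h
    · rw [min_eq_left h]
      have : 0 ≤ R⁻¹ * x ^ 2 := by positivity
      linarith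
    · rw [min_eq_right h]
      have : |x| ≤ R⁻¹ * x ^ 2 := by
        rw [← sq_abs, inv_mul_eq_div, le_div_iff₀ hR0, sq]
        gcongr
      linarith
  rw [Real.dist_eq, sub_zero] at h1 ⊢
  calc |∫ ω, G i ω ∂P| ≤ ∫ ω, |G i ω| ∂P := abs_integral_le_integral_abs
    _ ≤ ∫ ω, (min |G i ω| R + R⁻¹ * G i ω ^ 2) ∂P := by
        refine integral_mono_of_nonneg (ae_of_all _ fun _ => abs_nonneg _)
          (hint.add (hi.const_mul _)) (ae_of_all _ fun ω => hle _)
    _ = (∫ ω, min |G i ω| R ∂P) + R⁻¹ * ∫ ω, G i ω ^ 2 ∂P := by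
        rw [integral_add hint (hi.const_mul _), integral_const_mul]
    _ < ε / 2 + ε / 2 := by
        refine add_lt_add ((le_abs_self _).trans_lt h1) ?_
        rw [inv_mul_eq_div, div_lt_iff₀ hR0, hR]
        have : ε / 2 * (2 * (|M| + 1) / ε) = |M| + 1 := by field_simp
        rw [this]
        linarith [le_abs_self M]
    _ = ε := by ring

end Moments

/-! ### Moments of Gaussian laws with bounded parameters. -/

section GaussianMoments

variable {H : Type} [NormedAddCommGroup H] [InnerProductSpace ℝ H]
  [MeasurableSpace H] [BorelSpace H] [FiniteDimensional ℝ H]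

lemma integrable_two_add_norm_pow_stdGaussian (N : ℕ) :
    Integrable (fun z => (2 + ‖z‖) ^ N) (stdGaussian H) := by
  have h := ((memLp_const (2 : ℝ)).add (IsGaussian.memLp_id (stdGaussian H) N (by simp)).norm).integrable_norm_pow'
  refine h.congr (ae_of_all _ fun z => ?_)
  simp only [Pi.add_apply, id_eq]
  rw [Real.norm_of_nonneg (by positivity)]

lemma exists_eLpNorm_gaussianOf_le {p : ENNReal} (hp1 : 1 ≤ p) (hp : p ≠ ⊤) (R : ℝ≥0) :
    ∃ M : ℝ≥0, ∀ a : H × (H →L[ℝ] H), ‖a‖ ≤ R → eLpNorm id p (gaussianOf a) ≤ M := by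
  obtain ⟨M, hM⟩ : ∃ M : ℝ≥0, eLpNorm id p (stdGaussian H) = M :=
    ⟨_, (ENNReal.coe_toNNReal (IsGaussian.memLp_id (stdGaussian H) p hp).2.ne).symm⟩
  refine ⟨R + R * M, fun a ha => ?_⟩
  have h1 : ‖a.1‖ ≤ R := (norm_fst_le a).trans ha
  have h2 : ‖a.2‖ ≤ R := (norm_snd_le a).trans ha
  rw [gaussianOf, eLpNorm_map_measure aestronglyMeasurable_id (measurable_affine a).aemeasurable,
    Function.id_comp]
  have := eLpNorm_add_le (p := p) (μ := stdGaussian H) (f := fun _ : H => a.1) (g := fun z => a.2 z)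
    aestronglyMeasurable_const a.2.continuous.aestronglyMeasurable hp1
  refine this.trans ?_
  rw [ENNReal.coe_add, ENNReal.coe_mul]
  refine add_le_add ?_ ?_
  · rw [eLpNorm_const _ (by positivity) (NeZero.ne _), measure_univ, ENNReal.one_rpow, mul_one]
    exact enorm_le_coe.2 h1
  · rw [← hM]
    refine eLpNorm_le_mul_eLpNorm_of_ae_le_mul' (ae_of_all _ fun z => ?_) p
    rw [← ofReal_norm, ← ofReal_norm, ENNReal.coe_nnreal_eq, ← ENNReal.ofReal_mul R.coe_nonneg]
    exact ENNReal.ofReal_le_ofReal ((a.2.le_opNorm z).trans (by gcongr; rfl))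

lemma IsStable.norm_covRoot_le {K ρ σ : ℝ} {A : H →L[ℝ] H} (hA : IsStable K ρ A) {t : ℝ}
    (ht : 0 < t) : ‖covRoot K σ A t‖ ≤ ‖statRoot K σ A‖ := by
  refine ContinuousLinearMap.opNorm_le_bound _ (norm_nonneg _) fun ξ => ?_
  refine le_trans ?_ ((statRoot K σ A).le_opNorm ξ)
  have := hA.norm_covRoot_sq (σ := σ) ht ξ
  refine le_of_sq_le_sq ?_ (norm_nonneg _)
  nlinarith [sq_nonneg ‖statRoot K σ A (flow A t ξ)‖]

lemma IsStable.norm_ouMean_le {K ρ : ℝ} {A : H →L[ℝ] H} (hA : IsStable K ρ A) (a x : H) {t : ℝ}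
    (ht : 0 ≤ t) : ‖ouMean K A a x t‖ ≤ ‖invOp K A a‖ + ‖x - invOp K A a‖ :=
  (norm_add_le _ _).trans (add_le_add le_rfl (((flow A t).le_opNorm _).trans
    (mul_le_of_le_one_left (norm_nonneg _) (hA.norm_flow_le_one ht))))

end GaussianMoments

/-! ### Stability of paths, and their linearisation. -/

section PathBounds

variable {H : Type} [NormedAddCommGroup H] [InnerProductSpace ℝ H] [CompleteSpace H]

lemma norm_affine_path_le {K ρ : ℝ} {A B : H →L[ℝ] H} {α u₀ : H} {u y : ℝ → H}
    (hA : IsStable K ρ A) (hu : Continuous u) (hy : Continuous y)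
    (e : ∀ τ, 0 ≤ τ → u τ = u₀ + ∫ s in (0 : ℝ)..τ, (α - B (y s) - A (u s))) {t : ℝ}
    (ht : 0 ≤ t) : ‖u t‖ ≤ ‖u₀‖ + (t * ‖α‖ + ‖B‖ * ∫ s in (0 : ℝ)..t, ‖y s‖) := by
  refine (norm_le_of_variation_of_constants hA (b := fun s => α - B (y s)) hu (by fun_prop) e
    ht).trans (add_le_add le_rfl ?_)
  have h2 : ∫ s in (0 : ℝ)..t, (‖α‖ + ‖B‖ * ‖y s‖) =
      t * ‖α‖ + ‖B‖ * ∫ s in (0 : ℝ)..t, ‖y s‖ := by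
    rw [intervalIntegral.integral_add (Continuous.intervalIntegrable (by fun_prop) _ _)
      (Continuous.intervalIntegrable (by fun_prop) _ _), intervalIntegral.integral_const_mul]
    simp
  rw [← h2]
  refine intervalIntegral.integral_mono_on ht (Continuous.intervalIntegrable (by fun_prop) _ _)
    (Continuous.intervalIntegrable (by fun_prop) _ _) fun s _ => ?_
  exact (norm_sub_le _ _).trans (add_le_add le_rfl (B.le_opNorm _))

/-- Paths of two equations with the same noise stay close. -/
lemma norm_sub_path_le {K ρ σ : ℝ} {A A' : H →L[ℝ] H} {a a' x₀ x₀' : H} {x x' w : ℝ → H}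
    (hA' : IsStable K ρ A') (hx : Continuous x) (hx' : Continuous x')
    (e : ∀ τ, 0 ≤ τ → x τ = x₀ + (∫ s in (0 : ℝ)..τ, (a - A (x s))) + σ • w τ)
    (e' : ∀ τ, 0 ≤ τ → x' τ = x₀' + (∫ s in (0 : ℝ)..τ, (a' - A' (x' s))) + σ • w τ)
    {t : ℝ} (ht : 0 ≤ t) :
    ‖x' t - x t‖ ≤ ‖x₀' - x₀‖ + (t * ‖a' - a‖ + ‖A' - A‖ * ∫ s in (0 : ℝ)..t, ‖x s‖) := by
  refine norm_affine_path_le hA' (u := fun τ => x' τ - x τ) (y := x) (by fun_prop) hx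
    (fun τ hτ => ?_) ht
  have h1 : ∀ s, (a' - a) - (A' - A) (x s) - A' (x' s - x s) =
      (a' - A' (x' s)) - (a - A (x s)) := fun s => by
    rw [map_sub, ContinuousLinearMap.sub_apply]; abel
  simp_rw [h1]
  rw [e τ hτ, e' τ hτ, intervalIntegral.integral_sub (f := fun s => a' - A' (x' s))
    (g := fun s => a - A (x s)) (Continuous.intervalIntegrable (by fun_prop) _ _)
    (Continuous.intervalIntegrable (by fun_prop) _ _)]
  generalize ∫ s in (0 : ℝ)..τ, (a' - A' (x' s)) = I₁
  generalize ∫ s in (0 : ℝ)..τ, (a - A (x s)) = I₂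
  abel

/-- Difference quotients of paths are close to the solution of the linearised equation. -/
lemma norm_quotient_sub_path_le {K ρ σ c : ℝ} {A A' B : H →L[ℝ] H} {a a' α x₀ x₀' u₀ : H}
    {x x' u w : ℝ → H} (hA' : IsStable K ρ A') (hx : Continuous x) (hx' : Continuous x')
    (hu : Continuous u)
    (e : ∀ τ, 0 ≤ τ → x τ = x₀ + (∫ s in (0 : ℝ)..τ, (a - A (x s))) + σ • w τ)
    (e' : ∀ τ, 0 ≤ τ → x' τ = x₀' + (∫ s in (0 : ℝ)..τ, (a' - A' (x' s))) + σ • w τ)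
    (eu : ∀ τ, 0 ≤ τ → u τ = u₀ + ∫ s in (0 : ℝ)..τ, (α - B (x s) - A (u s)))
    (h0 : c • (x₀' - x₀) = u₀) {t : ℝ} (ht : 0 ≤ t) :
    ‖c • (x' t - x t) - u t‖ ≤ t * ‖c • (a' - a) - α‖ +
      (‖c • (A' - A) - B‖ * (∫ s in (0 : ℝ)..t, ‖x s‖) +
        ‖A' - A‖ * ∫ s in (0 : ℝ)..t, ‖u s‖) := by
  have key := norm_le_of_variation_of_constants hA' (y := fun τ => c • (x' τ - x τ) - u τ)
    (b := fun s => (c • (a' - a) - α) - ((c • (A' - A) - B) (x s) + (A' - A) (u s))) (y₀ := 0)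
    (by fun_prop) (by fun_prop)
    (fun τ hτ => by
      rw [e τ hτ, e' τ hτ, eu τ hτ, ← h0]
      have h1 : ∀ s, (c • (a' - a) - α) - ((c • (A' - A) - B) (x s) + (A' - A) (u s)) -
          A' (c • (x' s - x s) - u s) =
          c • ((a' - A' (x' s)) - (a - A (x s))) - (α - B (x s) - A (u s)) := fun s => by
        simp only [map_sub, ContinuousLinearMap.sub_apply, ContinuousLinearMap.smul_apply,
          map_smul, smul_sub]
        abel
      simp_rw [h1]
      rw [intervalIntegral.integral_sub (f := fun s => c • ((a' - A' (x' s)) - (a - A (x s))))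
        (g := fun s => α - B (x s) - A (u s)) (Continuous.intervalIntegrable (by fun_prop) _ _)
        (Continuous.intervalIntegrable (by fun_prop) _ _), intervalIntegral.integral_smul,
        intervalIntegral.integral_sub (f := fun s => a' - A' (x' s)) (g := fun s => a - A (x s))
        (Continuous.intervalIntegrable (by fun_prop) _ _)
        (Continuous.intervalIntegrable (by fun_prop) _ _)]
      generalize ∫ s in (0 : ℝ)..τ, (a' - A' (x' s)) = I₁
      generalize ∫ s in (0 : ℝ)..τ, (a - A (x s)) = I₂
      generalize ∫ s in (0 : ℝ)..τ, (α - B (x s) - A (u s)) = I₃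
      simp only [smul_sub, smul_add]
      abel) ht
  rw [norm_zero, zero_add] at key
  refine key.trans ?_
  have h2 : ∫ s in (0 : ℝ)..t, (‖c • (a' - a) - α‖ +
      (‖c • (A' - A) - B‖ * ‖x s‖ + ‖A' - A‖ * ‖u s‖)) =
      t * ‖c • (a' - a) - α‖ +
      (‖c • (A' - A) - B‖ * (∫ s in (0 : ℝ)..t, ‖x s‖) +
        ‖A' - A‖ * ∫ s in (0 : ℝ)..t, ‖u s‖) := by
    rw [intervalIntegral.integral_add (Continuous.intervalIntegrable (by fun_prop) _ _)
      (Continuous.intervalIntegrable (by fun_prop) _ _), intervalIntegral.integral_add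
      (Continuous.intervalIntegrable (by fun_prop) _ _)
      (Continuous.intervalIntegrable (by fun_prop) _ _), intervalIntegral.integral_const_mul,
      intervalIntegral.integral_const_mul]
    simp
  rw [← h2]
  refine intervalIntegral.integral_mono_on ht (Continuous.intervalIntegrable (by fun_prop) _ _)
    (Continuous.intervalIntegrable (by fun_prop) _ _) fun s _ => ?_
  refine (norm_sub_le _ _).trans (add_le_add le_rfl ((norm_add_le _ _).trans ?_))
  exact add_le_add (ContinuousLinearMap.le_opNorm _ _) (ContinuousLinearMap.le_opNorm _ _)

end PathBounds

/-! ### The parametrised system in coordinate-free form, and its moments. -/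

section System

variable {Ω : Type*} [MeasurableSpace Ω] {P : Measure Ω} [IsProbabilityMeasure P]
  {H Θ : Type} [NormedAddCommGroup H] [InnerProductSpace ℝ H] [FiniteDimensional ℝ H]
  [MeasurableSpace H] [BorelSpace H] [NormedAddCommGroup Θ] [NormedSpace ℝ Θ]
  [FiniteDimensional ℝ Θ]

/-- A parametrised Ornstein-Uhlenbeck process together with its derivative process. -/
structure OUSystem (P : Measure Ω) (W : ℝ≥0 → Ω → H) (g : Θ → H) (h : Θ → H →L[ℝ] H)
    (σ K ρ L : ℝ) (X : Θ → H → ℝ≥0 → Ω → H)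
    (X' : Θ → H → (Θ →L[ℝ] H) → ℝ≥0 → Ω → (Θ →L[ℝ] H)) : Prop where
  noise : IsNoise P W
  stable : ∀ θ, IsStable K ρ (h θ)
  polyBdd_g : PolyBdd 1 g L 0
  polyBdd_h : PolyBdd 1 h L 0
  measurable : ∀ θ x t, Measurable (X θ x t)
  path : ∀ θ x, ∀ᵐ ω ∂P, Continuous (fun t => X θ x t ω) ∧ ∀ t : ℝ≥0,
    X θ x t ω = x + (∫ s in (0 : ℝ)..t, (g θ - h θ (X θ x s.toNNReal ω))) + σ • W t ω
  measurable_tangent : ∀ θ x x' t, Measurable (X' θ x x' t)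
  path_tangent : ∀ θ x x', ∀ᵐ ω ∂P, Continuous (fun t => X' θ x x' t ω) ∧ ∀ t : ℝ≥0,
    X' θ x x' t ω = x' + ∫ s in (0 : ℝ)..t, (fderiv ℝ g θ -
      (fderiv ℝ h θ).flip (X θ x s.toNNReal ω) - (h θ).comp (X' θ x x' s.toNNReal ω))

namespace OUSystem

variable {W : ℝ≥0 → Ω → H} {g : Θ → H} {h : Θ → H →L[ℝ] H} {σ K ρ L : ℝ}
  {X : Θ → H → ℝ≥0 → Ω → H} {X' : Θ → H → (Θ →L[ℝ] H) → ℝ≥0 → Ω → (Θ →L[ℝ] H)}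

lemma nonneg (hS : OUSystem P W g h σ K ρ L X X') : 0 ≤ L := hS.polyBdd_g.nonneg

lemma path_real (hS : OUSystem P W g h σ K ρ L X X') (θ : Θ) (x : H) :
    ∀ᵐ ω ∂P, Continuous (fun s : ℝ => X θ x s.toNNReal ω) ∧ ∀ τ : ℝ, 0 ≤ τ →
      X θ x τ.toNNReal ω = x + (∫ s in (0 : ℝ)..τ, (g θ - h θ (X θ x s.toNNReal ω))) +
        σ • W τ.toNNReal ω := by
  filter_upwards [hS.path θ x] with ω hω
  refine ⟨hω.1.comp continuous_real_toNNReal, fun τ hτ => ?_⟩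
  have := hω.2 τ.toNNReal
  rwa [Real.coe_toNNReal τ hτ] at this

lemma path_tangent_real (hS : OUSystem P W g h σ K ρ L X X') (θ : Θ) (x : H) (x' : Θ →L[ℝ] H) :
    ∀ᵐ ω ∂P, Continuous (fun s : ℝ => X' θ x x' s.toNNReal ω) ∧ ∀ τ : ℝ, 0 ≤ τ → ∀ η,
      X' θ x x' τ.toNNReal ω η = x' η + ∫ s in (0 : ℝ)..τ, (fderiv ℝ g θ η -
        fderiv ℝ h θ η (X θ x s.toNNReal ω) - h θ (X' θ x x' s.toNNReal ω η)) := by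
  filter_upwards [hS.path_real θ x, hS.path_tangent θ x x'] with ω hω hω'
  have hc : Continuous fun s : ℝ => X' θ x x' s.toNNReal ω := hω'.1.comp continuous_real_toNNReal
  refine ⟨hc, fun τ hτ η => ?_⟩
  have h1 := hω'.2 τ.toNNReal
  rw [Real.coe_toNNReal τ hτ] at h1
  have hint : IntervalIntegrable (fun s : ℝ => fderiv ℝ g θ -
      (fderiv ℝ h θ).flip (X θ x s.toNNReal ω) - (h θ).comp (X' θ x x' s.toNNReal ω))
      volume 0 τ := by
    refine Continuous.intervalIntegrable ?_ _ _
    exact (continuous_const.sub ((fderiv ℝ h θ).flip.continuous.comp hω.1)).sub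
      ((ContinuousLinearMap.compL ℝ Θ H H (h θ)).continuous.comp hc)
  have h2 := (ContinuousLinearMap.apply ℝ H η).intervalIntegral_comp_comm hint
  rw [h1, ContinuousLinearMap.add_apply]
  congr 1
  exact h2.symm

lemma eval_zero (hS : OUSystem P W g h σ K ρ L X X') (θ : Θ) (x : H) :
    ∀ᵐ ω ∂P, X θ x 0 ω = x := by
  filter_upwards [hS.path θ x, hS.noise.path] with ω hω hw
  simpa [hw.2] using hω.2 0

lemma tangent_eval_zero (hS : OUSystem P W g h σ K ρ L X X') (θ : Θ) (x : H) (x' : Θ →L[ℝ] H) :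
    ∀ᵐ ω ∂P, X' θ x x' 0 ω = x' := by
  filter_upwards [hS.path_tangent θ x x'] with ω hω
  simpa using hω.2 0

lemma map_eq (hS : OUSystem P W g h σ K ρ L X X') (θ : Θ) (x : H) {t : ℝ≥0} (ht : 0 < t) :
    P.map (X θ x t) = gaussianOf (ouMean K (h θ) (g θ) x t, covRoot K σ (h θ) t) :=
  hS.noise.map_eq_gaussianOf (hS.stable θ) (hS.measurable θ x) (hS.path θ x) ht

/-- The bound is uniform in time because the mean and the covariance root stay bounded: the
semigroup contracts and the covariance never exceeds the stationary one. -/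
lemma exists_eLpNorm_le (hS : OUSystem P W g h σ K ρ L X X') (θ : Θ) (x : H) {p : ENNReal}
    (hp1 : 1 ≤ p) (hp : p ≠ ⊤) : ∃ M : ℝ≥0, ∀ t, eLpNorm (X θ x t) p P ≤ M := by
  have hA := hS.stable θ
  set R : ℝ≥0 := ⟨max (‖invOp K (h θ) (g θ)‖ + ‖x - invOp K (h θ) (g θ)‖) ‖statRoot K σ (h θ)‖,
    le_max_of_le_right (norm_nonneg _)⟩
  obtain ⟨M, hM⟩ := exists_eLpNorm_gaussianOf_le (H := H) hp1 hp R
  -- The extra ‖x‖ covers t = 0, where the Gaussian description is not available.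
  refine ⟨M + ‖x‖₊, fun t => ?_⟩
  rcases eq_or_lt_of_le (zero_le : 0 ≤ t) with rfl | ht
  · rw [eLpNorm_congr_ae (hS.eval_zero θ x), eLpNorm_const _ (by positivity) (NeZero.ne _),
      measure_univ, ENNReal.one_rpow, mul_one]
    exact_mod_cast le_add_self
  · have ht' : (0 : ℝ) < t := NNReal.coe_pos.2 ht
    have h1 := hM (ouMean K (h θ) (g θ) x t, covRoot K σ (h θ) t) ?_
    · rw [← hS.map_eq θ x ht, eLpNorm_map_measure aestronglyMeasurable_id
        (hS.measurable θ x t).aemeasurable, Function.id_comp] at h1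
      exact h1.trans (by exact_mod_cast le_self_add)
    · exact max_le_max (hA.norm_ouMean_le _ _ ht'.le) (hA.norm_covRoot_le ht')

/-- A random variable that controls the paths up to time `t`. -/
def pathMass (x : ℝ≥0 → Ω → H) (t : ℝ≥0) (ω : Ω) : ℝ :=
  1 + ‖x t ω‖ + ∫ s in (0 : ℝ)..t, ‖x s.toNNReal ω‖

lemma integral_norm_nonneg (x : ℝ≥0 → Ω → H) (t : ℝ≥0) (ω : Ω) :
    0 ≤ ∫ s in (0 : ℝ)..t, ‖x s.toNNReal ω‖ :=
  intervalIntegral.integral_nonneg t.coe_nonneg fun _ _ => norm_nonneg _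

lemma one_le_pathMass (x : ℝ≥0 → Ω → H) (t : ℝ≥0) (ω : Ω) : 1 ≤ pathMass x t ω := by
  unfold pathMass
  linarith [integral_norm_nonneg x t ω, norm_nonneg (x t ω)]

lemma memLp_pathMass (hS : OUSystem P W g h σ K ρ L X X') (θ : Θ) (x : H) (t : ℝ≥0) {p : ENNReal}
    (hp1 : 1 ≤ p) (hp : p ≠ ⊤) : MemLp (pathMass (X θ x) t) p P := by
  obtain ⟨M, hM⟩ := hS.exists_eLpNorm_le θ x hp1 hp
  have h1 : MemLp (X θ x t) p P := ⟨(hS.measurable θ x t).aestronglyMeasurable,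
    (hM t).trans_lt ENNReal.coe_lt_top⟩
  have h2 := eLpNorm_integral_norm_le (fun s => (hS.measurable θ x s).aestronglyMeasurable)
    ((hS.path θ x).mono fun _ h => h.1) hp1 hM t
  have h3 : MemLp (fun ω => ∫ s in (0 : ℝ)..t, ‖X θ x s.toNNReal ω‖) p P :=
    ⟨h2.1, h2.2.trans_lt ENNReal.coe_lt_top⟩
  have h4 : MemLp (fun _ : Ω => (1 : ℝ)) p P := memLp_const 1
  have h5 : MemLp (fun ω => ‖X θ x t ω‖) p P := h1.norm
  exact (h4.add h5).add h3

lemma integrable_pathMass_pow (hS : OUSystem P W g h σ K ρ L X X') (θ : Θ) (x : H) (t : ℝ≥0)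
    (N : ℕ) : Integrable (fun ω => pathMass (X θ x) t ω ^ N) P := by
  -- The triangle inequality in L^p needs p ≥ 1, so the case N = 0 is reached from the exponent N +
  -- 1.
  have h1 := (hS.memLp_pathMass θ x t (p := (N + 1 : ℕ)) (by simp) (by simp)).mono_exponent
    (p := (N : ENNReal)) (by norm_cast; omega)
  refine h1.integrable_norm_pow'.congr (ae_of_all _ fun ω => ?_)
  simp only
  rw [Real.norm_of_nonneg (zero_le_one.trans (one_le_pathMass _ _ _))]

lemma integrable_of_norm_le_pathMass (hS : OUSystem P W g h σ K ρ L X X') {θ : Θ} {x : H}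
    {t : ℝ≥0} {F : Type*} [NormedAddCommGroup F] {φ : Ω → F} (hφ : AEStronglyMeasurable φ P) {C : ℝ}
    {N : ℕ} (hb : ∀ᵐ ω ∂P, ‖φ ω‖ ≤ C * pathMass (X θ x) t ω ^ N) : Integrable φ P :=
  ((hS.integrable_pathMass_pow θ x t N).const_mul C).mono' hφ hb

/-- The derivative process is controlled by the path. -/
lemma norm_tangent_le (hS : OUSystem P W g h σ K ρ L X X') (θ : Θ) (x : H) (x' : Θ →L[ℝ] H) :
    ∀ᵐ ω ∂P, ∀ t : ℝ≥0,
      ‖X' θ x x' t ω‖ ≤ ‖x'‖ + L * (t + ∫ s in (0 : ℝ)..t, ‖X θ x s.toNNReal ω‖) := by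
  filter_upwards [hS.path_real θ x, hS.path_tangent_real θ x x'] with ω hω hω' t
  have hL := hS.nonneg
  refine ContinuousLinearMap.opNorm_le_bound _ (by
    have := integral_norm_nonneg (X θ x) t ω
    positivity) fun η => ?_
  have hc := hω.1
  have hc' : Continuous fun s : ℝ => X' θ x x' s.toNNReal ω η := hω'.1.clm_apply continuous_const
  have key := norm_affine_path_le (hS.stable θ) hc' hc (fun τ hτ => hω'.2 τ hτ η) t.coe_nonneg
  rw [Real.toNNReal_coe] at key
  have hg : ‖fderiv ℝ g θ η‖ ≤ L * ‖η‖ := by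
    have := hS.polyBdd_g.norm_fderiv_le le_rfl θ
    rw [pow_zero, mul_one] at this
    exact (ContinuousLinearMap.le_opNorm _ _).trans (by gcongr)
  have hh : ‖fderiv ℝ h θ η‖ ≤ L * ‖η‖ := by
    have := hS.polyBdd_h.norm_fderiv_le le_rfl θ
    rw [pow_zero, mul_one] at this
    exact (ContinuousLinearMap.le_opNorm _ _).trans (by gcongr)
  have hI := integral_norm_nonneg (X θ x) t ω
  calc _ ≤ _ := key
    _ ≤ ‖x'‖ * ‖η‖ + (t * (L * ‖η‖) + L * ‖η‖ * ∫ s in (0 : ℝ)..t, ‖X θ x s.toNNReal ω‖) := by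
        gcongr
        exact x'.le_opNorm η
    _ = _ := by ring

end OUSystem

end System

/-! ### The derivative process as derivative in parameter and initial value. -/

section DerivativeOfMean

variable {Ω : Type*} [MeasurableSpace Ω] {P : Measure Ω} [IsProbabilityMeasure P]
  {H Θ : Type} [NormedAddCommGroup H] [InnerProductSpace ℝ H] [FiniteDimensional ℝ H]
  [MeasurableSpace H] [BorelSpace H] [NormedAddCommGroup Θ] [NormedSpace ℝ Θ]
  [FiniteDimensional ℝ Θ]

namespace OUSystem

variable {W : ℝ≥0 → Ω → H} {g : Θ → H} {h : Θ → H →L[ℝ] H} {σ K ρ L : ℝ}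
  {X : Θ → H → ℝ≥0 → Ω → H} {X' : Θ → H → (Θ →L[ℝ] H) → ℝ≥0 → Ω → (Θ →L[ℝ] H)}

lemma norm_eval_le_pathMass (x : ℝ≥0 → Ω → H) (t : ℝ≥0) (ω : Ω) : ‖x t ω‖ ≤ pathMass x t ω := by
  unfold pathMass
  linarith [integral_norm_nonneg x t ω]

lemma integral_le_pathMass (x : ℝ≥0 → Ω → H) (t : ℝ≥0) (ω : Ω) :
    ∫ s in (0 : ℝ)..t, ‖x s.toNNReal ω‖ ≤ pathMass x t ω := by
  unfold pathMass
  linarith [norm_nonneg (x t ω)]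

/-- Perturbing the parameter and the initial value by `c⁻¹` moves the path by `O(c⁻¹)`. -/
lemma norm_perturbed_sub_le (hS : OUSystem P W g h σ K ρ L X X') (θ η : Θ) (x : H)
    (x' : Θ →L[ℝ] H) (t : ℝ≥0) {c : ℝ} (hc : 0 < c) :
    ∀ᵐ ω ∂P, c * ‖X (θ + c⁻¹ • η) (x + c⁻¹ • x' η) t ω - X θ x t ω‖ ≤
      (‖x' η‖ + (t + 1) * (L * ‖η‖)) * pathMass (X θ x) t ω := by
  filter_upwards [hS.path_real θ x, hS.path_real (θ + c⁻¹ • η) (x + c⁻¹ • x' η)] with ω h1 h2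
  have key := norm_sub_path_le (hS.stable _) h1.1 h2.1 h1.2 h2.2 t.coe_nonneg
  simp only [Real.toNNReal_coe] at key
  have hL := hS.nonneg
  have hg := hS.polyBdd_g.norm_sub_le le_rfl (θ + c⁻¹ • η) θ
  have hh := hS.polyBdd_h.norm_sub_le le_rfl (θ + c⁻¹ • η) θ
  rw [add_sub_cancel_left, pow_zero, mul_one, norm_smul, norm_inv, Real.norm_of_nonneg hc.le]
    at hg hh
  rw [add_sub_cancel_left, norm_smul, norm_inv, Real.norm_of_nonneg hc.le] at key
  have hI := integral_norm_nonneg (X θ x) t ω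
  have hJ := one_le_pathMass (X θ x) t ω
  have hIJ := integral_le_pathMass (X θ x) t ω
  set I := ∫ s in (0 : ℝ)..t, ‖X θ x s.toNNReal ω‖
  set J := pathMass (X θ x) t ω
  have ht := t.coe_nonneg
  calc _ ≤ c * (c⁻¹ * ‖x' η‖ + (t * (L * (c⁻¹ * ‖η‖)) + L * (c⁻¹ * ‖η‖) * I)) := by
        gcongr
        exact key.trans (by gcongr)
    _ = ‖x' η‖ * 1 + (t * (L * ‖η‖) * 1 + L * ‖η‖ * I) := by field_simp
    _ ≤ ‖x' η‖ * J + (t * (L * ‖η‖) * J + L * ‖η‖ * J) := by gcongr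
    _ = _ := by ring

/-- The derivative process is the derivative of the path with respect to the parameter and the
initial value. -/
lemma tendsto_quotient_path (hS : OUSystem P W g h σ K ρ L X X') (θ η : Θ) (x : H)
    (x' : Θ →L[ℝ] H) (t : ℝ≥0) {c : ℕ → ℝ} (hc : Tendsto c atTop atTop) :
    ∀ᵐ ω ∂P, Tendsto (fun n => c n • (X (θ + (c n)⁻¹ • η) (x + (c n)⁻¹ • x' η) t ω - X θ x t ω))
      atTop (𝓝 (X' θ x x' t ω η)) := by
  have hall : ∀ᵐ ω ∂P, ∀ n, Continuous (fun s : ℝ =>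
      X (θ + (c n)⁻¹ • η) (x + (c n)⁻¹ • x' η) s.toNNReal ω) ∧ ∀ τ : ℝ, 0 ≤ τ →
      X (θ + (c n)⁻¹ • η) (x + (c n)⁻¹ • x' η) τ.toNNReal ω = x + (c n)⁻¹ • x' η +
        (∫ s in (0 : ℝ)..τ, (g (θ + (c n)⁻¹ • η) - h (θ + (c n)⁻¹ • η)
          (X (θ + (c n)⁻¹ • η) (x + (c n)⁻¹ • x' η) s.toNNReal ω))) + σ • W τ.toNNReal ω :=
    ae_all_iff.2 fun n => hS.path_real _ _
  have hg := ((hS.polyBdd_g.hasFDerivAt le_rfl θ).lim_real η).comp hc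
  have hh := ((hS.polyBdd_h.hasFDerivAt le_rfl θ).lim_real η).comp hc
  have hh0 : Tendsto (fun n => h (θ + (c n)⁻¹ • η) - h θ) atTop (𝓝 0) := by
    have h1 : Tendsto (fun n => θ + (c n)⁻¹ • η) atTop (𝓝 (θ + (0 : ℝ) • η)) :=
      tendsto_const_nhds.add ((tendsto_inv_atTop_zero.comp hc).smul_const η)
    rw [zero_smul, add_zero] at h1
    have h2 := (hS.polyBdd_h.continuous.tendsto θ).comp h1
    simpa using h2.sub_const (h θ)
  filter_upwards [hall, hS.path_real θ x, hS.path_tangent_real θ x x'] with ω hall h1 h3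
  rw [tendsto_iff_norm_sub_tendsto_zero]
  have hb : Tendsto (fun n => t * ‖c n • (g (θ + (c n)⁻¹ • η) - g θ) - fderiv ℝ g θ η‖ +
      (‖c n • (h (θ + (c n)⁻¹ • η) - h θ) - fderiv ℝ h θ η‖ *
        (∫ s in (0 : ℝ)..t, ‖X θ x s.toNNReal ω‖) +
        ‖h (θ + (c n)⁻¹ • η) - h θ‖ * ∫ s in (0 : ℝ)..t, ‖X' θ x x' s.toNNReal ω η‖)) atTop
      (𝓝 (t * 0 + (0 * (∫ s in (0 : ℝ)..t, ‖X θ x s.toNNReal ω‖) +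
        0 * ∫ s in (0 : ℝ)..t, ‖X' θ x x' s.toNNReal ω η‖))) := by
    have e1 := tendsto_iff_norm_sub_tendsto_zero.1 hg
    have e2 := tendsto_iff_norm_sub_tendsto_zero.1 hh
    have e3 := hh0.norm
    rw [norm_zero] at e3
    exact (e1.const_mul _).add ((e2.mul_const _).add (e3.mul_const _))
  rw [mul_zero, zero_mul, zero_mul, add_zero, add_zero] at hb
  refine squeeze_zero' (Eventually.of_forall fun _ => norm_nonneg _) ?_ hb
  filter_upwards [hc.eventually_gt_atTop 0] with n hn
  have key := norm_quotient_sub_path_le (c := c n) (hS.stable (θ + (c n)⁻¹ • η)) h1.1 (hall n).1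
    (h3.1.clm_apply continuous_const) h1.2 (hall n).2 (fun τ hτ => h3.2 τ hτ η) (by
      rw [add_sub_cancel_left, smul_smul, mul_inv_cancel₀ hn.ne', one_smul]) t.coe_nonneg
  simpa only [Real.toNNReal_coe] using key

lemma integrable_comp (hS : OUSystem P W g h σ K ρ L X X') {F : Type*} [NormedAddCommGroup F]
    [NormedSpace ℝ F] {k : H × Θ → F} {C : ℝ} {n N : ℕ} (hk : PolyBdd n k C N) (θ : Θ) (x : H)
    (t : ℝ≥0) : Integrable (fun ω => k (X θ x t ω, θ)) P := by
  have hC := hk.nonneg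
  refine hS.integrable_of_norm_le_pathMass (θ := θ) (x := x) (t := t)
    (hk.continuous.comp_aestronglyMeasurable
      ((hS.measurable θ x t).aestronglyMeasurable.prodMk aestronglyMeasurable_const))
    (C := C * (2 + ‖θ‖) ^ N) (N := N) (ae_of_all _ fun ω => (hk.norm_le _).trans ?_)
  rw [mul_assoc, ← mul_pow]
  gcongr
  have h1 := norm_eval_le_pathMass (X θ x) t ω
  have h2 := one_le_pathMass (X θ x) t ω
  have h3 : ‖(X θ x t ω, θ)‖ ≤ ‖X θ x t ω‖ + ‖θ‖ :=
    max_le (le_add_of_nonneg_right (norm_nonneg _)) (le_add_of_nonneg_left (norm_nonneg _))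
  nlinarith [norm_nonneg θ]

/-- Differentiation under the expectation. -/
theorem integral_fderiv_tangent (hS : OUSystem P W g h σ K ρ L X X') {k : H × Θ → ℝ} {C : ℝ}
    {N : ℕ} (hk : PolyBdd 1 k C N) {θ : Θ} {x : H} {t : ℝ≥0} {κ' : H × Θ →L[ℝ] ℝ}
    (hκ : HasFDerivAt (fun q : H × Θ => ∫ ω, k (X q.2 q.1 t ω, q.2) ∂P) κ' (x, θ))
    (x' : Θ →L[ℝ] H) (η : Θ) :
    Integrable (fun ω => fderiv ℝ k (X θ x t ω, θ) (X' θ x x' t ω η, η)) P ∧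
      ∫ ω, fderiv ℝ k (X θ x t ω, θ) (X' θ x x' t ω η, η) ∂P = κ' (x' η, η) := by
  set c : ℕ → ℝ := fun n => n + 1 with hcdef
  have hc0 : ∀ n, 1 ≤ c n := fun n => by simp [hcdef]
  have hc : Tendsto c atTop atTop := tendsto_natCast_atTop_atTop.atTop_add tendsto_const_nhds
  set Y : ℕ → Ω → H := fun n => X (θ + (c n)⁻¹ • η) (x + (c n)⁻¹ • x' η) t with hY
  set D : ℕ → Ω → ℝ := fun n ω =>
    c n • (k (Y n ω, θ + (c n)⁻¹ • η) - k (X θ x t ω, θ)) with hD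
  have hC := hk.nonneg
  -- Up to the random factor `pathMass`, this bounds c n times the displacement of (X_t, θ),
  -- uniformly in n.
  set B : ℝ := ‖x' η‖ + (t + 1) * (L * ‖η‖) + ‖η‖ with hB
  have hL := hS.nonneg
  have hB0 : 0 ≤ B := by positivity
  have hDm : ∀ n, AEStronglyMeasurable (D n) P := fun n =>
    (((hS.integrable_comp hk _ _ t).sub (hS.integrable_comp hk θ x t)).smul (c n)).1
  have hbound : ∀ᵐ ω ∂P, ∀ n,
      ‖D n ω‖ ≤ C * (3 + 2 * ‖θ‖ + B) ^ N * B * pathMass (X θ x) t ω ^ (N + 1) := by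
    rw [ae_all_iff]
    intro n
    have hn : 0 < c n := zero_lt_one.trans_le (hc0 n)
    filter_upwards [hS.norm_perturbed_sub_le θ η x x' t hn] with ω hω
    have hJ := one_le_pathMass (X θ x) t ω
    have hXJ := norm_eval_le_pathMass (X θ x) t ω
    change c n * ‖Y n ω - X θ x t ω‖ ≤ _ at hω
    set J := pathMass (X θ x) t ω
    have hd : c n * ‖(Y n ω, θ + (c n)⁻¹ • η) - (X θ x t ω, θ)‖ ≤ B * J := by
      rw [Prod.mk_sub_mk, add_sub_cancel_left, Prod.norm_mk, mul_max_of_nonneg _ _ hn.le, norm_smul,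
        norm_inv, Real.norm_of_nonneg hn.le, mul_inv_cancel_left₀ hn.ne']
      refine max_le (hω.trans ?_) ?_
      · gcongr
        rw [hB]
        linarith [norm_nonneg η]
      · have : ‖η‖ ≤ B := by
          rw [hB]
          have : 0 ≤ ‖x' η‖ + (t + 1) * (L * ‖η‖) := by positivity
          linarith
        nlinarith
    set z : H × Θ := (X θ x t ω, θ) with hz
    set y : H × Θ := (Y n ω, θ + (c n)⁻¹ • η) with hy
    have hzn : ‖z‖ ≤ (1 + ‖θ‖) * J := by
      have h3 : ‖z‖ ≤ ‖X θ x t ω‖ + ‖θ‖ :=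
        max_le (le_add_of_nonneg_right (norm_nonneg _)) (le_add_of_nonneg_left (norm_nonneg _))
      nlinarith [norm_nonneg θ]
    have hyz : ‖y - z‖ ≤ B * J := by
      refine le_trans ?_ hd
      exact le_mul_of_one_le_left (norm_nonneg _) (hc0 n)
    have hyn : ‖y‖ ≤ ‖z‖ + B * J := by
      have := norm_add_le z (y - z)
      rw [add_sub_cancel] at this
      linarith
    have hs := hk.norm_sub_le le_rfl y z
    calc ‖D n ω‖ = c n * ‖k y - k z‖ := by
          rw [hD]; simp only; rw [norm_smul, Real.norm_of_nonneg hn.le]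
      _ ≤ c n * (C * (1 + (‖y‖ + ‖z‖)) ^ N * ‖y - z‖) := by gcongr
      _ = C * (1 + (‖y‖ + ‖z‖)) ^ N * (c n * ‖y - z‖) := by ring
      _ ≤ C * ((3 + 2 * ‖θ‖ + B) * J) ^ N * (B * J) := by
          gcongr
          linarith
      _ = _ := by rw [mul_pow]; ring
  have hlim : ∀ᵐ ω ∂P, Tendsto (fun n => D n ω) atTop
      (𝓝 (fderiv ℝ k (X θ x t ω, θ) (X' θ x x' t ω η, η))) := by
    filter_upwards [hS.tendsto_quotient_path θ η x x' t hc] with ω hω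
    have hci : Tendsto (fun n => (c n)⁻¹) atTop (𝓝 0) := tendsto_inv_atTop_zero.comp hc
    have hcd : Tendsto (fun n => c n • ((Y n ω - X θ x t ω, (c n)⁻¹ • η) : H × Θ)) atTop
        (𝓝 (X' θ x x' t ω η, η)) := by
      have h2 : Tendsto (fun n => c n • (c n)⁻¹ • η) atTop (𝓝 η) := by
        refine tendsto_const_nhds.congr fun n => ?_
        rw [smul_smul, mul_inv_cancel₀ (zero_lt_one.trans_le (hc0 n)).ne', one_smul]
      exact hω.prodMk_nhds h2
    have hd0 : Tendsto (fun n => ((Y n ω - X θ x t ω, (c n)⁻¹ • η) : H × Θ)) atTop (𝓝 0) := by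
      have := hci.smul hcd
      rw [zero_smul] at this
      refine this.congr fun n => ?_
      rw [smul_smul, inv_mul_cancel₀ (zero_lt_one.trans_le (hc0 n)).ne', one_smul]
    have := ((hk.hasFDerivAt le_rfl (X θ x t ω, θ)).hasFDerivWithinAt (s := univ)).lim hd0
      (Eventually.of_forall fun _ => mem_univ _) hcd
    refine this.congr fun n => ?_
    rw [hD]
    simp only [Prod.mk_add_mk, add_sub_cancel]
  have hgi := (hS.integrable_pathMass_pow θ x t (N + 1)).const_mul
    (C * (3 + 2 * ‖θ‖ + B) ^ N * B)
  have hconv := tendsto_integral_of_dominated_convergence _ hDm hgi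
    (fun n => hbound.mono fun ω h => h n) hlim
  refine ⟨hgi.mono' (aestronglyMeasurable_of_tendsto_ae _ hDm hlim) ?_, ?_⟩
  · filter_upwards [hbound, hlim] with ω h1 h2
    exact le_of_tendsto h2.norm (Eventually.of_forall h1)
  -- The same expectations are difference quotients of the mean, whose limit is κ' in the direction
  -- (x' η, η).
  · refine tendsto_nhds_unique hconv ?_
    have h1 := (hκ.lim_real (x' η, η)).comp hc
    refine h1.congr fun n => ?_
    rw [hD]
    simp only [Function.comp_apply]
    rw [integral_smul, integral_sub (hS.integrable_comp hk _ _ t) (hS.integrable_comp hk θ x t)]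
    rfl

end OUSystem

end DerivativeOfMean

/-! ### Gaussian averages of second-order Taylor expansions. -/

section GaussianTaylor

variable {H : Type} [NormedAddCommGroup H] [InnerProductSpace ℝ H]

/-- A differentiable curve whose velocity is small stays close to its starting point. -/
lemma abs_sub_le_of_abs_deriv_le {u u' : ℝ → ℝ} {r C : ℝ} (hr : 0 ≤ r)
    (hu : ∀ s, HasDerivAt u (u' s) s) (hb : ∀ s ∈ Icc 0 r, |u' s| ≤ C) : |u r - u 0| ≤ C * r := by
  have := norm_image_sub_le_of_norm_deriv_le_segment' (f := u) (f' := u') (a := 0) (b := r) (C := C)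
    (fun s _ => (hu s).hasDerivWithinAt) (fun s hs => hb s ⟨hs.1, hs.2.le⟩) r ⟨hr, le_rfl⟩
  simpa using this

lemma PolyBdd.hasDerivAt_line {φ : H → ℝ} {C : ℝ} {N : ℕ} (hφ : PolyBdd 2 φ C N) (x v : H) (s : ℝ) :
    HasDerivAt (fun s : ℝ => φ (x + s • v)) (fderiv ℝ φ (x + s • v) v) s := by
  have h1 : HasDerivAt (fun s : ℝ => x + s • v) v s := by
    simpa using ((hasDerivAt_id s).smul_const v).const_add x
  exact (hφ.hasFDerivAt one_le_two (x + s • v)).comp_hasDerivAt s h1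

lemma PolyBdd.abs_taylor_le {φ : H → ℝ} {C : ℝ} {N : ℕ} (hφ : PolyBdd 2 φ C N) (x v : H) {r : ℝ}
    (hr : 0 ≤ r) (hr1 : r ≤ 1) :
    |φ (x + r • v) - φ x - r * fderiv ℝ φ x v| ≤ C * (1 + (2 * ‖x‖ + ‖v‖)) ^ N * ‖v‖ ^ 2 * r ^ 2 := by
  have hC := hφ.nonneg
  have hd : ∀ s, HasDerivAt (fun s : ℝ => φ (x + s • v) - φ x - s * fderiv ℝ φ x v)
      (fderiv ℝ φ (x + s • v) v - fderiv ℝ φ x v) s := fun s => by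
    refine (((hφ.hasDerivAt_line x v s).sub_const (φ x)).sub
      ((hasDerivAt_id s).mul_const (fderiv ℝ φ x v))).congr_deriv ?_
    rw [one_mul]
  have := abs_sub_le_of_abs_deriv_le (C := C * (1 + (2 * ‖x‖ + ‖v‖)) ^ N * ‖v‖ ^ 2 * r) hr hd
    (fun s hs => by
      have h1 := (hφ.fderiv (n := 1)).norm_sub_le le_rfl (x + s • v) x
      rw [add_sub_cancel_left] at h1
      have hs' : ‖s • v‖ = s * ‖v‖ := by rw [norm_smul, Real.norm_of_nonneg hs.1]
      have h2 : ‖x + s • v‖ ≤ ‖x‖ + ‖v‖ := by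
        refine (norm_add_le _ _).trans ?_
        rw [hs']
        have : s * ‖v‖ ≤ ‖v‖ := mul_le_of_le_one_left (norm_nonneg v) (hs.2.trans hr1)
        linarith
      rw [← ContinuousLinearMap.sub_apply, ← Real.norm_eq_abs]
      refine (ContinuousLinearMap.le_opNorm _ _).trans ?_
      rw [hs'] at h1
      calc _ ≤ C * (1 + (‖x + s • v‖ + ‖x‖)) ^ N * (s * ‖v‖) * ‖v‖ := by gcongr
        _ ≤ C * (1 + (2 * ‖x‖ + ‖v‖)) ^ N * (r * ‖v‖) * ‖v‖ := by
            have hb : 1 + (‖x + s • v‖ + ‖x‖) ≤ 1 + (2 * ‖x‖ + ‖v‖) := by linarith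
            have h0 := hs.1
            have h3 := hs.2
            gcongr
        _ = _ := by ring)
  simp only [zero_smul, add_zero, sub_self, zero_mul, sub_zero] at this
  exact this.trans (le_of_eq (by ring))

lemma PolyBdd.tendsto_taylor {φ : H → ℝ} {C : ℝ} {N : ℕ} (hφ : PolyBdd 2 φ C N) (x v : H) :
    Tendsto (fun r : ℝ => (r ^ 2)⁻¹ * (φ (x + r • v) - φ x - r * fderiv ℝ φ x v)) (𝓝[>] 0)
      (𝓝 (fderiv ℝ (fderiv ℝ φ) x v v / 2)) := by
  set κ := fderiv ℝ (fderiv ℝ φ) x v v with hκ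
  have hdd : HasDerivAt (fun s : ℝ => fderiv ℝ φ (x + s • v) v) κ 0 := by
    have h1 : HasDerivAt (fun s : ℝ => x + s • v) v 0 := by
      simpa using ((hasDerivAt_id (0 : ℝ)).smul_const v).const_add x
    have h2 : HasFDerivAt (fderiv ℝ φ) (fderiv ℝ (fderiv ℝ φ) x) (x + (0 : ℝ) • v) := by
      rw [zero_smul, add_zero]
      exact (hφ.fderiv (n := 1)).hasFDerivAt le_rfl x
    exact (ContinuousLinearMap.apply ℝ ℝ v).hasFDerivAt.comp_hasDerivAt (0 : ℝ)
      (h2.comp_hasDerivAt (0 : ℝ) h1)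
  rw [hasDerivAt_iff_isLittleO_nhds_zero] at hdd
  rw [Metric.tendsto_nhdsWithin_nhds]
  intro ε hε
  have h4 := hdd.def (half_pos hε)
  rw [Metric.eventually_nhds_iff] at h4
  obtain ⟨δ, hδ, h4⟩ := h4
  refine ⟨δ, hδ, fun r hr hrδ => ?_⟩
  have hr0 : 0 < r := hr
  rw [Real.dist_eq, sub_zero, abs_of_pos hr0] at hrδ
  have hd : ∀ s, HasDerivAt (fun s : ℝ => φ (x + s • v) - φ x - s * fderiv ℝ φ x v - s ^ 2 * (κ / 2))
      (fderiv ℝ φ (x + s • v) v - fderiv ℝ φ x v - s * κ) s := fun s => by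
    have := (((hφ.hasDerivAt_line x v s).sub_const (φ x)).sub
      ((hasDerivAt_id s).mul_const (fderiv ℝ φ x v))).sub
      ((hasDerivAt_pow 2 s).mul_const (κ / 2))
    refine this.congr_deriv ?_
    simp
    ring
  have := abs_sub_le_of_abs_deriv_le (C := ε / 2 * r) hr0.le hd (fun s hs => by
    have h5 := h4 (y := s) (by
      rw [Real.dist_eq, sub_zero, abs_of_nonneg hs.1]; exact hs.2.trans_lt hrδ)
    simp only [zero_add, zero_smul, add_zero, smul_eq_mul, Real.norm_eq_abs,
      abs_of_nonneg hs.1] at h5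
    exact h5.trans (by gcongr; exact hs.2))
  simp only [zero_smul, add_zero, sub_self, zero_mul, sub_zero, ne_eq, OfNat.ofNat_ne_zero,
    not_false_eq_true, zero_pow] at this
  rw [Real.dist_eq]
  have e : (r ^ 2)⁻¹ * (φ (x + r • v) - φ x - r * fderiv ℝ φ x v) - κ / 2 =
      (r ^ 2)⁻¹ * (φ (x + r • v) - φ x - r * fderiv ℝ φ x v - r ^ 2 * (κ / 2)) := by
    field_simp
  rw [e, abs_mul, abs_of_pos (by positivity)]
  calc _ ≤ (r ^ 2)⁻¹ * (ε / 2 * r * r) := by gcongr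
    _ = ε / 2 := by field_simp
    _ < ε := half_lt_self hε

variable [FiniteDimensional ℝ H] [MeasurableSpace H] [BorelSpace H]

/-- Expand z in an orthonormal basis; its coordinates are uncorrelated with unit variance, so only
the trace survives. -/
lemma integral_bilin_stdGaussian (B : H →L[ℝ] H →L[ℝ] ℝ) :
    ∫ z, B z z ∂stdGaussian H =
      ∑ i, B (stdOrthonormalBasis ℝ H i) (stdOrthonormalBasis ℝ H i) := by
  set e := stdOrthonormalBasis ℝ H
  have hL2 : ∀ v : H, MemLp (fun z => (inner ℝ v z : ℝ)) 2 (stdGaussian H) := fun v =>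
    (innerSL ℝ v).comp_memLp' (IsGaussian.memLp_two_id (μ := stdGaussian H))
  have hcov : ∀ i j, ∫ z, (inner ℝ (e i) z * inner ℝ (e j) z : ℝ) ∂stdGaussian H =
      if i = j then 1 else 0 := fun i j => by
    have h1 := covarianceBilin_apply (μ := stdGaussian H) IsGaussian.memLp_two_id (e i) (e j)
    have h0 : (stdGaussian H)[id] = 0 := integral_id_stdGaussian
    rw [h0, covarianceBilin_stdGaussian] at h1
    simp only [sub_zero] at h1
    rw [← h1]
    exact orthonormal_iff_ite.1 e.orthonormal i j
  have hexp : ∀ z, B z z = ∑ i, ∑ j, inner ℝ (e i) z * inner ℝ (e j) z * B (e i) (e j) := fun z => by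
    have h1 : B z = ∑ i, (inner ℝ (e i) z : ℝ) • B (e i) := by
      conv_lhs => rw [← e.sum_repr' z]
      simp only [map_sum, map_smul]
    have h2 : ∀ i, B (e i) z = ∑ j, inner ℝ (e j) z * B (e i) (e j) := fun i => by
      conv_lhs => rw [← e.sum_repr' z]
      simp only [map_sum, map_smul, smul_eq_mul]
    rw [h1, ContinuousLinearMap.sum_apply]
    refine Finset.sum_congr rfl fun i _ => ?_
    rw [ContinuousLinearMap.smul_apply, h2, smul_eq_mul, Finset.mul_sum]
    exact Finset.sum_congr rfl fun j _ => (mul_assoc _ _ _).symm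
  have hij : ∀ i j, Integrable (fun z => (inner ℝ (e i) z * inner ℝ (e j) z : ℝ))
      (stdGaussian H) := fun i j => (hL2 (e i)).integrable_mul (hL2 (e j))
  rw [integral_congr_ae (ae_of_all _ hexp)]
  rw [integral_finsetSum _ fun i _ => integrable_finsetSum _ fun j _ =>
    (hij i j).mul_const _]
  refine Finset.sum_congr rfl fun i _ => ?_
  rw [integral_finsetSum _ fun j _ => (hij i j).mul_const _]
  simp_rw [integral_mul_const, hcov]
  simp

lemma laplacian_eq_integral (φ : H → ℝ) (x : H) :
    Δ φ x = ∫ z, fderiv ℝ (fderiv ℝ φ) x z z ∂stdGaussian H := by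
  rw [integral_bilin_stdGaussian, InnerProductSpace.laplacian_eq_iteratedFDeriv_stdOrthonormalBasis]
  simp [iteratedFDeriv_two_apply]

/-- The heat semigroup is generated by half the Laplacian. -/
lemma tendsto_smear_laplacian {φ : H → ℝ} {C : ℝ} {N : ℕ} (hφ : PolyBdd 2 φ C N) (x : H) (σ : ℝ) :
    Tendsto (fun r : ℝ => (r ^ 2)⁻¹ * ((∫ z, φ (x + r • σ • z) ∂stdGaussian H) - φ x)) (𝓝[>] 0)
      (𝓝 (σ ^ 2 / 2 * Δ φ x)) := by
  have hC := hφ.nonneg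
  have hlim : (σ ^ 2 / 2 * Δ φ x) =
      ∫ z, fderiv ℝ (fderiv ℝ φ) x (σ • z) (σ • z) / 2 ∂stdGaussian H := by
    rw [laplacian_eq_integral, ← integral_const_mul]
    congr 1
    ext z
    simp only [map_smul, ContinuousLinearMap.smul_apply, smul_eq_mul]
    ring
  rw [hlim]
  -- The first-order term averages to zero, so division by r² leaves only the second-order term.
  have hlin : ∀ r : ℝ, ∫ z, r * fderiv ℝ φ x (σ • z) ∂stdGaussian H = 0 := fun r => by
    simp_rw [map_smul, smul_eq_mul]
    rw [integral_const_mul, integral_const_mul, integral_strongDual_stdGaussian]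
    simp
  have hlini : ∀ r : ℝ, Integrable (fun z => r * fderiv ℝ φ x (σ • z)) (stdGaussian H) := fun r =>
    (((fderiv ℝ φ x).comp (σ • ContinuousLinearMap.id ℝ H)).integrable_comp
      IsGaussian.integrable_id).const_mul r
  have hint : ∀ r : ℝ, Integrable (fun z => φ (x + r • σ • z)) (stdGaussian H) := fun r => by
    refine ((integrable_two_add_norm_pow_stdGaussian N).const_mul
      (C * (1 + ‖x‖ + |r| * |σ|) ^ N)).mono' ?_ (ae_of_all _ fun z => ?_)
    · exact (hφ.continuous.comp (by fun_prop)).aestronglyMeasurable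
    · refine (hφ.norm_le _).trans ?_
      rw [mul_assoc, ← mul_pow]
      gcongr
      have : ‖x + r • σ • z‖ ≤ ‖x‖ + |r| * |σ| * ‖z‖ := by
        refine (norm_add_le _ _).trans ?_
        rw [norm_smul, norm_smul, Real.norm_eq_abs, Real.norm_eq_abs, mul_assoc]
      have h1 : 0 ≤ |r| * |σ| := by positivity
      nlinarith [norm_nonneg x, norm_nonneg z, mul_nonneg (norm_nonneg x) (norm_nonneg z)]
  have key : Tendsto (fun r : ℝ => ∫ z, (r ^ 2)⁻¹ *
      (φ (x + r • σ • z) - φ x - r * fderiv ℝ φ x (σ • z)) ∂stdGaussian H) (𝓝[>] 0)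
      (𝓝 (∫ z, fderiv ℝ (fderiv ℝ φ) x (σ • z) (σ • z) / 2 ∂stdGaussian H)) := by
    refine tendsto_integral_filter_of_dominated_convergence
      (fun z => C * (1 + 2 * ‖x‖ + |σ|) ^ N * |σ| ^ 2 * (2 + ‖z‖) ^ (N + 2)) ?_ ?_
      ((integrable_two_add_norm_pow_stdGaussian (N + 2)).const_mul _)
      (ae_of_all _ fun z => hφ.tendsto_taylor x (σ • z))
    · refine Eventually.of_forall fun r => Continuous.aestronglyMeasurable ?_
      have h1 : Continuous fun z : H => φ (x + r • σ • z) := hφ.continuous.comp (by fun_prop)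
      have h2 : Continuous fun z : H => fderiv ℝ φ x (σ • z) :=
        (fderiv ℝ φ x).continuous.comp (by fun_prop)
      exact continuous_const.mul ((h1.sub continuous_const).sub (continuous_const.mul h2))
    · have : ∀ᶠ r : ℝ in 𝓝[>] 0, r ∈ Ioc 0 1 := Ioc_mem_nhdsGT zero_lt_one
      filter_upwards [this] with r hr
      refine ae_of_all _ fun z => ?_
      have h1 := hφ.abs_taylor_le x (σ • z) hr.1.le hr.2
      rw [norm_mul, Real.norm_of_nonneg (by positivity : 0 ≤ (r ^ 2)⁻¹), Real.norm_eq_abs]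
      rw [inv_mul_le_iff₀ (by have := hr.1; positivity)]
      refine h1.trans ?_
      rw [norm_smul, Real.norm_eq_abs, mul_comm (r ^ 2)]
      refine mul_le_mul_of_nonneg_right ?_ (sq_nonneg r)
      have hz := norm_nonneg z
      have hx := norm_nonneg x
      have hs := abs_nonneg σ
      have h2 : 1 + (2 * ‖x‖ + |σ| * ‖z‖) ≤ (1 + 2 * ‖x‖ + |σ|) * (2 + ‖z‖) := by
        nlinarith [mul_nonneg hx hz, mul_nonneg hs hz]
      calc _ ≤ C * ((1 + 2 * ‖x‖ + |σ|) * (2 + ‖z‖)) ^ N * (|σ| * (2 + ‖z‖)) ^ 2 := by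
            gcongr
            linarith
        _ = _ := by rw [mul_pow, mul_pow]; ring
  refine key.congr fun r => ?_
  have hs : Integrable (fun z => φ (x + r • σ • z) - φ x) (stdGaussian H) :=
    (hint r).sub (integrable_const _)
  rw [integral_const_mul, integral_sub hs (hlini r), hlin,
    integral_sub (hint r) (integrable_const _)]
  simp

end GaussianTaylor

/-! ### Difference quotients with two moving points. -/

section Strict

/-- Strict differentiability is what permits both points to move. It will be applied to (X_t, X'_t)
and (x + σW_t, x̃), whose distance is of order t while the noise moves both by a larger amount. -/
lemma tendsto_smul_sub_of_hasStrictFDerivAt {E ι : Type*} [NormedAddCommGroup E] [NormedSpace ℝ E]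
    {ψ : E → ℝ} {ψ' : E →L[ℝ] ℝ} {p r : E} (hψ : HasStrictFDerivAt ψ ψ' p) {l : Filter ι}
    {c : ι → ℝ} {y q : ι → E} (hy : Tendsto y l (𝓝 p)) (hq : Tendsto q l (𝓝 p))
    (hr : Tendsto (fun i => c i • (y i - q i)) l (𝓝 r)) :
    Tendsto (fun i => c i * (ψ (y i) - ψ (q i))) l (𝓝 (ψ' r)) := by
  have h1 := hψ.isLittleO.comp_tendsto (hy.prodMk_nhds hq)
  have h2 := (Asymptotics.isBigO_refl c l).smul_isLittleO h1
  have h3 : (fun i => c i • (ψ (y i) - ψ (q i) - ψ' (y i - q i))) =o[l] fun _ => (1 : ℝ) :=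
    h2.trans_isBigO (hr.isBigO_one ℝ)
  have h4 := (Asymptotics.isLittleO_one_iff ℝ).1 h3
  have h5 := h4.add ((ψ'.continuous.tendsto r).comp hr)
  rw [zero_add] at h5
  refine h5.congr fun i => ?_
  simp only [Function.comp_apply, map_smul, smul_eq_mul]
  ring

end Strict

/-! ### Short-time increments of the pair once the noise is removed. -/

section Generator

variable {Ω : Type*} [MeasurableSpace Ω] {P : Measure Ω} [IsProbabilityMeasure P]
  {H Θ : Type} [NormedAddCommGroup H] [InnerProductSpace ℝ H] [FiniteDimensional ℝ H]
  [MeasurableSpace H] [BorelSpace H] [NormedAddCommGroup Θ] [NormedSpace ℝ Θ]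
  [FiniteDimensional ℝ Θ]

lemma IsNoise.map_eq {W : ℝ≥0 → Ω → H} (hW : IsNoise P W) (t : ℝ≥0) :
    P.map (W t) = gaussianOf ((0 : H), √(t : ℝ) • ContinuousLinearMap.id ℝ H) := by
  have hm := (hW.measurable t).aemeasurable (μ := P)
  have : IsProbabilityMeasure (P.map (W t)) := Measure.isProbabilityMeasure_map hm
  refine Measure.ext_of_charFun (funext fun ξ => ?_)
  rw [charFun_gaussianOf (a := ((0 : H), √(t : ℝ) • ContinuousLinearMap.id ℝ H))
    (isSelfAdjoint_smul (IsSelfAdjoint.one (H →L[ℝ] H)) _), charFun_apply,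
    integral_map hm (by fun_prop)]
  have key := hW.charFun_sum t 1 fun _ => ξ
  simp only [Finset.range_one, Finset.sum_singleton, zero_add, Nat.cast_one, one_mul,
    Nat.cast_zero, zero_mul] at key
  have e : (-(t * ‖ξ‖ ^ 2) / 2 : ℝ) =
      -‖((0 : H), √(t : ℝ) • ContinuousLinearMap.id ℝ H).2 ξ‖ ^ 2 / 2 := by
    simp only [ContinuousLinearMap.smul_apply, ContinuousLinearMap.id_apply]
    rw [norm_smul, mul_pow, Real.norm_of_nonneg (Real.sqrt_nonneg _), Real.sq_sqrt t.coe_nonneg]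
  rw [← e, ← key, inner_zero_right, Complex.ofReal_zero, zero_mul, Complex.exp_zero, one_mul]
  refine integral_congr_ae ?_
  filter_upwards [hW.path] with ω hω
  rw [hω.2, sub_zero, real_inner_comm]

lemma norm_integral_affine_le (A : H →L[ℝ] H) (a : H) {y : ℝ → H} (hy : Continuous y) {t : ℝ}
    (ht : 0 ≤ t) :
    ‖∫ s in (0 : ℝ)..t, (a - A (y s))‖ ≤ t * ‖a‖ + ‖A‖ * ∫ s in (0 : ℝ)..t, ‖y s‖ := by
  have h2 : ∫ s in (0 : ℝ)..t, (‖a‖ + ‖A‖ * ‖y s‖) =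
      t * ‖a‖ + ‖A‖ * ∫ s in (0 : ℝ)..t, ‖y s‖ := by
    rw [intervalIntegral.integral_add (Continuous.intervalIntegrable (by fun_prop) _ _)
      (Continuous.intervalIntegrable (by fun_prop) _ _), intervalIntegral.integral_const_mul]
    simp
  rw [← h2]
  exact (intervalIntegral.norm_integral_le_integral_norm ht).trans
    (intervalIntegral.integral_mono_on ht (Continuous.intervalIntegrable (by fun_prop) _ _)
      (Continuous.intervalIntegrable (by fun_prop) _ _) fun s _ =>
        (norm_sub_le _ _).trans (add_le_add le_rfl (A.le_opNorm _)))

lemma norm_integral_affine_sub_le (A B : H →L[ℝ] H) (a : H) {y u : ℝ → H} (hy : Continuous y)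
    (hu : Continuous u) {t R : ℝ} (ht : 0 ≤ t) (hR : ∀ s ∈ Icc 0 t, ‖u s‖ ≤ R) :
    ‖∫ s in (0 : ℝ)..t, (a - B (y s) - A (u s))‖ ≤
      t * ‖a‖ + ‖B‖ * (∫ s in (0 : ℝ)..t, ‖y s‖) + ‖A‖ * R * t := by
  rw [intervalIntegral.integral_sub (f := fun s => a - B (y s)) (g := fun s => A (u s))
    (Continuous.intervalIntegrable (by fun_prop) _ _)
    (Continuous.intervalIntegrable (by fun_prop) _ _)]
  refine (norm_sub_le _ _).trans (add_le_add (norm_integral_affine_le B a hy ht) ?_)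
  refine (intervalIntegral.norm_integral_le_of_norm_le_const (C := ‖A‖ * R) fun s hs => ?_).trans
    (by rw [sub_zero, abs_of_nonneg ht])
  rw [uIoc_of_le ht] at hs
  exact (A.le_opNorm _).trans (by gcongr; exact hR s ⟨hs.1.le, hs.2⟩)

/-- The average size of a path up to time `t`. -/
def pathMean (x : ℝ≥0 → Ω → H) (t : ℝ≥0) (ω : Ω) : ℝ :=
  1 + ‖x t ω‖ + (t : ℝ)⁻¹ * ∫ s in (0 : ℝ)..t, ‖x s.toNNReal ω‖

namespace OUSystem

variable {W : ℝ≥0 → Ω → H} {g : Θ → H} {h : Θ → H →L[ℝ] H} {σ K ρ L : ℝ}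
  {X : Θ → H → ℝ≥0 → Ω → H} {X' : Θ → H → (Θ →L[ℝ] H) → ℝ≥0 → Ω → (Θ →L[ℝ] H)}

lemma mean_nonneg (x : ℝ≥0 → Ω → H) (t : ℝ≥0) (ω : Ω) :
    0 ≤ (t : ℝ)⁻¹ * ∫ s in (0 : ℝ)..t, ‖x s.toNNReal ω‖ :=
  mul_nonneg (inv_nonneg.2 t.coe_nonneg) (integral_norm_nonneg x t ω)

lemma one_le_pathMean (x : ℝ≥0 → Ω → H) (t : ℝ≥0) (ω : Ω) : 1 ≤ pathMean x t ω := by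
  unfold pathMean
  linarith [mean_nonneg x t ω, norm_nonneg (x t ω)]

lemma norm_eval_le_pathMean (x : ℝ≥0 → Ω → H) (t : ℝ≥0) (ω : Ω) :
    ‖x t ω‖ ≤ pathMean x t ω := by
  unfold pathMean
  linarith [mean_nonneg x t ω]

lemma add_integral_le_pathMean (x : ℝ≥0 → Ω → H) {t : ℝ≥0} (ht : 0 < t) (ω : Ω) :
    t + (∫ s in (0 : ℝ)..t, ‖x s.toNNReal ω‖) ≤ t * pathMean x t ω := by
  have ht' : (0 : ℝ) < t := NNReal.coe_pos.2 ht
  unfold pathMean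
  rw [mul_add, mul_add, mul_inv_cancel_left₀ ht'.ne', mul_one]
  linarith [mul_nonneg ht'.le (norm_nonneg (x t ω))]

lemma aestronglyMeasurable_pathMean (hS : OUSystem P W g h σ K ρ L X X') (θ : Θ) (x : H) (t : ℝ≥0) :
    AEStronglyMeasurable (pathMean (X θ x) t) P := by
  obtain ⟨M, hM⟩ := hS.exists_eLpNorm_le θ x le_rfl ENNReal.one_ne_top
  have h2 := eLpNorm_integral_norm_le (fun s => (hS.measurable θ x s).aestronglyMeasurable)
    ((hS.path θ x).mono fun _ h => h.1) le_rfl hM t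
  exact (aestronglyMeasurable_const.add (hS.measurable θ x t).aestronglyMeasurable.norm).add
    (h2.1.const_mul _)

/-- The averages have moments that are bounded uniformly in time. -/
lemma exists_integral_pathMean_pow_le (hS : OUSystem P W g h σ K ρ L X X') (θ : Θ) (x : H) (N : ℕ) :
    ∃ M : ℝ, ∀ t, 0 < t → Integrable (fun ω => pathMean (X θ x) t ω ^ (N + 1)) P ∧
      ∫ ω, pathMean (X θ x) t ω ^ (N + 1) ∂P ≤ M := by
  have hp1 : (1 : ENNReal) ≤ ((N + 1 : ℕ) : ENNReal) := by norm_cast; omega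
  have hp : ((N + 1 : ℕ) : ENNReal) ≠ ⊤ := by simp
  obtain ⟨M, hM⟩ := hS.exists_eLpNorm_le θ x hp1 hp
  refine ⟨((1 + M + M : ℝ≥0) : ℝ) ^ (N + 1), fun t ht => ?_⟩
  have h2 := eLpNorm_integral_norm_le (fun s => (hS.measurable θ x s).aestronglyMeasurable)
    ((hS.path θ x).mono fun _ h => h.1) hp1 hM t
  have hm := hS.aestronglyMeasurable_pathMean θ x t
  have hX := (hS.measurable θ x t).aestronglyMeasurable (μ := P)
  have hle : eLpNorm (pathMean (X θ x) t) (N + 1 : ℕ) P ≤ (1 + M + M : ℝ≥0) := by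
    have e1 := eLpNorm_add_le (p := ((N + 1 : ℕ) : ENNReal)) (μ := P)
      (f := (fun _ => (1 : ℝ)) + fun ω => ‖X θ x t ω‖)
      (g := fun ω => (t : ℝ)⁻¹ * ∫ s in (0 : ℝ)..t, ‖X θ x s.toNNReal ω‖)
      (aestronglyMeasurable_const.add hX.norm) (h2.1.const_mul _) hp1
    have e2 := eLpNorm_add_le (p := ((N + 1 : ℕ) : ENNReal)) (μ := P)
      (f := (fun _ : Ω => (1 : ℝ))) (g := fun ω => ‖X θ x t ω‖)
      aestronglyMeasurable_const hX.norm hp1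
    have e3 : eLpNorm (fun ω => (t : ℝ)⁻¹ * ∫ s in (0 : ℝ)..t, ‖X θ x s.toNNReal ω‖)
        (N + 1 : ℕ) P ≤ M := by
      refine (eLpNorm_le_mul_eLpNorm_of_ae_le_mul' (c := t⁻¹)
        (g := fun ω => ∫ s in (0 : ℝ)..t, ‖X θ x s.toNNReal ω‖) (ae_of_all _ fun ω => ?_) _).trans ?_
      · rw [enorm_mul, ← NNReal.coe_inv, NNReal.enorm_eq]
      · refine (mul_le_mul_right h2.2 _).trans ?_
        rw [← ENNReal.coe_mul, ENNReal.coe_le_coe, inv_mul_cancel_left₀ ht.ne']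
    have e4 : eLpNorm (fun _ : Ω => (1 : ℝ)) (N + 1 : ℕ) P ≤ 1 := by
      rw [eLpNorm_const _ (by positivity) (NeZero.ne _), measure_univ, ENNReal.one_rpow, mul_one]
      simp
    rw [ENNReal.coe_add, ENNReal.coe_add]
    refine e1.trans (add_le_add (e2.trans (add_le_add (by exact_mod_cast e4) ?_)) e3)
    rw [eLpNorm_norm]
    exact hM t
  have hmem : MemLp (pathMean (X θ x) t) (N + 1 : ℕ) P := ⟨hm, hle.trans_lt ENNReal.coe_lt_top⟩
  have habs : ∀ ω, ‖pathMean (X θ x) t ω‖ ^ (N + 1) = pathMean (X θ x) t ω ^ (N + 1) := fun ω => by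
    rw [Real.norm_of_nonneg (zero_le_one.trans (one_le_pathMean _ _ _))]
  have h3 := integral_pow_le_of_eLpNorm_le hle
  have h4 := hmem.integrable_norm_pow'
  simp_rw [habs] at h3 h4
  exact ⟨h4, h3⟩

/-- The increments of the pair over a short time, without the noise. -/
lemma norm_increment_le (hS : OUSystem P W g h σ K ρ L X X') (θ : Θ) (x : H) (x' : Θ →L[ℝ] H) :
    ∀ᵐ ω ∂P, ∀ t : ℝ≥0, 0 < t → t ≤ 1 →
      ‖X θ x t ω - (x + σ • W t ω)‖ ≤ t * ((‖g θ‖ + ‖h θ‖) * pathMean (X θ x) t ω) ∧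
      ‖X' θ x x' t ω - x'‖ ≤ t * ((L + ‖h θ‖ * (‖x'‖ + L)) * pathMean (X θ x) t ω) := by
  filter_upwards [hS.path_real θ x, hS.path_tangent_real θ x x', hS.norm_tangent_le θ x x']
    with ω h1 h2 h3 t ht ht1
  have hL := hS.nonneg
  have ht' : (0 : ℝ) < t := NNReal.coe_pos.2 ht
  have ht1' : (t : ℝ) ≤ 1 := by exact_mod_cast ht1
  have hI := integral_norm_nonneg (X θ x) t ω
  have hA := add_integral_le_pathMean (X θ x) ht ω
  have hA1 := one_le_pathMean (X θ x) t ω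
  set I := ∫ s in (0 : ℝ)..t, ‖X θ x s.toNNReal ω‖ with hIdef
  set M := pathMean (X θ x) t ω
  constructor
  · have e1 := h1.2 t t.coe_nonneg
    rw [Real.toNNReal_coe] at e1
    have e3 : X θ x t ω - (x + σ • W t ω) =
        ∫ s in (0 : ℝ)..t, (g θ - h θ (X θ x s.toNNReal ω)) := by
      rw [e1]; abel
    rw [e3]
    refine (norm_integral_affine_le _ _ h1.1 ht'.le).trans ?_
    have h5 := norm_nonneg (g θ)
    have h6 := norm_nonneg (h θ)
    have h7 : I ≤ t * M := by linarith
    have h8 : (t : ℝ) * 1 ≤ t * M := by gcongr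
    nlinarith
  · refine ContinuousLinearMap.opNorm_le_bound _ (by positivity) fun η => ?_
    have e1 := h2.2 t t.coe_nonneg η
    rw [Real.toNNReal_coe] at e1
    rw [ContinuousLinearMap.sub_apply, e1, add_sub_cancel_left]
    have hg : ‖fderiv ℝ g θ η‖ ≤ L * ‖η‖ := by
      have := hS.polyBdd_g.norm_fderiv_le le_rfl θ
      rw [pow_zero, mul_one] at this
      exact (ContinuousLinearMap.le_opNorm _ _).trans (by gcongr)
    have hh : ‖fderiv ℝ h θ η‖ ≤ L * ‖η‖ := by
      have := hS.polyBdd_h.norm_fderiv_le le_rfl θ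
      rw [pow_zero, mul_one] at this
      exact (ContinuousLinearMap.le_opNorm _ _).trans (by gcongr)
    have hcu : Continuous fun s : ℝ => X' θ x x' s.toNNReal ω η := h2.1.clm_apply continuous_const
    have hbu : ∀ s ∈ Icc (0 : ℝ) t, ‖X' θ x x' s.toNNReal ω η‖ ≤ (‖x'‖ + L) * M * ‖η‖ := by
      intro s hs
      have h4 := h3 s.toNNReal
      rw [Real.coe_toNNReal s hs.1] at h4
      have h5 : ∫ r in (0 : ℝ)..s, ‖X θ x r.toNNReal ω‖ ≤ I :=
        intervalIntegral.integral_mono_interval le_rfl hs.1 hs.2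
          (ae_of_all _ fun _ => norm_nonneg _) (h1.1.norm.intervalIntegrable _ _)
      refine (ContinuousLinearMap.le_opNorm _ _).trans ?_
      gcongr
      refine h4.trans ?_
      have h6 : s + ∫ r in (0 : ℝ)..s, ‖X θ x r.toNNReal ω‖ ≤ M := by nlinarith [hs.2]
      have h7 := norm_nonneg x'
      calc _ ≤ ‖x'‖ * M + L * M := by
            gcongr
            nlinarith
        _ = _ := by ring
    refine (norm_integral_affine_sub_le _ _ _ h1.1 hcu t.coe_nonneg hbu).trans ?_
    calc _ ≤ t * (L * ‖η‖) + L * ‖η‖ * I + ‖h θ‖ * ((‖x'‖ + L) * M * ‖η‖) * t := by gcongr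
      _ = L * ‖η‖ * (t + I) + ‖h θ‖ * ((‖x'‖ + L) * M * ‖η‖) * t := by ring
      _ ≤ L * ‖η‖ * (t * M) + ‖h θ‖ * ((‖x'‖ + L) * M * ‖η‖) * t := by gcongr
      _ = _ := by ring

/-- The drift of the pair. -/
def pairDrift (g : Θ → H) (h : Θ → H →L[ℝ] H) (θ : Θ) (p : H × (Θ →L[ℝ] H)) : H × (Θ →L[ℝ] H) :=
  (g θ - h θ p.1, fderiv ℝ g θ - (fderiv ℝ h θ).flip p.1 - (h θ).comp p.2)

/-- The pair without the noise moves with the drift. -/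
lemma tendsto_increment (hS : OUSystem P W g h σ K ρ L X X') (θ : Θ) (x : H) (x' : Θ →L[ℝ] H) :
    ∀ᵐ ω ∂P, Tendsto (fun t : ℝ≥0 => (t : ℝ)⁻¹ •
      ((X θ x t ω, X' θ x x' t ω) - (x + σ • W t ω, x'))) (𝓝[>] 0)
      (𝓝 (pairDrift g h θ (x, x'))) := by
  filter_upwards [hS.path θ x, hS.path_tangent θ x x', hS.eval_zero θ x,
    hS.tangent_eval_zero θ x x'] with ω h1 h2 h3 h4
  have hcoe : Tendsto (fun t : ℝ≥0 => (t : ℝ)) (𝓝[>] 0) (𝓝[>] 0) := by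
    refine tendsto_nhdsWithin_iff.2 ⟨?_, ?_⟩
    · exact (NNReal.continuous_coe.tendsto 0).mono_left nhdsWithin_le_nhds
    · filter_upwards [self_mem_nhdsWithin] with t ht using NNReal.coe_pos.2 ht
  have hX : Continuous fun s : ℝ => X θ x s.toNNReal ω := h1.1.comp continuous_real_toNNReal
  have hX' : Continuous fun s : ℝ => X' θ x x' s.toNNReal ω := h2.1.comp continuous_real_toNNReal
  have hint : ∀ {E : Type} [NormedAddCommGroup E] [NormedSpace ℝ E] [CompleteSpace E] {b : ℝ → E},
      Continuous b → Tendsto (fun t : ℝ≥0 => (t : ℝ)⁻¹ • ∫ s in (0 : ℝ)..t, b s) (𝓝[>] 0)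
        (𝓝 (b 0)) := fun {E} _ _ _ b hb => by
    have := (intervalIntegral.integral_hasDerivAt_right (hb.intervalIntegrable 0 0)
      (hb.stronglyMeasurableAtFilter _ _) hb.continuousAt).tendsto_slope_zero_right
    refine (this.comp hcoe).congr fun t => ?_
    simp
  have hb1 := hint (b := fun s => g θ - h θ (X θ x s.toNNReal ω))
    (continuous_const.sub ((h θ).continuous.comp hX))
  have hb2 := hint (b := fun s => fderiv ℝ g θ -
      (fderiv ℝ h θ).flip (X θ x s.toNNReal ω) - (h θ).comp (X' θ x x' s.toNNReal ω))
    ((continuous_const.sub ((fderiv ℝ h θ).flip.continuous.comp hX)).sub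
      ((ContinuousLinearMap.compL ℝ Θ H H (h θ)).continuous.comp hX'))
  simp only [Real.toNNReal_zero, h3, h4] at hb1 hb2
  refine (hb1.prodMk_nhds hb2).congr fun t => ?_
  rw [Prod.mk_sub_mk, Prod.smul_mk]
  congr 2
  · rw [h1.2 t]; abel
  · rw [h2.2 t]; abel

end OUSystem

end Generator

/-! ### The infinitesimal generator of the pair. -/

section GeneratorLimit

variable {Ω : Type*} [MeasurableSpace Ω] {P : Measure Ω} [IsProbabilityMeasure P]
  {H Θ : Type} [NormedAddCommGroup H] [InnerProductSpace ℝ H] [FiniteDimensional ℝ H]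
  [MeasurableSpace H] [BorelSpace H] [NormedAddCommGroup Θ] [NormedSpace ℝ Θ]
  [FiniteDimensional ℝ Θ]

lemma PolyBdd.comp_mk_right {E F G : Type*} [NormedAddCommGroup E] [NormedSpace ℝ E]
    [NormedAddCommGroup F] [NormedSpace ℝ F] [NormedAddCommGroup G] [NormedSpace ℝ G] {n N : ℕ}
    {C : ℝ} {ψ : E × F → G} (hψ : PolyBdd n ψ C N) (b : F) :
    ∃ C' N', PolyBdd n (fun x => ψ (x, b)) C' N' := by
  have h1 : PolyBdd n (fun x : E => x) ‖ContinuousLinearMap.id ℝ E‖ 1 :=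
    PolyBdd.clm (ContinuousLinearMap.id ℝ E)
  exact ⟨_, _, hψ.comp (h1.prodMk ((PolyBdd.const (n := n) (E := E) b).mono le_rfl zero_le_one))⟩

namespace OUSystem

variable {W : ℝ≥0 → Ω → H} {g : Θ → H} {h : Θ → H →L[ℝ] H} {σ K ρ L : ℝ}
  {X : Θ → H → ℝ≥0 → Ω → H} {X' : Θ → H → (Θ →L[ℝ] H) → ℝ≥0 → Ω → (Θ →L[ℝ] H)}

/-- W_t has the law of √t Z, so this is the Gaussian Taylor limit at r = √t. -/
lemma tendsto_heat (hS : OUSystem P W g h σ K ρ L X X') {φ : H → ℝ} {C : ℝ} {N : ℕ}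
    (hφ : PolyBdd 2 φ C N) (x : H) :
    Tendsto (fun t : ℝ≥0 => (t : ℝ)⁻¹ * ((∫ ω, φ (x + σ • W t ω) ∂P) - φ x)) (𝓝[>] 0)
      (𝓝 (σ ^ 2 / 2 * Δ φ x)) := by
  have hcoe : Tendsto (fun t : ℝ≥0 => √(t : ℝ)) (𝓝[>] 0) (𝓝[>] 0) := by
    refine tendsto_nhdsWithin_iff.2 ⟨?_, ?_⟩
    · have : Continuous fun t : ℝ≥0 => √(t : ℝ) := by fun_prop
      have := (this.tendsto 0).mono_left (nhdsWithin_le_nhds (s := Ioi 0))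
      simpa using this
    · filter_upwards [self_mem_nhdsWithin] with t ht using Real.sqrt_pos.2 (NNReal.coe_pos.2 ht)
  refine ((tendsto_smear_laplacian hφ x σ).comp hcoe).congr fun t => ?_
  simp only [Function.comp_apply]
  rw [Real.sq_sqrt t.coe_nonneg]
  congr 2
  have hc : Continuous fun w : H => φ (x + σ • w) := hφ.continuous.comp (by fun_prop)
  have h1 := integral_map (μ := P) (hS.noise.measurable t).aemeasurable
    (f := fun w => φ (x + σ • w)) hc.aestronglyMeasurable
  rw [← h1, hS.noise.map_eq t, gaussianOf, integral_map (measurable_affine _).aemeasurable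
    hc.aestronglyMeasurable]
  congr 1
  ext z
  simp only [zero_add, ContinuousLinearMap.smul_apply, ContinuousLinearMap.id_apply]
  rw [smul_comm]

/-- The generator of the pair on functions with polynomially bounded derivatives. -/
theorem tendsto_generator (hS : OUSystem P W g h σ K ρ L X X') {ψ : H × (Θ →L[ℝ] H) → ℝ} {C : ℝ}
    {N : ℕ} (hψ : PolyBdd 2 ψ C N) (θ : Θ) (x : H) (x' : Θ →L[ℝ] H) :
    Tendsto (fun t : ℝ≥0 => (t : ℝ)⁻¹ *
        ((∫ ω, ψ (X θ x t ω, X' θ x x' t ω) ∂P) - ψ (x, x'))) (𝓝[>] 0)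
      (𝓝 (fderiv ℝ ψ (x, x') (pairDrift g h θ (x, x')) +
        σ ^ 2 / 2 * Δ (fun y => ψ (y, x')) x)) := by
  have hC := hψ.nonneg
  have hL := hS.nonneg
  set c₀ := fderiv ℝ ψ (x, x') (pairDrift g h θ (x, x')) with hc₀
  set y : ℝ≥0 → Ω → H × (Θ →L[ℝ] H) := fun t ω => (X θ x t ω, X' θ x x' t ω) with hy
  set q : ℝ≥0 → Ω → H × (Θ →L[ℝ] H) := fun t ω => (x + σ • W t ω, x') with hq
  set M : ℝ≥0 → Ω → ℝ := fun t ω => pathMean (X θ x) t ω with hM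
  set C₂ : ℝ := (‖g θ‖ + ‖h θ‖) + (L + ‖h θ‖ * (‖x'‖ + L)) with hC₂
  have hC₂0 : 0 ≤ C₂ := by positivity
  set C₃ : ℝ := 3 + 2 * ‖x'‖ + 3 * C₂ with hC₃
  have hC₃0 : 0 ≤ C₃ := by positivity
  have hincr : ∀ᵐ ω ∂P, ∀ t : ℝ≥0, 0 < t → t ≤ 1 → ‖y t ω - q t ω‖ ≤ t * (C₂ * M t ω) ∧
      1 + (‖y t ω‖ + ‖q t ω‖) ≤ C₃ * M t ω := by
    filter_upwards [hS.norm_increment_le θ x x'] with ω hω t ht ht1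
    obtain ⟨h1, h2⟩ := hω t ht ht1
    have hM1 : 1 ≤ M t ω := one_le_pathMean _ _ _
    have hMX : ‖X θ x t ω‖ ≤ M t ω := norm_eval_le_pathMean _ _ _
    have ht1' : (t : ℝ) ≤ 1 := by exact_mod_cast ht1
    change _ ≤ t * (_ * M t ω) at h1 h2
    have hd : ‖y t ω - q t ω‖ ≤ t * (C₂ * M t ω) := by
      rw [hy, hq]
      simp only [Prod.mk_sub_mk, Prod.norm_mk]
      refine max_le (h1.trans ?_) (h2.trans ?_)
      · gcongr
        rw [hC₂]
        exact le_add_of_nonneg_right (by positivity)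
      · gcongr
        rw [hC₂]
        exact le_add_of_nonneg_left (by positivity)
    have hd' : ‖y t ω - q t ω‖ ≤ C₂ * M t ω :=
      hd.trans (mul_le_of_le_one_left (by positivity) ht1')
    refine ⟨hd, ?_⟩
    have hX' : ‖X' θ x x' t ω‖ ≤ ‖x'‖ + C₂ * M t ω := by
      have h3 : ‖X' θ x x' t ω - x'‖ ≤ C₂ * M t ω := (norm_snd_le (y t ω - q t ω)).trans hd'
      have := norm_add_le x' (X' θ x x' t ω - x')
      rw [add_sub_cancel] at this
      linarith
    have hyn : ‖y t ω‖ ≤ M t ω + (‖x'‖ + C₂ * M t ω) :=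
      max_le (hMX.trans (le_add_of_nonneg_right (by positivity)))
        (hX'.trans (le_add_of_nonneg_left (by linarith)))
    have hqn : ‖q t ω‖ ≤ ‖y t ω‖ + C₂ * M t ω := by
      have := norm_sub_le (y t ω) (y t ω - q t ω)
      rw [sub_sub_cancel] at this
      linarith
    have := norm_nonneg x'
    rw [hC₃]
    nlinarith
  have hym : ∀ t, AEStronglyMeasurable (y t) P := fun t =>
    (hS.measurable θ x t).aestronglyMeasurable.prodMk
      (hS.measurable_tangent θ x x' t).aestronglyMeasurable
  have hqm : ∀ t, AEStronglyMeasurable (q t) P := fun t =>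
    (aestronglyMeasurable_const.add
      ((hS.noise.measurable t).aestronglyMeasurable.const_smul σ)).prodMk aestronglyMeasurable_const
  have hMint : ∀ (k : ℕ) t, 0 < t → Integrable (fun ω => M t ω ^ (k + 1)) P := fun k t ht => by
    obtain ⟨_, hB⟩ := hS.exists_integral_pathMean_pow_le θ x k
    exact (hB t ht).1
  have hpsi_int : ∀ (z : ℝ≥0 → Ω → H × (Θ →L[ℝ] H)), (∀ t, AEStronglyMeasurable (z t) P) →
      (∀ t ω, ‖z t ω‖ ≤ ‖y t ω‖ + ‖q t ω‖) → ∀ t, 0 < t → t ≤ 1 →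
      Integrable (fun ω => ψ (z t ω)) P := by
    intro z hz hzn t ht ht1
    refine ((hMint N t ht).const_mul (C * C₃ ^ N)).mono'
      (hψ.continuous.comp_aestronglyMeasurable (hz t)) ?_
    filter_upwards [hincr] with ω hω
    have h1 := (hω t ht ht1).2
    have hM1 : 1 ≤ M t ω := one_le_pathMean _ _ _
    calc ‖ψ (z t ω)‖ ≤ C * (1 + ‖z t ω‖) ^ N := hψ.norm_le _
      _ ≤ C * (C₃ * M t ω) ^ N := by
          gcongr
          linarith [hzn t ω]
      _ = C * C₃ ^ N * M t ω ^ N := by rw [mul_pow]; ring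
      _ ≤ C * C₃ ^ N * M t ω ^ (N + 1) := by
          gcongr
          exact Nat.le_succ N
  have hyi := hpsi_int y hym fun t ω => le_add_of_nonneg_right (norm_nonneg _)
  have hqi := hpsi_int q hqm fun t ω => le_add_of_nonneg_left (norm_nonneg _)
  -- The drift part: y and q contain the same noise and differ by O(t), so F converges almost surely
  -- to c₀. What remains, from (x, x') to q, is the heat part.
  set F : ℝ≥0 → Ω → ℝ := fun t ω => (t : ℝ)⁻¹ * (ψ (y t ω) - ψ (q t ω)) with hF
  have hFi : ∀ t, 0 < t → t ≤ 1 → Integrable (F t) P := fun t ht ht1 =>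
    ((hyi t ht ht1).sub (hqi t ht ht1)).const_mul _
  set C₄ : ℝ := C * C₃ ^ N * C₂ with hC₄
  have hFb : ∀ᵐ ω ∂P, ∀ t : ℝ≥0, 0 < t → t ≤ 1 → |F t ω| ≤ C₄ * M t ω ^ (N + 1) := by
    filter_upwards [hincr] with ω hω t ht ht1
    obtain ⟨h1, h2⟩ := hω t ht ht1
    have ht' : (0 : ℝ) < t := NNReal.coe_pos.2 ht
    have hM1 : 1 ≤ M t ω := one_le_pathMean _ _ _
    have h3 := hψ.norm_sub_le one_le_two (y t ω) (q t ω)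
    rw [hF, abs_mul, abs_of_pos (inv_pos.2 ht'), inv_mul_le_iff₀ ht', ← Real.norm_eq_abs]
    calc _ ≤ _ := h3
      _ ≤ C * (C₃ * M t ω) ^ N * (t * (C₂ * M t ω)) := by gcongr
      _ = _ := by rw [hC₄, mul_pow]; ring
  -- Gives the moment of order 2N + 2, the square of the bound on F; an L² bound uniform in t
  -- replaces a dominating function.
  obtain ⟨B, hB⟩ := hS.exists_integral_pathMean_pow_le θ x (2 * N + 1)
  have hGsq : ∀ t, 0 < t → t ≤ 1 → Integrable (fun ω => (F t ω - c₀) ^ 2) P ∧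
      ∫ ω, (F t ω - c₀) ^ 2 ∂P ≤ 2 * C₄ ^ 2 * B + 2 * c₀ ^ 2 := by
    intro t ht ht1
    have hdom : Integrable (fun ω => 2 * C₄ ^ 2 * M t ω ^ (2 * N + 1 + 1) + 2 * c₀ ^ 2) P :=
      ((hB t ht).1.const_mul _).add (integrable_const _)
    have hle : ∀ᵐ ω ∂P, (F t ω - c₀) ^ 2 ≤ 2 * C₄ ^ 2 * M t ω ^ (2 * N + 1 + 1) + 2 * c₀ ^ 2 := by
      filter_upwards [hFb] with ω hω
      have h1 := sq_le_sq' (by linarith [neg_abs_le (F t ω), hω t ht ht1])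
        ((le_abs_self _).trans (hω t ht ht1))
      have e : (C₄ * M t ω ^ (N + 1)) ^ 2 = C₄ ^ 2 * M t ω ^ (2 * N + 1 + 1) := by ring
      rw [e] at h1
      nlinarith [sq_nonneg (F t ω + c₀)]
    refine ⟨hdom.mono' (((hFi t ht ht1).sub (integrable_const c₀)).1.pow 2) ?_, ?_⟩
    · filter_upwards [hle] with ω hω
      rwa [Real.norm_of_nonneg (sq_nonneg _)]
    · refine (integral_mono_of_nonneg (ae_of_all _ fun _ => sq_nonneg _) hdom hle).trans ?_
      rw [integral_add ((hB t ht).1.const_mul _) (integrable_const _), integral_const_mul]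
      simp only [integral_const, probReal_univ, one_smul]
      gcongr
      exact (hB t ht).2
  have hsmall : ∀ᶠ t : ℝ≥0 in 𝓝[>] 0, t ∈ Ioc 0 1 := Ioc_mem_nhdsGT zero_lt_one
  have hG := tendsto_integral_zero_of_sq_bounded (P := P) (l := 𝓝[>] (0 : ℝ≥0))
    (G := fun t ω => F t ω - c₀) (M := 2 * C₄ ^ 2 * B + 2 * c₀ ^ 2) ?_ ?_ ?_ ?_
  · have h1 : Tendsto (fun t => ∫ ω, F t ω ∂P) (𝓝[>] 0) (𝓝 c₀) := by
      have := hG.add_const c₀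
      rw [zero_add] at this
      refine this.congr' ?_
      filter_upwards [hsmall] with t ht
      rw [integral_sub (hFi t ht.1 ht.2) (integrable_const _)]
      simp
    obtain ⟨Cφ, Nφ, hφ⟩ := hψ.comp_mk_right x'
    refine (h1.add (hS.tendsto_heat hφ x)).congr' ?_
    filter_upwards [hsmall] with t ht
    rw [hF, integral_const_mul, integral_sub (hyi t ht.1 ht.2) (hqi t ht.1 ht.2)]
    ring
  · filter_upwards [hsmall] with t ht
    exact ((hFi t ht.1 ht.2).sub (integrable_const _)).1
  · filter_upwards [hsmall] with t ht
    exact (hGsq t ht.1 ht.2).1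
  · filter_upwards [hsmall] with t ht
    exact (hGsq t ht.1 ht.2).2
  · filter_upwards [hS.tendsto_increment θ x x', hS.path θ x, hS.path_tangent θ x x',
      hS.eval_zero θ x, hS.tangent_eval_zero θ x x', hS.noise.path] with ω h1 h2 h3 h4 h5 h6
    have hstrict : HasStrictFDerivAt ψ (fderiv ℝ ψ (x, x')) (x, x') :=
      hψ.contDiff.contDiffAt.hasStrictFDerivAt (by norm_num)
    have hcy : Continuous fun t : ℝ≥0 => y t ω := h2.1.prodMk h3.1
    have hcq : Continuous fun t : ℝ≥0 => q t ω :=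
      (continuous_const.add (h6.1.const_smul σ)).prodMk continuous_const
    have hy0 : Tendsto (fun t : ℝ≥0 => y t ω) (𝓝[>] 0) (𝓝 (x, x')) := by
      have := (hcy.tendsto 0).mono_left (nhdsWithin_le_nhds (s := Ioi 0))
      rwa [show y 0 ω = (x, x') from Prod.ext h4 h5] at this
    have hq0 : Tendsto (fun t : ℝ≥0 => q t ω) (𝓝[>] 0) (𝓝 (x, x')) := by
      have := (hcq.tendsto 0).mono_left (nhdsWithin_le_nhds (s := Ioi 0))
      rwa [show q 0 ω = (x, x') from by simp [hq, h6.2]] at this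
    have := (tendsto_smul_sub_of_hasStrictFDerivAt hstrict hy0 hq0 h1).sub_const c₀
    rwa [sub_self] at this

end OUSystem

end GeneratorLimit

/-! ### Evolution of laws: Chapman-Kolmogorov, invariance and uniqueness. -/

section Evolution

variable {H : Type} [NormedAddCommGroup H] [InnerProductSpace ℝ H] [FiniteDimensional ℝ H]
  [MeasurableSpace H] [BorelSpace H]

/-- The law at time `t` of the process with initial law `μ`. -/
def evolve (K σ : ℝ) (A : H →L[ℝ] H) (a : H) (t : ℝ) (μ : Measure H) : Measure H :=
  μ.map (flow A t) ∗ gaussianOf (ouMean K A a 0 t, covRoot K σ A t)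

variable {K ρ σ : ℝ} {A : H →L[ℝ] H} {a : H} {t : ℝ} {μ : Measure H}

lemma ouMean_eq (K : ℝ) (A : H →L[ℝ] H) (a x : H) (t : ℝ) :
    ouMean K A a x t = flow A t x + ouMean K A a 0 t := by
  unfold ouMean
  rw [map_sub, zero_sub, map_neg]
  abel

lemma charFun_evolve [IsProbabilityMeasure μ] (hA : IsStable K ρ A) (ξ : H) :
    charFun (evolve K σ A a t μ) ξ = charFun μ (flow A t ξ) *
      (Complex.exp ((inner ℝ ξ (ouMean K A a 0 t) : ℝ) * Complex.I) *
        Complex.exp ((-‖covRoot K σ A t ξ‖ ^ 2 / 2 : ℝ))) := by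
  have hm : Measurable (flow A t) := (flow A t).continuous.measurable
  have : IsProbabilityMeasure (μ.map (flow A t)) := Measure.isProbabilityMeasure_map hm.aemeasurable
  rw [evolve, charFun_conv, charFun_gaussianOf (a := (ouMean K A a 0 t, covRoot K σ A t))
    (hA.selfAdjoint_covRoot t), charFun_apply, integral_map hm.aemeasurable (by fun_prop),
    charFun_apply]
  congr 2
  ext y
  rw [← ContinuousLinearMap.adjoint_inner_right, (isSelfAdjoint_flow hA.symm t).adjoint_eq]

/-- The Chapman-Kolmogorov equation. -/
lemma evolve_gaussianOf (hA : IsStable K ρ A) {s t : ℝ} (hs : 0 < s) (ht : 0 < t) (x : H) :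
    evolve K σ A a s (gaussianOf (ouMean K A a x t, covRoot K σ A t)) =
      gaussianOf (ouMean K A a x (s + t), covRoot K σ A (s + t)) := by
  have hm : Measurable (flow A s) := (flow A s).continuous.measurable
  have : IsProbabilityMeasure ((gaussianOf (ouMean K A a x t, covRoot K σ A t)).map (flow A s)) :=
    Measure.isProbabilityMeasure_map hm.aemeasurable
  have : IsProbabilityMeasure (evolve K σ A a s (gaussianOf (ouMean K A a x t, covRoot K σ A t))) := by
    unfold evolve; infer_instance
  refine Measure.ext_of_charFun (funext fun ξ => ?_)
  rw [charFun_evolve hA, charFun_gaussianOf (a := (ouMean K A a x t, covRoot K σ A t))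
    (hA.selfAdjoint_covRoot t), charFun_gaussianOf
    (a := (ouMean K A a x (s + t), covRoot K σ A (s + t))) (hA.selfAdjoint_covRoot (s + t))]
  simp only
  rw [hA.norm_covRoot_add hs ht, ← Complex.exp_add, ← Complex.exp_add, ← Complex.exp_add,
    ← Complex.exp_add]
  congr 1
  have e : inner ℝ ξ (ouMean K A a x (s + t)) =
      inner ℝ (flow A s ξ) (ouMean K A a x t) + inner ℝ ξ (ouMean K A a 0 s) := by
    rw [← ContinuousLinearMap.adjoint_inner_right, (isSelfAdjoint_flow hA.symm s).adjoint_eq,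
      ← inner_add_right, ← ouMean_eq]
    congr 1
    unfold ouMean
    rw [flow_add, ContinuousLinearMap.mul_apply, add_sub_cancel_left]
  rw [e]
  push_cast
  ring

/-- The Gaussian measure with the limit parameters is invariant. -/
lemma evolve_gaussianOf_limit (hA : IsStable K ρ A) (ht : 0 < t) :
    evolve K σ A a t (gaussianOf (invOp K A a, statRoot K σ A)) =
      gaussianOf (invOp K A a, statRoot K σ A) := by
  have hm : Measurable (flow A t) := (flow A t).continuous.measurable
  have : IsProbabilityMeasure ((gaussianOf (invOp K A a, statRoot K σ A)).map (flow A t)) :=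
    Measure.isProbabilityMeasure_map hm.aemeasurable
  have : IsProbabilityMeasure (evolve K σ A a t (gaussianOf (invOp K A a, statRoot K σ A))) := by
    unfold evolve; infer_instance
  refine Measure.ext_of_charFun (funext fun ξ => ?_)
  rw [charFun_evolve hA, charFun_gaussianOf (a := (invOp K A a, statRoot K σ A))
    hA.selfAdjoint_statRoot, charFun_gaussianOf (a := (invOp K A a, statRoot K σ A))
    hA.selfAdjoint_statRoot, hA.norm_covRoot_sq ht]
  simp only
  simp only [← Complex.exp_add]
  congr 1
  have e : inner ℝ ξ (invOp K A a) =
      inner ℝ (flow A t ξ) (invOp K A a) + inner ℝ ξ (ouMean K A a 0 t) := by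
    rw [← ContinuousLinearMap.adjoint_inner_right, (isSelfAdjoint_flow hA.symm t).adjoint_eq,
      ← inner_add_right, ← ouMean_eq]
    congr 1
    unfold ouMean
    rw [sub_self, map_zero, add_zero]
  rw [e]
  push_cast
  ring

lemma tendsto_charFun_zero [IsProbabilityMeasure μ] {ξ : ℕ → H} (hξ : Tendsto ξ atTop (𝓝 0)) :
    Tendsto (fun n => charFun μ (ξ n)) atTop (𝓝 1) := by
  have h1 : (1 : ℂ) = ∫ _, 1 ∂μ := by simp
  rw [h1]
  simp only [charFun_apply]
  refine tendsto_integral_of_dominated_convergence (fun _ => 1) (fun n => by fun_prop)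
    (integrable_const _) (fun n => ae_of_all _ fun y => ?_) (ae_of_all _ fun y => ?_)
  · rw [Complex.norm_exp_ofReal_mul_I]
  · have : Continuous fun ξ : H => Complex.exp ((inner ℝ y ξ : ℝ) * Complex.I) := by fun_prop
    have := (this.tendsto 0).comp hξ
    simpa [Function.comp_def] using this

/-- The only invariant law is the Gaussian one. -/
lemma eq_gaussianOf_of_evolve_eq [IsProbabilityMeasure μ] (hA : IsStable K ρ A)
    (hlim : Tendsto (fun n : ℕ => flow A n) atTop (𝓝 0))
    (hμ : ∀ n : ℕ, 0 < n → evolve K σ A a n μ = μ) :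
    μ = gaussianOf (invOp K A a, statRoot K σ A) := by
  refine Measure.ext_of_charFun (funext fun ξ => ?_)
  rw [charFun_gaussianOf (a := (invOp K A a, statRoot K σ A)) hA.selfAdjoint_statRoot]
  have hξ : ∀ y : H, Tendsto (fun n : ℕ => flow A n y) atTop (𝓝 0) := fun y => by
    have := ((ContinuousLinearMap.apply ℝ H y).continuous.tendsto 0).comp hlim
    simpa [Function.comp_def] using this
  have h1 := tendsto_charFun_zero (μ := μ) (hξ ξ)
  have h2 : Tendsto (fun n : ℕ => ouMean K A a 0 n) atTop (𝓝 (invOp K A a)) := by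
    have := (hξ (0 - invOp K A a)).const_add (invOp K A a)
    rwa [add_zero] at this
  have h3 : Tendsto (fun n : ℕ => Complex.exp ((inner ℝ ξ (ouMean K A a 0 n) : ℝ) * Complex.I))
      atTop (𝓝 (Complex.exp ((inner ℝ ξ (invOp K A a) : ℝ) * Complex.I))) := by
    have : Continuous fun y : H => Complex.exp ((inner ℝ ξ y : ℝ) * Complex.I) := by fun_prop
    exact (this.tendsto _).comp h2
  have h4 : Tendsto (fun n : ℕ => Complex.exp
      ((-(‖statRoot K σ A ξ‖ ^ 2 - ‖statRoot K σ A (flow A n ξ)‖ ^ 2) / 2 : ℝ))) atTop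
      (𝓝 (Complex.exp ((-‖statRoot K σ A ξ‖ ^ 2 / 2 : ℝ)))) := by
    have : Continuous fun y : H => Complex.exp
      ((-(‖statRoot K σ A ξ‖ ^ 2 - ‖statRoot K σ A y‖ ^ 2) / 2 : ℝ)) := by fun_prop
    have := (this.tendsto 0).comp (hξ ξ)
    simpa [Function.comp_def] using this
  -- By invariance every such product with n ≥ 1 equals the characteristic function of μ at ξ, while
  -- in the limit the factor that depends on μ tends to 1.
  have h5 := h1.mul (h3.mul h4)
  rw [one_mul] at h5
  refine tendsto_nhds_unique (tendsto_const_nhds.congr' ?_) h5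
  filter_upwards [eventually_gt_atTop 0] with n hn
  have hn' : (0 : ℝ) < n := Nat.cast_pos.2 hn
  rw [← hA.norm_covRoot_sq hn', ← charFun_evolve hA, hμ n hn]

lemma PolyBdd.integrable_gaussianOf {n N : ℕ} {C : ℝ} {f : H → ℝ} (hf : PolyBdd n f C N)
    (b : H × (H →L[ℝ] H)) : Integrable f (gaussianOf b) := by
  rw [gaussianOf, integrable_map_measure hf.continuous.aestronglyMeasurable
    (measurable_affine b).aemeasurable]
  refine ((integrable_two_add_norm_pow_stdGaussian N).const_mul (C * (1 + ‖b‖) ^ N)).mono'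
    (hf.continuous.comp_aestronglyMeasurable (measurable_affine b).aestronglyMeasurable)
    (ae_of_all _ fun z => (hf.norm_le _).trans ?_)
  have hC := hf.nonneg
  rw [mul_assoc, ← mul_pow]
  gcongr
  have h1 : ‖b.1 + b.2 z‖ ≤ ‖b‖ + ‖b‖ * ‖z‖ := (norm_add_le _ _).trans
    (add_le_add (norm_fst_le b) ((b.2.le_opNorm z).trans (by gcongr; exact norm_snd_le b)))
  nlinarith [norm_nonneg b, norm_nonneg z]

lemma lintegral_evolve [IsProbabilityMeasure μ] {φ : H → ENNReal} (hφ : Measurable φ) :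
    ∫⁻ y, φ y ∂evolve K σ A a t μ =
      ∫⁻ y, ∫⁻ z, φ z ∂gaussianOf (ouMean K A a y t, covRoot K σ A t) ∂μ := by
  have hm : Measurable (flow A t) := (flow A t).continuous.measurable
  have : IsProbabilityMeasure (μ.map (flow A t)) := Measure.isProbabilityMeasure_map hm.aemeasurable
  rw [evolve, Measure.lintegral_conv hφ, lintegral_map _ hm]
  · refine lintegral_congr fun y => ?_
    rw [gaussianOf, gaussianOf, lintegral_map hφ (measurable_affine _),
      lintegral_map (by fun_prop) (measurable_affine _)]
    refine lintegral_congr fun z => ?_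
    rw [ouMean_eq K A a y, add_assoc]
  · exact Measurable.lintegral_prod_right (by fun_prop)

lemma integral_evolve [IsProbabilityMeasure μ] {f : H → ℝ}
    (hf : Integrable f (evolve K σ A a t μ)) (hfc : Continuous f) :
    ∫ y, f y ∂evolve K σ A a t μ =
      ∫ y, smear (stdGaussian H) f (ouMean K A a y t, covRoot K σ A t) ∂μ := by
  have hm : Measurable (flow A t) := (flow A t).continuous.measurable
  have : IsProbabilityMeasure (μ.map (flow A t)) := Measure.isProbabilityMeasure_map hm.aemeasurable
  have e : ∀ y, ∫ z, f (flow A t y + z) ∂gaussianOf (ouMean K A a 0 t, covRoot K σ A t) =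
      smear (stdGaussian H) f (ouMean K A a y t, covRoot K σ A t) := fun y => by
    rw [integral_gaussianOf _ (f := fun z => f (flow A t y + z)) (by fun_prop)]
    unfold smear
    simp only [ouMean_eq K A a y, add_assoc]
  rw [evolve, integral_conv hf, integral_map hm.aemeasurable]
  · simp only [e]
  · exact (hf.1.comp_measurable measurable_add).integral_prod_right'

end Evolution

/-! ### Semigroup identities for means and their directional derivatives. -/

section Markov

variable {H Θ : Type} [NormedAddCommGroup H] [InnerProductSpace ℝ H] [FiniteDimensional ℝ H]
  [MeasurableSpace H] [BorelSpace H] [NormedAddCommGroup Θ] [NormedSpace ℝ Θ]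
  [FiniteDimensional ℝ Θ]

/-- `E f(X_t)` as a function of the initial value and the parameter. -/
def transition (K σ : ℝ) (g : Θ → H) (h : Θ → H →L[ℝ] H) (f : H → ℝ) (t : ℝ≥0) (q : H × Θ) : ℝ :=
  smear (stdGaussian H) f
    (lawPair (ContinuousLinearMap.inl ℝ H (H →L[ℝ] H)) (limPair K σ g h) (diffPair K σ g h) h t q)

/-- The stationary mean of `f` as a function of the parameter. -/
def stationaryMean (K σ : ℝ) (g : Θ → H) (h : Θ → H →L[ℝ] H) (f : H → ℝ) (θ : Θ) : ℝ :=
  smear (stdGaussian H) f (limPair K σ g h θ)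

/-- `E ∇f(X_t) X'_t - ∇ π(f)`. -/
def gap (K σ : ℝ) (g : Θ → H) (h : Θ → H →L[ℝ] H) (f : H → ℝ) (t : ℝ≥0) (p : H × (Θ →L[ℝ] H))
    (θ : Θ) : Θ →L[ℝ] ℝ :=
  tangentGap (ContinuousLinearMap.inl ℝ H (H →L[ℝ] H)) (limPair K σ g h) (diffPair K σ g h) h
    (smear (stdGaussian H) f) t p θ

/-- The time integral of `gap`. -/
def gapPotential (K σ : ℝ) (g : Θ → H) (h : Θ → H →L[ℝ] H) (f : H → ℝ) (p : H × (Θ →L[ℝ] H))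
    (θ : Θ) : Θ →L[ℝ] ℝ :=
  ∫ t in Ioi (0 : ℝ), gap K σ g h f t.toNNReal p θ

lemma PolyBdd.exists_smear {f : H → ℝ} {n N : ℕ} {C : ℝ} (hf : PolyBdd n f C N) :
    ∃ C' N', PolyBdd n (smear (stdGaussian H) f) C' N' := by
  obtain ⟨C', h⟩ := smear_polyBdd integrable_two_add_norm_pow_stdGaussian hf
  exact ⟨C', _, h⟩

variable {K σ ρ : ℝ} {g : Θ → H} {h : Θ → H →L[ℝ] H} {D c : ℝ} {f : H → ℝ} {Cf : ℝ} {Nf : ℕ}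

lemma transition_eq (f : H → ℝ) (t : ℝ≥0) (q : H × Θ) : transition K σ g h f t q =
    smear (stdGaussian H) f (ouMean K (h q.2) (g q.2) q.1 t, covRoot K σ (h q.2) t) := by
  rw [transition, lawPair_eq]

lemma polyBdd_transition (hB : DecayingFamily (limPair K σ g h) (diffPair K σ g h) h D c)
    (hf : PolyBdd 3 f Cf Nf) (t : ℝ≥0) :
    ∃ C' N', PolyBdd 2 (transition K σ g h f t) C' N' := by
  obtain ⟨CΦ, NΦ, hΦ⟩ := hf.exists_smear
  have hfst := PolyBdd.clm (n := 2) (ContinuousLinearMap.fst ℝ H Θ)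
  have hsnd := PolyBdd.clm (n := 2) (ContinuousLinearMap.snd ℝ H Θ)
  have h1 := hB.polyBdd_lim.comp hsnd
  have h2 := (hB.polyBdd_diff t).comp hsnd
  have h3 := ((hB.polyBdd_flow t).comp hsnd).bilin (ContinuousLinearMap.id ℝ (H →L[ℝ] H)) hfst
  have h4 := h3.clm_comp (ContinuousLinearMap.inl ℝ H (H →L[ℝ] H))
  have h5 := ((h1.add h2).mono le_rfl (Nat.le_succ _)).add h4
  exact ⟨_, _, (hΦ.of_le (Nat.le_succ 2)).comp h5⟩

variable {Ω : Type*} [MeasurableSpace Ω] {P : Measure Ω} [IsProbabilityMeasure P]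
  {W : ℝ≥0 → Ω → H} {L : ℝ}
  {X : Θ → H → ℝ≥0 → Ω → H} {X' : Θ → H → (Θ →L[ℝ] H) → ℝ≥0 → Ω → (Θ →L[ℝ] H)}

namespace OUSystem

lemma integral_eq_transition (hS : OUSystem P W g h σ K ρ L X X') (hf : Continuous f) (θ : Θ) (x : H)
    {t : ℝ≥0} (ht : 0 < t) : ∫ ω, f (X θ x t ω) ∂P = transition K σ g h f t (x, θ) := by
  rw [transition_eq, ← integral_gaussianOf _ hf, ← hS.map_eq θ x ht,
    integral_map (hS.measurable θ x t).aemeasurable hf.aestronglyMeasurable]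

/-- The Markov property. -/
lemma integral_transition (hS : OUSystem P W g h σ K ρ L X X') 
    (hB : DecayingFamily (limPair K σ g h) (diffPair K σ g h) h D c) (hf : PolyBdd 3 f Cf Nf)
    (θ : Θ) (x : H) {s t : ℝ≥0} (hs : 0 < s) (ht : 0 < t) :
    ∫ ω, transition K σ g h f s (X θ x t ω, θ) ∂P = transition K σ g h f (s + t) (x, θ) := by
  obtain ⟨_, _, hT⟩ := polyBdd_transition hB hf s
  have hc : Continuous fun y => transition K σ g h f s (y, θ) := hT.continuous.comp (by fun_prop)
  have h1 := integral_map (hS.measurable θ x t).aemeasurable (μ := P)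
    (f := fun y => transition K σ g h f s (y, θ)) hc.aestronglyMeasurable
  -- Only one-time laws enter: the law of X_t is Gaussian, and evolving it by s gives the law at s +
  -- t.
  have h2 := evolve_gaussianOf (σ := σ) (a := g θ) (hS.stable θ) (NNReal.coe_pos.2 hs)
    (NNReal.coe_pos.2 ht) x
  have h3 := integral_evolve (K := K) (σ := σ) (A := h θ) (a := g θ) (t := s) (f := f)
    (μ := gaussianOf (ouMean K (h θ) (g θ) x t, covRoot K σ (h θ) t))
    (by rw [h2]; exact hf.integrable_gaussianOf _) hf.continuous
  rw [← h1, hS.map_eq θ x ht]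
  simp only [transition_eq]
  rw [← h3, h2, integral_gaussianOf _ hf.continuous, NNReal.coe_add]

/-- Differentiate the semigroup identity for X in (x, θ) along (x̃η, η). Differentiating under the
expectation yields the mean of the transition derivative at (X_t, X'_t); the right side is the
derivative at time s + t. The pair thus obeys a semigroup identity without any Markov property of
its own. -/
lemma integral_gap (hS : OUSystem P W g h σ K ρ L X X')
    (hB : DecayingFamily (limPair K σ g h) (diffPair K σ g h) h D c) (hf : PolyBdd 3 f Cf Nf)
    (θ : Θ) (x : H) (x' : Θ →L[ℝ] H) (η : Θ) {s t : ℝ≥0} (hs : 0 < s) (ht : 0 < t) :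
    Integrable (fun ω => gap K σ g h f s (X θ x t ω, X' θ x x' t ω) θ η) P ∧
      ∫ ω, gap K σ g h f s (X θ x t ω, X' θ x x' t ω) θ η ∂P =
        gap K σ g h f (s + t) (x, x') θ η := by
  obtain ⟨_, _, hT⟩ := polyBdd_transition hB hf s
  obtain ⟨_, _, hT'⟩ := polyBdd_transition hB hf (s + t)
  obtain ⟨_, _, hΦ⟩ := hf.exists_smear
  have hΦ' : Differentiable ℝ (smear (stdGaussian H) f) := hΦ.differentiable (by norm_num)
  have hκ : HasFDerivAt (fun q : H × Θ => ∫ ω, transition K σ g h f s (X q.2 q.1 t ω, q.2) ∂P)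
      (fderiv ℝ (transition K σ g h f (s + t)) (x, θ)) (x, θ) := by
    refine (hT'.hasFDerivAt one_le_two (x, θ)).congr_of_eventuallyEq (Eventually.of_forall fun q => ?_)
    exact hS.integral_transition hB hf q.2 q.1 hs ht
  obtain ⟨h1, h2⟩ := hS.integral_fderiv_tangent (hT.of_le one_le_two) hκ x' η
  have e : ∀ (r : ℝ≥0) p, gap K σ g h f r p θ η = fderiv ℝ (transition K σ g h f r) (p.1, θ) (p.2 η, η) -
      fderiv ℝ (stationaryMean K σ g h f) θ η := fun r p => hB.tangentGap_apply hΦ' r p θ η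
  simp only [e]
  refine ⟨h1.sub (integrable_const _), ?_⟩
  rw [integral_sub h1 (integrable_const _), h2]
  simp

/-- Both sides are the derivative of E f(X_t) along (x̃η, η): once inside the expectation, along
paths, and once through the Gaussian parameters. -/
lemma integral_observable (hS : OUSystem P W g h σ K ρ L X X')
    (hB : DecayingFamily (limPair K σ g h) (diffPair K σ g h) h D c) (hf : PolyBdd 3 f Cf Nf)
    (θ : Θ) (x : H) (x' : Θ →L[ℝ] H) (η : Θ) {t : ℝ≥0} (ht : 0 < t) :
    Integrable (fun ω => fderiv ℝ f (X θ x t ω) (X' θ x x' t ω η)) P ∧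
      ∫ ω, fderiv ℝ f (X θ x t ω) (X' θ x x' t ω η) ∂P =
        gap K σ g h f t (x, x') θ η + fderiv ℝ (stationaryMean K σ g h f) θ η := by
  obtain ⟨_, _, hT⟩ := polyBdd_transition hB hf t
  obtain ⟨_, _, hΦ⟩ := hf.exists_smear
  have hΦ' : Differentiable ℝ (smear (stdGaussian H) f) := hΦ.differentiable (by norm_num)
  have hk := (hf.of_le (by norm_num : 1 ≤ 3)).comp (PolyBdd.clm (ContinuousLinearMap.fst ℝ H Θ))
  have hκ : HasFDerivAt (fun q : H × Θ => ∫ ω, f (X q.2 q.1 t ω) ∂P)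
      (fderiv ℝ (transition K σ g h f t) (x, θ)) (x, θ) := by
    refine (hT.hasFDerivAt one_le_two (x, θ)).congr_of_eventuallyEq (Eventually.of_forall fun q => ?_)
    exact hS.integral_eq_transition hf.continuous q.2 q.1 ht
  have key := hS.integral_fderiv_tangent hk hκ x' η
  have e : ∀ (y : H) (v : H), fderiv ℝ (fun q : H × Θ => f (ContinuousLinearMap.fst ℝ H Θ q)) (y, θ)
      (v, η) = fderiv ℝ f y v := fun y v => by
    have h1 : HasFDerivAt (fun q : H × Θ => f (ContinuousLinearMap.fst ℝ H Θ q))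
        ((fderiv ℝ f y).comp (ContinuousLinearMap.fst ℝ H Θ)) (y, θ) :=
      (hf.hasFDerivAt (by norm_num) y).comp (y, θ) (ContinuousLinearMap.fst ℝ H Θ).hasFDerivAt
    rw [h1.fderiv]
    rfl
  have e2 : gap K σ g h f t (x, x') θ η = fderiv ℝ (transition K σ g h f t) (x, θ) (x' η, η) -
      fderiv ℝ (stationaryMean K σ g h f) θ η := hB.tangentGap_apply hΦ' t (x, x') θ η
  rw [e2, sub_add_cancel]
  simpa only [e] using key

end OUSystem

end Markov

/-! ### The Poisson equation for the time integral of the gap. -/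

section Poisson

variable {H Θ : Type} [NormedAddCommGroup H] [InnerProductSpace ℝ H] [FiniteDimensional ℝ H]
  [MeasurableSpace H] [BorelSpace H] [NormedAddCommGroup Θ] [NormedSpace ℝ Θ]
  [FiniteDimensional ℝ Θ]

lemma setIntegral_Ioi_comp_add (k : ℝ → ℝ) (t : ℝ) :
    ∫ s in Ioi 0, k (s + t) = ∫ s in Ioi t, k s := by
  have := (measurePreserving_add_right volume t).setIntegral_preimage_emb
    (measurableEmbedding_addRight t) k (Ioi t)
  rw [← this]
  congr 2
  ext s
  simp

variable {K σ ρ : ℝ} {g : Θ → H} {h : Θ → H →L[ℝ] H} {D c : ℝ} {f : H → ℝ} {Cf : ℝ} {Nf : ℕ}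

lemma exists_polyBdd_gap (hB : DecayingFamily (limPair K σ g h) (diffPair K σ g h) h D c)
    (hf : PolyBdd 3 f Cf Nf) : ∃ (C : ℝ) (N : ℕ),
      ∀ t θ, PolyBdd 2 (fun p => gap K σ g h f t p θ) (C * Real.exp (-(c * t))) N := by
  obtain ⟨_, _, hΦ⟩ := hf.exists_smear
  obtain ⟨C', N', h1, -⟩ := hB.polyBdd_tangentGap (ι := ContinuousLinearMap.inl ℝ H (H →L[ℝ] H)) hΦ
  exact ⟨C', N', h1⟩

lemma measurable_gap (hB : DecayingFamily (limPair K σ g h) (diffPair K σ g h) h D c)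
    (hf : PolyBdd 3 f Cf Nf) (p : H × (Θ →L[ℝ] H)) (θ : Θ) :
    StronglyMeasurable fun t : ℝ => gap K σ g h f t.toNNReal p θ := by
  obtain ⟨_, _, hΦ⟩ := hf.exists_smear
  exact (hB.stronglyMeasurable_tangentGap hΦ p θ).comp_measurable measurable_real_toNNReal

lemma integrableOn_gap (hB : DecayingFamily (limPair K σ g h) (diffPair K σ g h) h D c)
    (hf : PolyBdd 3 f Cf Nf) (p : H × (Θ →L[ℝ] H)) (θ : Θ) :
    IntegrableOn (fun t : ℝ => gap K σ g h f t.toNNReal p θ) (Ioi 0) := by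
  obtain ⟨C, N, hb⟩ := exists_polyBdd_gap hB hf
  refine ((integrableOn_exp_toNNReal hB.rate_pos C).mul_const ((1 + ‖p‖) ^ N)).mono'
    (measurable_gap hB hf p θ).aestronglyMeasurable (ae_of_all _ fun t => (hb _ θ).norm_le p)

lemma gapPotential_apply (hB : DecayingFamily (limPair K σ g h) (diffPair K σ g h) h D c)
    (hf : PolyBdd 3 f Cf Nf) (p : H × (Θ →L[ℝ] H)) (θ η : Θ) :
    gapPotential K σ g h f p θ η = ∫ t in Ioi (0 : ℝ), gap K σ g h f t.toNNReal p θ η :=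
  ContinuousLinearMap.integral_apply (integrableOn_gap hB hf p θ) η

lemma polyBdd_gapPotential (hB : DecayingFamily (limPair K σ g h) (diffPair K σ g h) h D c)
    (hf : PolyBdd 3 f Cf Nf) :
    ∃ C' N', (∀ θ, PolyBdd 2 (fun p => gapPotential K σ g h f p θ) C' N') ∧
      ∀ p, PolyBdd 1 (fun θ => gapPotential K σ g h f p θ) (C' * (1 + ‖p‖) ^ N') 0 := by
  obtain ⟨_, _, hΦ⟩ := hf.exists_smear
  exact hB.polyBdd_potential hΦ

/-- The pairing of the derivative with the tangent is polynomially bounded. -/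
lemma PolyBdd.exists_pairing (hf : PolyBdd 3 f Cf Nf) (η : Θ) :
    ∃ C N, PolyBdd 2 (fun p : H × (Θ →L[ℝ] H) => fderiv ℝ f p.1 (p.2 η)) C N := by
  have h1 := hf.fderiv.comp (PolyBdd.clm (n := 2) (ContinuousLinearMap.fst ℝ H (Θ →L[ℝ] H)))
  have h2 := PolyBdd.clm (n := 2) ((ContinuousLinearMap.apply ℝ H η).comp
    (ContinuousLinearMap.snd ℝ H (Θ →L[ℝ] H)))
  exact ⟨_, _, h1.bilin (ContinuousLinearMap.id ℝ (H →L[ℝ] ℝ)) h2⟩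

variable {Ω : Type*} [MeasurableSpace Ω] {P : Measure Ω} [IsProbabilityMeasure P]
  {W : ℝ≥0 → Ω → H} {L : ℝ}
  {X : Θ → H → ℝ≥0 → Ω → H} {X' : Θ → H → (Θ →L[ℝ] H) → ℝ≥0 → Ω → (Θ →L[ℝ] H)}

namespace OUSystem

lemma aestronglyMeasurable_pair (hS : OUSystem P W g h σ K ρ L X X') (θ : Θ) (x : H)
    (x' : Θ →L[ℝ] H) (t : ℝ≥0) :
    AEStronglyMeasurable (fun ω => (X θ x t ω, X' θ x x' t ω)) P :=
  (hS.measurable θ x t).aestronglyMeasurable.prodMk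
    (hS.measurable_tangent θ x x' t).aestronglyMeasurable

lemma integrable_one_add_norm_pair_pow (hS : OUSystem P W g h σ K ρ L X X') (θ : Θ) (x : H)
    (x' : Θ →L[ℝ] H) (t : ℝ≥0) (N : ℕ) :
    Integrable (fun ω => (1 + ‖(X θ x t ω, X' θ x x' t ω)‖) ^ N) P := by
  have hL := hS.nonneg
  refine hS.integrable_of_norm_le_pathMass (θ := θ) (x := x) (t := t)
    (C := (2 + ‖x'‖ + L * t + L) ^ N) (N := N)
    ((aestronglyMeasurable_const.add (hS.aestronglyMeasurable_pair θ x x' t).norm).pow N) ?_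
  filter_upwards [hS.norm_tangent_le θ x x'] with ω hω
  have h1 := one_le_pathMass (X θ x) t ω
  have h2 := norm_eval_le_pathMass (X θ x) t ω
  have h3 := integral_le_pathMass (X θ x) t ω
  have h4 := hω t
  set J := pathMass (X θ x) t ω
  set I := ∫ s in (0 : ℝ)..t, ‖X θ x s.toNNReal ω‖
  rw [Real.norm_of_nonneg (by positivity), ← mul_pow]
  have h5 : ‖X' θ x x' t ω‖ ≤ (‖x'‖ + L * t + L) * J := by
    refine h4.trans ?_
    have e1 : ‖x'‖ ≤ ‖x'‖ * J := le_mul_of_one_le_right (norm_nonneg _) h1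
    have e2 : L * t ≤ L * t * J := le_mul_of_one_le_right (by positivity) h1
    have e3 : L * I ≤ L * J := by gcongr
    linarith
  have h6 : ‖(X θ x t ω, X' θ x x' t ω)‖ ≤ J + (‖x'‖ + L * t + L) * J :=
    max_le (h2.trans (le_add_of_nonneg_right (by positivity)))
      (h5.trans (le_add_of_nonneg_left (by positivity)))
  gcongr
  linarith

lemma integrable_pair (hS : OUSystem P W g h σ K ρ L X X') {F : Type*} [NormedAddCommGroup F]
    [NormedSpace ℝ F] {ψ : H × (Θ →L[ℝ] H) → F} {n N : ℕ} {C : ℝ} (hψ : PolyBdd n ψ C N) (θ : Θ) (x : H) (x' : Θ →L[ℝ] H) (t : ℝ≥0) :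
    Integrable (fun ω => ψ (X θ x t ω, X' θ x x' t ω)) P :=
  ((hS.integrable_one_add_norm_pair_pow θ x x' t N).const_mul C).mono'
    (hψ.continuous.comp_aestronglyMeasurable (hS.aestronglyMeasurable_pair θ x x' t))
    (ae_of_all _ fun _ => hψ.norm_le _)

/-- Fubini and the semigroup identity shift the time integral by t, so exactly the piece over (0, t]
is lost. -/
lemma integral_gapPotential (hS : OUSystem P W g h σ K ρ L X X')
    (hB : DecayingFamily (limPair K σ g h) (diffPair K σ g h) h D c) (hf : PolyBdd 3 f Cf Nf)
    (θ : Θ) (x : H) (x' : Θ →L[ℝ] H) (η : Θ) {t : ℝ≥0} (ht : 0 < t) :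
    ∫ ω, gapPotential K σ g h f (X θ x t ω, X' θ x x' t ω) θ η ∂P =
      gapPotential K σ g h f (x, x') θ η -
        ∫ s in (0 : ℝ)..t, gap K σ g h f s.toNNReal (x, x') θ η := by
  obtain ⟨C, N, hb⟩ := exists_polyBdd_gap hB hf
  have hjoint : StronglyMeasurable (Function.uncurry fun (p : H × (Θ →L[ℝ] H)) (s : ℝ) =>
      gap K σ g h f s.toNNReal p θ η) :=
    stronglyMeasurable_uncurry_of_continuous_of_stronglyMeasurable
      (fun s => ((hb s.toNNReal θ).continuous.clm_apply continuous_const))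
      fun p => (ContinuousLinearMap.apply ℝ ℝ η).continuous.comp_stronglyMeasurable
        (measurable_gap hB hf p θ)
  have hprod : AEStronglyMeasurable (Function.uncurry fun (ω : Ω) (s : ℝ) =>
      gap K σ g h f s.toNNReal (X θ x t ω, X' θ x x' t ω) θ η) (P.prod (volume.restrict (Ioi 0))) := by
    have hYm : Measurable fun q : Ω × ℝ => ((X θ x t q.1, X' θ x x' t q.1), q.2) :=
      (((hS.measurable θ x t).prodMk (hS.measurable_tangent θ x x' t)).comp measurable_fst).prodMk
        measurable_snd
    exact (hjoint.comp_measurable hYm).aestronglyMeasurable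
  have hint : Integrable (Function.uncurry fun (ω : Ω) (s : ℝ) =>
      gap K σ g h f s.toNNReal (X θ x t ω, X' θ x x' t ω) θ η) (P.prod (volume.restrict (Ioi 0))) := by
    have hdom := ((hS.integrable_one_add_norm_pair_pow θ x x' t N).mul_prod
      ((integrableOn_exp_toNNReal hB.rate_pos C).mul_const ‖η‖))
    refine hdom.mono' hprod (ae_of_all _ fun q => ?_)
    refine (ContinuousLinearMap.le_opNorm _ _).trans ?_
    refine (mul_le_mul_of_nonneg_right ((hb _ θ).norm_le _) (norm_nonneg _)).trans (le_of_eq ?_)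
    ring
  have hk : IntegrableOn (fun s : ℝ => gap K σ g h f s.toNNReal (x, x') θ η) (Ioi 0) :=
    (integrableOn_gap hB hf (x, x') θ).apply_continuousLinearMap η
  simp only [gapPotential_apply hB hf]
  rw [integral_integral_swap hint]
  -- The semigroup identity holds for s > 0, hence at all times of the integral.
  have e1 : ∀ s ∈ Ioi (0 : ℝ),
      ∫ ω, gap K σ g h f s.toNNReal (X θ x t ω, X' θ x x' t ω) θ η ∂P =
        gap K σ g h f (s + t).toNNReal (x, x') θ η := by
    intro s hs
    rw [(hS.integral_gap hB hf θ x x' η (Real.toNNReal_pos.2 hs) ht).2,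
      Real.toNNReal_add (le_of_lt hs) t.coe_nonneg, Real.toNNReal_coe]
  rw [setIntegral_congr_fun measurableSet_Ioi e1,
    setIntegral_Ioi_comp_add fun s => gap K σ g h f s.toNNReal (x, x') θ η,
    ← intervalIntegral.integral_Ioi_sub_Ioi hk t.coe_nonneg, sub_sub_cancel]

/-- For t > 0 the gap plus a constant is the mean of Df(X_t) X'_t η. Since the generator limit of
this function exists, its mean tends to the initial value. -/
lemma tendsto_gap (hS : OUSystem P W g h σ K ρ L X X')
    (hB : DecayingFamily (limPair K σ g h) (diffPair K σ g h) h D c) (hf : PolyBdd 3 f Cf Nf)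
    (θ : Θ) (x : H) (x' : Θ →L[ℝ] H) (η : Θ) :
    Tendsto (fun t => gap K σ g h f t (x, x') θ η) (𝓝[>] 0)
      (𝓝 (fderiv ℝ f x (x' η) - fderiv ℝ (stationaryMean K σ g h f) θ η)) := by
  obtain ⟨_, _, hψ⟩ := hf.exists_pairing η
  have h1 := hS.tendsto_generator hψ θ x x'
  have h2 : Tendsto (fun t : ℝ≥0 => (t : ℝ)) (𝓝[>] 0) (𝓝 0) :=
    (NNReal.continuous_coe.tendsto 0).mono_left nhdsWithin_le_nhds
  have h3 := ((h2.mul h1).add_const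
    (fderiv ℝ f x (x' η))).sub_const (fderiv ℝ (stationaryMean K σ g h f) θ η)
  rw [zero_mul, zero_add] at h3
  refine h3.congr' ?_
  filter_upwards [self_mem_nhdsWithin] with t ht
  have ht' : (t : ℝ) ≠ 0 := (NNReal.coe_pos.2 ht).ne'
  rw [mul_inv_cancel_left₀ ht', sub_add_cancel, (hS.integral_observable hB hf θ x x' η ht).2,
    add_sub_cancel_right]

/-- The potential solves the Poisson equation. -/
theorem poisson_gapPotential (hS : OUSystem P W g h σ K ρ L X X')
    (hB : DecayingFamily (limPair K σ g h) (diffPair K σ g h) h D c) (hf : PolyBdd 3 f Cf Nf)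
    (θ : Θ) (x : H) (x' : Θ →L[ℝ] H) (η : Θ) :
    fderiv ℝ (fun p => gapPotential K σ g h f p θ η) (x, x') (pairDrift g h θ (x, x')) +
        σ ^ 2 / 2 * Δ (fun y => gapPotential K σ g h f (y, x') θ η) x =
      -(fderiv ℝ f x (x' η) - fderiv ℝ (stationaryMean K σ g h f) θ η) := by
  obtain ⟨C', N', hU, -⟩ := polyBdd_gapPotential hB hf
  have hUη := (hU θ).clm_comp (ContinuousLinearMap.apply ℝ ℝ η)
  have h1 := hS.tendsto_generator hUη θ x x'
  refine tendsto_nhds_unique h1 ?_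
  have hk : IntegrableOn (fun s : ℝ => gap K σ g h f s.toNNReal (x, x') θ η) (Ioi 0) :=
    (integrableOn_gap hB hf (x, x') θ).apply_continuousLinearMap η
  have hlim : Tendsto (fun s : ℝ => gap K σ g h f s.toNNReal (x, x') θ η) (𝓝[>] 0)
      (𝓝 (fderiv ℝ f x (x' η) - fderiv ℝ (stationaryMean K σ g h f) θ η)) := by
    refine (hS.tendsto_gap hB hf θ x x' η).comp (tendsto_nhdsWithin_iff.2 ⟨?_, ?_⟩)
    · have := (continuous_real_toNNReal.tendsto 0).mono_left (nhdsWithin_le_nhds (s := Ioi 0))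
      rwa [Real.toNNReal_zero] at this
    · filter_upwards [self_mem_nhdsWithin] with s hs using Real.toNNReal_pos.2 hs
  have hmeas : StronglyMeasurable fun s : ℝ => gap K σ g h f s.toNNReal (x, x') θ η :=
    (ContinuousLinearMap.apply ℝ ℝ η).continuous.comp_stronglyMeasurable
        (measurable_gap hB hf (x, x') θ)
  -- One-sided derivative at 0 from the right limit of the integrand; the value of the gap at time 0
  -- itself is irrelevant.
  have hder : HasDerivWithinAt
      (fun t : ℝ => ∫ s in (0 : ℝ)..t, gap K σ g h f s.toNNReal (x, x') θ η)
      (fderiv ℝ f x (x' η) - fderiv ℝ (stationaryMean K σ g h f) θ η) (Ici 0) 0 :=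
    intervalIntegral.integral_hasDerivWithinAt_of_tendsto_ae_right (t := Ioi 0)
      IntervalIntegrable.refl hmeas.stronglyMeasurableAtFilter (hlim.mono_left inf_le_left)
  have hcoe : Tendsto (fun t : ℝ≥0 => (t : ℝ)) (𝓝[>] 0) (𝓝[>] 0) := by
    refine tendsto_nhdsWithin_iff.2 ⟨(NNReal.continuous_coe.tendsto 0).mono_left
      nhdsWithin_le_nhds, ?_⟩
    filter_upwards [self_mem_nhdsWithin] with t ht using NNReal.coe_pos.2 ht
  have hslope := (hasDerivWithinAt_iff_tendsto_slope' self_notMem_Ioi).1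
    (hder.mono Ioi_subset_Ici_self)
  refine ((hslope.comp hcoe).neg).congr' ?_
  filter_upwards [self_mem_nhdsWithin] with t ht
  have key := hS.integral_gapPotential hB hf θ x x' η ht
  simp only [ContinuousLinearMap.apply_apply, Function.comp_apply, slope_def_field,
    intervalIntegral.integral_same, sub_zero]
  rw [key]
  ring

end OUSystem

end Poisson

/-! ### Slices, test functions, and the stationary distribution. -/

section Stationary

variable {H Θ : Type} [NormedAddCommGroup H] [InnerProductSpace ℝ H] [FiniteDimensional ℝ H]
  [MeasurableSpace H] [BorelSpace H] [NormedAddCommGroup Θ] [NormedSpace ℝ Θ]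
  [FiniteDimensional ℝ Θ]

lemma iteratedFDeriv_comp_mk_right {E F G : Type*} [NormedAddCommGroup E] [NormedSpace ℝ E]
    [NormedAddCommGroup F] [NormedSpace ℝ F] [NormedAddCommGroup G] [NormedSpace ℝ G] {n : ℕ}
    {U : E × F → G} (hU : ContDiff ℝ n U) (a : E) (b : F) :
    iteratedFDeriv ℝ n (fun x => U (x, b)) a =
      (iteratedFDeriv ℝ n U (a, b)).compContinuousLinearMap
        fun _ => ContinuousLinearMap.inl ℝ E F := by
  have h1 : ContDiff ℝ n fun q : E × F => U (q + (0, b)) := hU.comp (by fun_prop)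
  have h2 := (ContinuousLinearMap.inl ℝ E F).iteratedFDeriv_comp_right h1 a le_rfl
  have e : (fun q : E × F => U (q + (0, b))) ∘ (ContinuousLinearMap.inl ℝ E F) =
      fun x => U (x, b) := by
    ext x; simp
  rw [e, iteratedFDeriv_comp_add_right] at h2
  simpa using h2

lemma continuous_iteratedFDeriv_comp_mk_right {E F G : Type*} [NormedAddCommGroup E]
    [NormedSpace ℝ E] [NormedAddCommGroup F] [NormedSpace ℝ F] [NormedAddCommGroup G]
    [NormedSpace ℝ G] {n : ℕ} {U : E × F → G} (hU : ContDiff ℝ n U) :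
    Continuous fun p : E × F => iteratedFDeriv ℝ n (fun x => U (x, p.2)) p.1 := by
  have h1 : Continuous fun p : E × F => iteratedFDeriv ℝ n U p := hU.continuous_iteratedFDeriv le_rfl
  have h2 := (ContinuousMultilinearMap.compContinuousLinearMapL (𝕜 := ℝ) (E := fun _ : Fin n => E) (E₁ := fun _ : Fin n => E × F) (F := G)
    fun _ : Fin n => ContinuousLinearMap.inl ℝ E F).continuous.comp h1
  refine h2.congr fun p => ?_
  rw [iteratedFDeriv_comp_mk_right hU]
  rfl

lemma HasCompactSupport.exists_polyBdd {E F : Type*} [NormedAddCommGroup E] [NormedSpace ℝ E]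
    [NormedAddCommGroup F] [NormedSpace ℝ F] {n : ℕ} {φ : E → F} (hφ : ContDiff ℝ n φ)
    (hc : HasCompactSupport φ) : ∃ C, PolyBdd n φ C 0 := by
  have h1 : ∀ i : ℕ, i ≤ n → ∃ C, ∀ x, ‖iteratedFDeriv ℝ i φ x‖ ≤ C := fun i hi =>
    (hφ.continuous_iteratedFDeriv (by exact_mod_cast hi)).bounded_above_of_compact_support
      (hc.iteratedFDeriv i)
  choose! C hC using h1
  refine ⟨∑ i ∈ Finset.range (n + 1), C i, hφ, fun i hi x => ?_⟩
  rw [pow_zero, mul_one]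
  refine (hC i hi x).trans (Finset.single_le_sum (f := C) (fun j hj => ?_)
    (Finset.mem_range.2 (Nat.lt_succ_of_le hi)))
  exact (norm_nonneg _).trans (hC j (Nat.le_of_lt_succ (Finset.mem_range.1 hj)) 0)

variable {K σ ρ : ℝ} {g : Θ → H} {h : Θ → H →L[ℝ] H} {D c : ℝ}
  {Ω : Type*} [MeasurableSpace Ω] {P : Measure Ω} [IsProbabilityMeasure P]
  {W : ℝ≥0 → Ω → H} {L : ℝ}
  {X : Θ → H → ℝ≥0 → Ω → H} {X' : Θ → H → (Θ →L[ℝ] H) → ℝ≥0 → Ω → (Θ →L[ℝ] H)}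

lemma DecayingFamily.tendsto_flow {V : Type} [NormedAddCommGroup V] [NormedSpace ℝ V]
    {lim : Θ → V} {diff : ℝ≥0 → Θ → V} (hB : DecayingFamily lim diff h D c) (θ : Θ) :
    Tendsto (fun n : ℕ => flow (h θ) n) atTop (𝓝 0) := by
  have h1 : Tendsto (fun n : ℕ => D * Real.exp (-(c * n))) atTop (𝓝 (D * 0)) := by
    refine (Real.tendsto_exp_neg_atTop_nhds_zero.comp ?_).const_mul D
    exact tendsto_natCast_atTop_atTop.const_mul_atTop hB.rate_pos
  rw [mul_zero] at h1
  refine squeeze_zero_norm (fun n => ?_) h1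
  have := (hB.polyBdd_flow n).norm_le θ
  simpa using this

namespace OUSystem

lemma lintegral_prob_eq (hS : OUSystem P W g h σ K ρ L X X') (θ : Θ) {t : ℝ≥0} (ht : 0 < t)
    {A : Set H} (hA : MeasurableSet A) (μ : Measure H) [IsProbabilityMeasure μ] :
    ∫⁻ x, P {ω | X θ x t ω ∈ A} ∂μ = evolve K σ (h θ) (g θ) t μ A := by
  have h1 := lintegral_evolve (K := K) (σ := σ) (A := h θ) (a := g θ) (t := t) (μ := μ)
    (measurable_one.indicator hA)
  rw [lintegral_indicator_one hA] at h1
  rw [h1]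
  refine lintegral_congr fun x => ?_
  rw [lintegral_indicator_one hA, ← hS.map_eq θ x ht, Measure.map_apply (hS.measurable θ x t) hA]
  rfl

/-- Time 0 is treated separately, since the Gaussian formula is established only for t > 0. -/
lemma lintegral_prob_zero (hS : OUSystem P W g h σ K ρ L X X') (θ : Θ) {A : Set H}
    (hA : MeasurableSet A) (μ : Measure H) : ∫⁻ x, P {ω | X θ x 0 ω ∈ A} ∂μ = μ A := by
  rw [← lintegral_indicator_one hA]
  refine lintegral_congr fun x => ?_
  have h1 : P {ω | X θ x 0 ω ∈ A} = P {_ω | x ∈ A} := by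
    refine measure_congr ?_
    filter_upwards [hS.eval_zero θ x] with ω hω
    change (X θ x 0 ω ∈ A) = (x ∈ A)
    rw [hω]
  rw [h1]
  by_cases hx : x ∈ A <;> simp [hx]

lemma invariant_gaussianOf (hS : OUSystem P W g h σ K ρ L X X') (θ : Θ) (t : ℝ≥0)
    {A : Set H} (hA : MeasurableSet A) :
    ∫⁻ x, P {ω | X θ x t ω ∈ A} ∂gaussianOf (limPair K σ g h θ) =
      gaussianOf (limPair K σ g h θ) A := by
  rcases eq_or_ne t 0 with rfl | ht
  · exact hS.lintegral_prob_zero θ hA _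
  · have ht' : 0 < t := pos_iff_ne_zero.2 ht
    rw [hS.lintegral_prob_eq θ ht' hA, limPair,
      evolve_gaussianOf_limit (hS.stable θ) (NNReal.coe_pos.2 ht')]

lemma eq_gaussianOf_of_invariant (hS : OUSystem P W g h σ K ρ L X X')
    (hB : DecayingFamily (limPair K σ g h) (diffPair K σ g h) h D c) (θ : Θ) (μ : Measure H)
    [IsProbabilityMeasure μ]
    (hμ : ∀ (t : ℝ≥0) (A : Set H), MeasurableSet A → ∫⁻ x, P {ω | X θ x t ω ∈ A} ∂μ = μ A) :
    μ = gaussianOf (limPair K σ g h θ) := by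
  refine eq_gaussianOf_of_evolve_eq (a := g θ) (hS.stable θ) (hB.tendsto_flow θ) fun n hn => ?_
  ext A hA
  have := hS.lintegral_prob_eq θ (t := n) (Nat.cast_pos.2 hn) hA μ
  rw [hμ n A hA, NNReal.coe_natCast] at this
  exact this.symm

end OUSystem

end Stationary

/-! ### Translation to Euclidean coordinates, and the bounds for the solution. -/

section Euclidean

variable {d ℓ : ℕ}

lemma polyBdd_of_bounded {E F : Type*} [NormedAddCommGroup E] [NormedSpace ℝ E]
    [NormedAddCommGroup F] [NormedSpace ℝ F] {n : ℕ} {φ : E → F} (hφ : ContDiff ℝ n φ)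
    (hb : ∀ i ≤ n, ∃ K : ℝ, ∀ x, ‖iteratedFDeriv ℝ i φ x‖ ≤ K) : ∃ C, PolyBdd n φ C 0 := by
  choose! C hC using hb
  refine ⟨∑ i ∈ Finset.range (n + 1), C i, hφ, fun i hi x => ?_⟩
  rw [pow_zero, mul_one]
  refine (hC i hi x).trans (Finset.single_le_sum (f := C) (fun j hj => ?_)
    (Finset.mem_range.2 (Nat.lt_succ_of_le hi)))
  exact (norm_nonneg _).trans (hC j (Nat.le_of_lt_succ (Finset.mem_range.1 hj)) 0)

lemma one_add_rpow_le {r m : ℝ} (hr : 0 ≤ r) (hm : 0 < m) : 1 + r ^ m ≤ 2 * (1 + r) ^ ⌈m⌉₊ := by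
  have h1 : (1 : ℝ) ≤ (1 + r) ^ ⌈m⌉₊ := one_le_pow₀ (by linarith)
  have h2 : r ^ m ≤ (1 + r) ^ ⌈m⌉₊ := by
    rw [← Real.rpow_natCast]
    exact (Real.rpow_le_rpow hr (by linarith) hm.le).trans
      (Real.rpow_le_rpow_of_exponent_le (by linarith) (Nat.le_ceil m))
  linarith

lemma exists_polyBdd_of_sum_le {E : Type*} [NormedAddCommGroup E] [NormedSpace ℝ E] {f : E → ℝ}
    (hf : ContDiff ℝ 3 f) (hb : ∃ C m : ℝ, 0 < m ∧
      ∀ x, |f x| + ∑ i ∈ Finset.Icc 1 3, ‖iteratedFDeriv ℝ i f x‖ ≤ C * (1 + ‖x‖ ^ m)) :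
    ∃ C N, PolyBdd 3 f C N := by
  obtain ⟨C, m, hm, hb⟩ := hb
  refine ⟨|C| * 2, ⌈m⌉₊, hf, fun i hi x => ?_⟩
  have hs : ∀ j ∈ Finset.Icc 1 3, 0 ≤ ‖iteratedFDeriv ℝ j f x‖ := fun _ _ => norm_nonneg _
  have h1 : ‖iteratedFDeriv ℝ i f x‖ ≤ |f x| + ∑ i ∈ Finset.Icc 1 3, ‖iteratedFDeriv ℝ i f x‖ := by
    rcases Nat.eq_zero_or_pos i with rfl | hi0
    · rw [norm_iteratedFDeriv_zero, Real.norm_eq_abs]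
      exact le_add_of_nonneg_right (Finset.sum_nonneg hs)
    · exact (Finset.single_le_sum hs (Finset.mem_Icc.2 ⟨hi0, hi⟩)).trans
        (le_add_of_nonneg_left (abs_nonneg _))
  have h2 := one_add_rpow_le (norm_nonneg x) hm
  have h3 : 0 ≤ ‖x‖ ^ m := by positivity
  calc _ ≤ C * (1 + ‖x‖ ^ m) := h1.trans (hb x)
    _ ≤ |C| * (1 + ‖x‖ ^ m) := by gcongr; exact le_abs_self C
    _ ≤ |C| * (2 * (1 + ‖x‖) ^ ⌈m⌉₊) := by gcongr
    _ = _ := by ring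

lemma one_add_max_pow_le {a b : ℝ} (ha : 0 ≤ a) (hb : 0 ≤ b) (n : ℕ) :
    (1 + max a b) ^ n ≤ 2 ^ n * (1 + a ^ n + b ^ n) := by
  have h1 : 1 + max a b ≤ 2 * max 1 (max a b) := by
    linarith [le_max_left 1 (max a b), le_max_right 1 (max a b)]
  have ha' := pow_nonneg ha n
  have hb' := pow_nonneg hb n
  calc _ ≤ (2 * max 1 (max a b)) ^ n :=
        pow_le_pow_left₀ (by positivity) h1 n
    _ = 2 ^ n * max 1 (max a b) ^ n := mul_pow _ _ _
    _ ≤ _ := by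
        gcongr
        rcases max_choice 1 (max a b) with h | h <;> rw [h]
        · rw [one_pow]; linarith
        · rcases max_choice a b with h | h <;> rw [h] <;> linarith

/-- The operator in terms of the derivative in both variables. -/
lemma generator_eq {g : Vec ℓ → Vec d} {h : Vec ℓ → Mat d d} {σ : ℝ} {θ : Vec ℓ}
    {φ : Vec d → Mat d ℓ → ℝ} (hφ : Differentiable ℝ fun p : Vec d × Mat d ℓ => φ p.1 p.2)
    (x : Vec d) (x' : Mat d ℓ) :
    generator g h σ θ φ x x' =
      fderiv ℝ (fun p : Vec d × Mat d ℓ => φ p.1 p.2) (x, x') (OUSystem.pairDrift g h θ (x, x')) +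
        σ ^ 2 / 2 * Δ (fun y => φ y x') x := by
  have h0 := (hφ (x, x')).hasFDerivAt
  set ψ' := fderiv ℝ (fun p : Vec d × Mat d ℓ => φ p.1 p.2) (x, x')
  have e1 : HasFDerivAt (fun y : Vec d => (y, x')) (ContinuousLinearMap.inl ℝ (Vec d) (Mat d ℓ)) x :=
    hasFDerivAt_prodMk_left x x'
  have h1 : HasFDerivAt (fun y => φ y x') (ψ'.comp (ContinuousLinearMap.inl ℝ (Vec d) (Mat d ℓ))) x :=
    HasFDerivAt.comp (g := fun p : Vec d × Mat d ℓ => φ p.1 p.2) x h0 e1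
  have h2 : HasFDerivAt (fun y' => φ x y') (ψ'.comp (ContinuousLinearMap.inr ℝ (Vec d) (Mat d ℓ))) x' :=
    HasFDerivAt.comp (g := fun p : Vec d × Mat d ℓ => φ p.1 p.2) x' h0 (hasFDerivAt_prodMk_right x x')
  unfold generator
  rw [h2.fderiv, gradient, h1.fderiv, real_inner_comm, InnerProductSpace.toDual_symm_apply]
  have e : OUSystem.pairDrift g h θ (x, x') = ContinuousLinearMap.inl ℝ (Vec d) (Mat d ℓ) (g θ - h θ x) +
      ContinuousLinearMap.inr ℝ (Vec d) (Mat d ℓ) (tangentDrift g h θ x x') := by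
    simp [OUSystem.pairDrift, tangentDrift]
  rw [e, map_add, ContinuousLinearMap.comp_apply, ContinuousLinearMap.comp_apply]
  ring

/-- The vector that represents a linear form. -/
abbrev riesz (ℓ : ℕ) : (Vec ℓ →L[ℝ] ℝ) ≃ₗᵢ[ℝ] Vec ℓ := (InnerProductSpace.toDual ℝ (Vec ℓ)).symm

lemma riesz_coord (T : Vec ℓ →L[ℝ] ℝ) (j : Fin ℓ) :
    riesz ℓ T j = T (EuclideanSpace.single j 1) := by
  rw [← InnerProductSpace.toDual_symm_apply, EuclideanSpace.inner_single_right]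
  simp

/-- Under the Riesz isometry the transpose applied to a gradient is a composition of linear maps,
the form in which the gap is written. -/
lemma G1_eq {f : Vec d → ℝ} {β : ℝ} {π : Vec ℓ → Measure (Vec d)} (x : Vec d) (x' : Mat d ℓ)
    (θ : Vec ℓ) : G1 f β π x x' θ = ((∫ y, f y ∂π θ) - β) •
      riesz ℓ ((fderiv ℝ f x).comp x' - fderiv ℝ (fun η => ∫ y, f y ∂π η) θ) := by
  unfold G1
  congr 1
  rw [map_sub]
  congr 1
  refine ext_inner_right ℝ fun η => ?_
  rw [ContinuousLinearMap.adjoint_inner_left, gradient, InnerProductSpace.toDual_symm_apply,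
    InnerProductSpace.toDual_symm_apply]
  rfl

variable {Ω : Type*} [MeasurableSpace Ω] {P : Measure Ω} [IsProbabilityMeasure P]
  {W : ℝ≥0 → Ω → Vec d} {g : Vec ℓ → Vec d} {h : Vec ℓ → Mat d d} {f : Vec d → ℝ}
  {σ β K ρ L D c Cf : ℝ} {Nf : ℕ}
  {X : Vec ℓ → Vec d → ℝ≥0 → Ω → Vec d} {X' : Vec ℓ → Vec d → Mat d ℓ → ℝ≥0 → Ω → Mat d ℓ}

/-- The Gaussian stationary distribution. -/
def stationaryLaw (K σ : ℝ) (g : Vec ℓ → Vec d) (h : Vec ℓ → Mat d d) (θ : Vec ℓ) :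
    Measure (Vec d) := gaussianOf (limPair K σ g h θ)

/-- The solution of the Poisson equation. -/
def solution (K σ β : ℝ) (g : Vec ℓ → Vec d) (h : Vec ℓ → Mat d d) (f : Vec d → ℝ)
    (p : Vec d × Mat d ℓ) (θ : Vec ℓ) : Vec ℓ :=
  -((stationaryMean K σ g h f θ - β) • riesz ℓ (gapPotential K σ g h f p θ))

lemma integral_stationaryLaw (hf : Continuous f) (θ : Vec ℓ) :
    ∫ y, f y ∂stationaryLaw K σ g h θ = stationaryMean K σ g h f θ :=
  integral_gaussianOf _ hf

lemma G1_stationaryLaw (hf : Continuous f) (x : Vec d) (x' : Mat d ℓ) (θ : Vec ℓ) :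
    G1 f β (stationaryLaw K σ g h) x x' θ = (stationaryMean K σ g h f θ - β) •
      riesz ℓ ((fderiv ℝ f x).comp x' - fderiv ℝ (stationaryMean K σ g h f) θ) := by
  rw [G1_eq]
  simp only [integral_stationaryLaw hf]

lemma PolyBdd.exists_pairing_comp (hf : PolyBdd 3 f Cf Nf) :
    ∃ C N, PolyBdd 2 (fun p : Vec d × Mat d ℓ => (fderiv ℝ f p.1).comp p.2) C N := by
  have h1 := hf.fderiv.comp (PolyBdd.clm (n := 2) (ContinuousLinearMap.fst ℝ (Vec d) (Mat d ℓ)))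
  have h2 := PolyBdd.clm (n := 2) (ContinuousLinearMap.snd ℝ (Vec d) (Mat d ℓ))
  exact ⟨_, _, h1.bilin (ContinuousLinearMap.compL ℝ (Vec ℓ) (Vec d) ℝ) h2⟩

namespace OUSystem

lemma integrable_G1 (hS : OUSystem P W g h σ K ρ L X X') (hf : PolyBdd 3 f Cf Nf) (θ : Vec ℓ)
    (x : Vec d) (x' : Mat d ℓ) (t : ℝ≥0) :
    Integrable (fun ω => G1 f β (stationaryLaw K σ g h) (X θ x t ω) (X' θ x x' t ω) θ) P := by
  obtain ⟨_, _, hψ⟩ := hf.exists_pairing_comp (ℓ := ℓ)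
  simp only [G1_stationaryLaw hf.continuous]
  exact ((riesz ℓ).toContinuousLinearEquiv.toContinuousLinearMap.integrable_comp
    ((hS.integrable_pair hψ θ x x' t).sub (integrable_const _))).smul
      (stationaryMean K σ g h f θ - β)

lemma meanG1_eq (hS : OUSystem P W g h σ K ρ L X X')
    (hB : DecayingFamily (limPair K σ g h) (diffPair K σ g h) h D c) (hf : PolyBdd 3 f Cf Nf)
    (θ : Vec ℓ) (x : Vec d) (x' : Mat d ℓ) {t : ℝ≥0} (ht : 0 < t) :
    meanG1 P X X' f β (stationaryLaw K σ g h) x x' θ t =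
      (stationaryMean K σ g h f θ - β) • riesz ℓ (gap K σ g h f t (x, x') θ) := by
  obtain ⟨_, _, hψ⟩ := hf.exists_pairing_comp (ℓ := ℓ)
  unfold meanG1
  simp only [G1_stationaryLaw hf.continuous]
  rw [integral_smul]
  congr 1
  have hint : Integrable (fun ω => (fderiv ℝ f (X θ x t ω)).comp (X' θ x x' t ω) -
      fderiv ℝ (stationaryMean K σ g h f) θ) P :=
    (hS.integrable_pair hψ θ x x' t).sub (integrable_const _)
  rw [← LinearIsometryEquiv.coe_toContinuousLinearEquiv,
    ContinuousLinearEquiv.integral_comp_comm (riesz ℓ).toContinuousLinearEquiv]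
  congr 1
  ext1 η
  rw [ContinuousLinearMap.integral_apply hint]
  have h1 := hS.integral_observable hB hf θ x x' η ht
  have h2 := integral_sub h1.1 (integrable_const (μ := P)
    (fderiv ℝ (stationaryMean K σ g h f) θ η))
  rw [h1.2] at h2
  refine h2.trans ?_
  simp

lemma integrableOn_meanG1 (hS : OUSystem P W g h σ K ρ L X X')
    (hB : DecayingFamily (limPair K σ g h) (diffPair K σ g h) h D c) (hf : PolyBdd 3 f Cf Nf)
    (θ : Vec ℓ) (x : Vec d) (x' : Mat d ℓ) : IntegrableOn
      (fun t : ℝ => meanG1 P X X' f β (stationaryLaw K σ g h) x x' θ t.toNNReal) (Ioi 0) := by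
  have h1 : IntegrableOn (fun t : ℝ => (stationaryMean K σ g h f θ - β) •
      riesz ℓ (gap K σ g h f t.toNNReal (x, x') θ)) (Ioi 0) :=
    ((riesz ℓ).toContinuousLinearEquiv.toContinuousLinearMap.integrable_comp
      (integrableOn_gap hB hf (x, x') θ)).smul (stationaryMean K σ g h f θ - β)
  exact h1.congr_fun (fun t ht => (hS.meanG1_eq hB hf θ x x' (Real.toNNReal_pos.2 ht)).symm)
    measurableSet_Ioi

lemma v1_eq (hS : OUSystem P W g h σ K ρ L X X')
    (hB : DecayingFamily (limPair K σ g h) (diffPair K σ g h) h D c) (hf : PolyBdd 3 f Cf Nf)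
    (θ : Vec ℓ) (x : Vec d) (x' : Mat d ℓ) :
    v1 P X X' f β (stationaryLaw K σ g h) x x' θ = solution K σ β g h f (x, x') θ := by
  unfold v1 solution
  rw [setIntegral_congr_fun measurableSet_Ioi fun t ht =>
    hS.meanG1_eq hB hf θ x x' (Real.toNNReal_pos.2 ht), integral_smul]
  congr 2
  exact (riesz ℓ).toContinuousLinearEquiv.integral_comp_comm _

end OUSystem

/-- Each coordinate is the potential evaluated in a direction that depends on θ but not on (x, x̃),
so the scalar Poisson equation applies to it directly. -/
lemma solution_coord (p : Vec d × Mat d ℓ) (θ : Vec ℓ) (j : Fin ℓ) :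
    solution K σ β g h f p θ j = gapPotential K σ g h f p θ
      (-(stationaryMean K σ g h f θ - β) • EuclideanSpace.single j 1) := by
  rw [map_smul, ← riesz_coord, solution]
  simp only [PiLp.neg_apply, PiLp.smul_apply, smul_eq_mul, neg_mul]

/-- The solution is bounded together with its derivatives. -/
lemma exists_polyBdd_solution (hB : DecayingFamily (limPair K σ g h) (diffPair K σ g h) h D c)
    (hf : PolyBdd 3 f Cf Nf) :
    ∃ C N, (∀ θ, PolyBdd 2 (fun p => solution K σ β g h f p θ) C N) ∧
      ∀ p, PolyBdd 1 (fun θ => solution K σ β g h f p θ) (C * (1 + ‖p‖) ^ N) 0 := by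
  obtain ⟨C', N', h1, h2⟩ := polyBdd_gapPotential hB hf
  obtain ⟨_, _, hΦ⟩ := hf.exists_smear
  obtain ⟨CF, hF⟩ : ∃ CF, PolyBdd 1 (fun θ => stationaryMean K σ g h f θ - β) CF 0 := by
    have h := ((hΦ.of_le (by norm_num : 1 ≤ 3)).comp (hB.polyBdd_lim.of_le one_le_two)).mono le_rfl
      (zero_mul _).le
    exact ⟨_, h.add (PolyBdd.const (-β))⟩
  have hCF := hF.nonneg
  set B : ℝ →L[ℝ] Vec ℓ →L[ℝ] Vec ℓ := ContinuousLinearMap.lsmul ℝ ℝ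
  set R := (riesz ℓ).toContinuousLinearEquiv.toContinuousLinearMap
  refine ⟨‖B‖ * (2 ^ 2 * CF * (‖R‖ * C')), 0 + N', fun θ => ?_, fun p => ?_⟩
  · have h3 : PolyBdd 2 (fun _ : Vec d × Mat d ℓ => stationaryMean K σ g h f θ - β) CF 0 :=
      (PolyBdd.const _).mono (by simpa using hF.norm_le θ) le_rfl
    exact (h3.bilin B ((h1 θ).clm_comp R)).neg
  · have h3 := (hF.bilin B ((h2 p).clm_comp R)).neg
    have hC' := (h1 0).nonneg
    refine h3.mono ?_ le_rfl
    rw [zero_add]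
    calc _ = ‖B‖ * (2 ^ 1 * CF * (‖R‖ * C')) * (1 + ‖p‖) ^ N' := by ring
      _ ≤ _ := by
        gcongr
        · norm_num
        · norm_num

lemma fderiv_mk_right_norm_le {E F G : Type*} [NormedAddCommGroup E] [NormedSpace ℝ E]
    [NormedAddCommGroup F] [NormedSpace ℝ F] [NormedAddCommGroup G] [NormedSpace ℝ G]
    {U : E × F → G} {x : E} {y : F} (hU : DifferentiableAt ℝ U (x, y)) :
    ‖fderiv ℝ (fun z => U (z, y)) x‖ ≤ ‖fderiv ℝ U (x, y)‖ := by
  have h0 : HasFDerivAt (fun z : E => (z, y)) (ContinuousLinearMap.inl ℝ E F) x :=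
    hasFDerivAt_prodMk_left x y
  have h1 := HasFDerivAt.comp (g := U) x hU.hasFDerivAt h0
  have e : fderiv ℝ (fun z => U (z, y)) x = _ := h1.fderiv
  rw [e]
  exact (ContinuousLinearMap.opNorm_comp_le _ _).trans
    (mul_le_of_le_one_right (norm_nonneg _) (ContinuousLinearMap.norm_inl_le_one ℝ E F))

lemma fderiv_mk_left_norm_le {E F G : Type*} [NormedAddCommGroup E] [NormedSpace ℝ E]
    [NormedAddCommGroup F] [NormedSpace ℝ F] [NormedAddCommGroup G] [NormedSpace ℝ G]
    {U : E × F → G} {x : E} {y : F} (hU : DifferentiableAt ℝ U (x, y)) :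
    ‖fderiv ℝ (fun z => U (x, z)) y‖ ≤ ‖fderiv ℝ U (x, y)‖ := by
  have h1 := HasFDerivAt.comp (g := U) y hU.hasFDerivAt (hasFDerivAt_prodMk_right x y)
  have e : fderiv ℝ (fun z => U (x, z)) y = _ := h1.fderiv
  rw [e]
  exact (ContinuousLinearMap.opNorm_comp_le _ _).trans
    (mul_le_of_le_one_right (norm_nonneg _) (ContinuousLinearMap.norm_inr_le_one ℝ E F))

lemma exists_solution_bound (hB : DecayingFamily (limPair K σ g h) (diffPair K σ g h) h D c)
    (hf : PolyBdd 3 f Cf Nf) : ∃ C m : ℝ, 0 < m ∧ ∀ (x : Vec d) (x' : Mat d ℓ) (θ : Vec ℓ),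
      ‖solution K σ β g h f (x, x') θ‖ + ‖fderiv ℝ (solution K σ β g h f (x, x')) θ‖
        + ‖fderiv ℝ (fun y => solution K σ β g h f (y, x') θ) x‖
        + ‖fderiv ℝ (fun y' => solution K σ β g h f (x, y') θ) x'‖
        ≤ C * (1 + ‖x‖ ^ m + ‖x'‖ ^ m) := by
  obtain ⟨C, N, h1, h2⟩ := exists_polyBdd_solution (β := β) hB hf
  have hC := (h1 0).nonneg
  -- Each of the four terms is at most C (1 + ‖(x, x')‖)^N; the exponent is raised to N + 1 to be
  -- positive.
  refine ⟨4 * C * 2 ^ (N + 1), ((N + 1 : ℕ) : ℝ), by positivity, fun x x' θ => ?_⟩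
  rw [Real.rpow_natCast, Real.rpow_natCast]
  have hd := (h1 θ).differentiable one_le_two (x, x')
  have e1 := (h1 θ).norm_le (x, x')
  have e2 := (h2 (x, x')).norm_fderiv_le le_rfl θ
  rw [pow_zero, mul_one] at e2
  have e0 := (h1 θ).norm_fderiv_le one_le_two (x, x')
  have e3 := (fderiv_mk_right_norm_le hd).trans e0
  have e4 := (fderiv_mk_left_norm_le hd).trans e0
  have e5 : (1 + ‖(x, x')‖) ^ N ≤ 2 ^ (N + 1) * (1 + ‖x‖ ^ (N + 1) + ‖x'‖ ^ (N + 1)) :=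
    (pow_le_pow_right₀ (by linarith [norm_nonneg (x, x')]) (Nat.le_succ N)).trans
      (one_add_max_pow_le (norm_nonneg x) (norm_nonneg x') (N + 1))
  calc _ ≤ 4 * C * (1 + ‖(x, x')‖) ^ N := by linarith
    _ ≤ 4 * C * (2 ^ (N + 1) * (1 + ‖x‖ ^ (N + 1) + ‖x'‖ ^ (N + 1))) := by gcongr
    _ = _ := by ring

lemma differentiable_stationaryMean
    (hB : DecayingFamily (limPair K σ g h) (diffPair K σ g h) h D c) (hf : PolyBdd 3 f Cf Nf) :
    Differentiable ℝ (stationaryMean K σ g h f) := by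
  obtain ⟨_, _, hΦ⟩ := hf.exists_smear
  exact (hΦ.differentiable (by norm_num)).comp (hB.polyBdd_lim.differentiable one_le_two)

namespace OUSystem

lemma isClassicalSolution (hS : OUSystem P W g h σ K ρ L X X')
    (hB : DecayingFamily (limPair K σ g h) (diffPair K σ g h) h D c) (hf : PolyBdd 3 f Cf Nf)
    (θ : Vec ℓ) : IsClassicalSolution (generator g h σ θ)
      (fun x x' => solution K σ β g h f (x, x') θ)
      (fun x x' => G1 f β (stationaryLaw K σ g h) x x' θ) := by
  obtain ⟨C, N, h1, -⟩ := exists_polyBdd_solution (β := β) hB hf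
  obtain ⟨_, _, h2, -⟩ := polyBdd_gapPotential hB hf
  have hc : ContDiff ℝ 2 fun p => solution K σ β g h f p θ := (h1 θ).contDiff
  have hd := (h2 θ).differentiable one_le_two
  have he : ContDiff ℝ 2 fun p : Vec d × Mat d ℓ => solution K σ β g h f (p.1, p.2) θ := hc
  refine ⟨he.of_le one_le_two, fun x' => ?_, ?_, fun x x' j => ?_⟩
  · have h3 : ContDiff ℝ 2 fun x : Vec d => (x, x') := contDiff_id.prodMk contDiff_const
    exact hc.comp h3
  · exact continuous_iteratedFDeriv_comp_mk_right (n := 2)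
      (U := fun p => solution K σ β g h f p θ) (h1 θ).contDiff
  simp only [solution_coord]
  set η : Vec ℓ := -(stationaryMean K σ g h f θ - β) • EuclideanSpace.single j 1 with hη
  have hdη : Differentiable ℝ fun p : Vec d × Mat d ℓ => gapPotential K σ g h f (p.1, p.2) θ η :=
    hd.clm_apply (differentiable_const η)
  rw [generator_eq (φ := fun y y' => gapPotential K σ g h f (y, y') θ η) hdη]
  refine (hS.poisson_gapPotential hB hf θ x x' η).trans ?_
  rw [hη, G1_stationaryLaw hf.continuous]
  simp only [PiLp.smul_apply, smul_eq_mul, riesz_coord, map_smul, ContinuousLinearMap.sub_apply,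
    ContinuousLinearMap.comp_apply]
  ring

end OUSystem

end Euclidean

/-! ### From the hypotheses to a stable system. -/

section Assembly

variable {d ℓ : ℕ} {Ω : Type*} [MeasurableSpace Ω] {P : Measure Ω} [IsProbabilityMeasure P]
  {W : ℝ≥0 → Ω → Vec d} {g : Vec ℓ → Vec d} {h : Vec ℓ → Mat d d}
  {σ : ℝ} {X : Vec ℓ → Vec d → ℝ≥0 → Ω → Vec d} {X' : Vec ℓ → Vec d → Mat d ℓ → ℝ≥0 → Ω → Mat d ℓ}

/-- The contraction estimate with M = max Ch c, a common bound for all h(θ) that is also at least c;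
K and ρ then do not depend on θ. -/
lemma exists_isStable {Ch : ℝ} (hh : PolyBdd 2 h Ch 0) (hsymm : ∀ θ, IsSelfAdjoint (h θ))
    (hpos : ∃ c : ℝ, 0 < c ∧ ∀ θ x, c * ‖x‖ ^ 2 ≤ inner ℝ x (h θ x)) :
    ∃ K ρ : ℝ, ∀ θ, IsStable K ρ (h θ) := by
  obtain ⟨c, hc, hpos⟩ := hpos
  have hM : 0 < max Ch c := hc.trans_le (le_max_right _ _)
  refine ⟨max Ch c ^ 2 / c, √(1 - c ^ 2 / max Ch c ^ 2), fun θ => ⟨by positivity, ?_,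
    norm_one_sub_le hc (le_max_right _ _) ?_ (hpos θ), hsymm θ⟩⟩
  · rw [Real.sqrt_lt' one_pos, one_pow]
    exact sub_lt_self _ (by positivity)
  · have := hh.norm_le θ
    rw [pow_zero, mul_one] at this
    exact this.trans (le_max_left _ _)

lemma ouSystem {K ρ Cg Ch : ℝ} (hg : PolyBdd 2 g Cg 0) (hh : PolyBdd 2 h Ch 0)
    (hs : ∀ θ, IsStable K ρ (h θ)) (hW : IsBrownianVec P W)
    (hX : ∀ θ x, IsOUSolution P W (g θ) (h θ) σ x (X θ x))
    (hX' : ∀ θ x x', IsTangentSolution P g h θ x' (X θ x) (X' θ x x')) :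
    OUSystem P W g h σ K ρ (max Cg Ch) X X' where
  noise := hW.isNoise
  stable := hs
  polyBdd_g := (hg.of_le one_le_two).mono (le_max_left _ _) le_rfl
  polyBdd_h := (hh.of_le one_le_two).mono (le_max_right _ _) le_rfl
  measurable θ x t := (hX θ x).measurable t
  path θ x := (hX θ x).path
  measurable_tangent θ x x' t := (hX' θ x x').measurable t
  path_tangent θ x x' := (hX' θ x x').path

end Assembly

end

end OUPoisson

open OUPoisson in
theorem mainTheorem2 {d ℓ : ℕ} (g : Vec ℓ → Vec d) (h : Vec ℓ → Mat d d) (f : Vec d → ℝ)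
    (σ β : ℝ)
    (hg : ContDiff ℝ 2 g) (hh : ContDiff ℝ 2 h) (hf : ContDiff ℝ 3 f)
    (hg_bdd : ∀ i ≤ 2, ∃ K : ℝ, ∀ θ, ‖iteratedFDeriv ℝ i g θ‖ ≤ K)
    (hh_bdd : ∀ i ≤ 2, ∃ K : ℝ, ∀ θ, ‖iteratedFDeriv ℝ i h θ‖ ≤ K)
    (hh_symm : ∀ θ, IsSelfAdjoint (h θ))
    (hh_pos : ∃ c : ℝ, 0 < c ∧ ∀ θ x, c * ‖x‖ ^ 2 ≤ inner ℝ x (h θ x))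
    (hf_poly : ∃ C m : ℝ, 0 < m ∧
      ∀ x, |f x| + ∑ i ∈ Finset.Icc 1 3, ‖iteratedFDeriv ℝ i f x‖ ≤ C * (1 + ‖x‖ ^ m))
    {Ω : Type*} [MeasurableSpace Ω] (P : Measure Ω) [IsProbabilityMeasure P]
    (W : ℝ≥0 → Ω → Vec d) (hW : IsBrownianVec P W)
    (X : Vec ℓ → Vec d → ℝ≥0 → Ω → Vec d)
    (hX : ∀ θ x, IsOUSolution P W (g θ) (h θ) σ x (X θ x))
    (X' : Vec ℓ → Vec d → Mat d ℓ → ℝ≥0 → Ω → Mat d ℓ)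
    (hX' : ∀ θ x x', IsTangentSolution P g h θ x' (X θ x) (X' θ x x')) :
    ∃ π : Vec ℓ → Measure (Vec d),
      -- the stationary distribution of the process exists and is unique
      (∀ θ, IsStationary P (X θ) (π θ)) ∧
      (∀ θ μ, IsStationary P (X θ) μ → μ = π θ) ∧
      -- the expectation of `f` under it is well defined and differentiable in the parameter
      (∀ θ, Integrable f (π θ)) ∧
      Differentiable ℝ (fun θ => ∫ y, f y ∂π θ) ∧
      -- the integrals that define `v` converge
      (∀ θ x x' t, Integrable (fun ω => G1 f β π (X θ x t ω) (X' θ x x' t ω) θ) P) ∧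
      (∀ θ x x', IntegrableOn (fun t : ℝ => meanG1 P X X' f β π x x' θ t.toNNReal) (Ioi 0)) ∧
      -- on test functions, the operator is the infinitesimal generator of the pair process
      (∀ θ (φ : Vec d → Mat d ℓ → ℝ),
        ContDiff ℝ 2 (fun p : Vec d × Mat d ℓ => φ p.1 p.2) →
        HasCompactSupport (fun p : Vec d × Mat d ℓ => φ p.1 p.2) →
        ∀ x x', Tendsto
          (fun t : ℝ≥0 => (t : ℝ)⁻¹ * ((∫ ω, φ (X θ x t ω) (X' θ x x' t ω) ∂P) - φ x x'))
          (𝓝[>] 0) (𝓝 (generator g h σ θ φ x x'))) ∧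
      -- `v` is a classical solution of the Poisson equation
      (∀ θ, IsClassicalSolution (generator g h σ θ)
        (fun x x' => v1 P X X' f β π x x' θ) (fun x x' => G1 f β π x x' θ)) ∧
      -- `v` is differentiable in the parameter, and the polynomial bound holds
      (∀ x x', Differentiable ℝ (fun θ => v1 P X X' f β π x x' θ)) ∧
      ∃ C m' : ℝ, 0 < m' ∧ ∀ x x' θ,
        ‖v1 P X X' f β π x x' θ‖
          + ‖fderiv ℝ (fun η => v1 P X X' f β π x x' η) θ‖
          + ‖fderiv ℝ (fun y => v1 P X X' f β π y x' θ) x‖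
          + ‖fderiv ℝ (fun y' => v1 P X X' f β π x y' θ) x'‖
          ≤ C * (1 + ‖x‖ ^ m' + ‖x'‖ ^ m') := by
  obtain ⟨Cg, hg'⟩ := polyBdd_of_bounded (n := 2) hg hg_bdd
  obtain ⟨Ch, hh'⟩ := polyBdd_of_bounded (n := 2) hh hh_bdd
  obtain ⟨Cf, Nf, hf'⟩ := exists_polyBdd_of_sum_le hf hf_poly
  obtain ⟨K, ρ, hs⟩ := exists_isStable hh' hh_symm hh_pos
  have hS := ouSystem (σ := σ) hg' hh' hs hW hX hX'
  obtain ⟨C₀, c, hC₀⟩ := exists_paramBounds (σ := σ) hg' hh' hs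
  obtain ⟨D, hB⟩ := hC₀.decayingFamily hs
  refine ⟨stationaryLaw K σ g h, fun θ => ⟨?_, fun t A hA => hS.invariant_gaussianOf θ t hA⟩,
    fun θ μ hμ => ?_, fun θ => hf'.integrable_gaussianOf _, ?_,
    fun θ x x' t => hS.integrable_G1 hf' θ x x' t,
    fun θ x x' => hS.integrableOn_meanG1 hB hf' θ x x', fun θ φ hφ hc x x' => ?_, fun θ => ?_,
    fun x x' => ?_, ?_⟩
  · unfold stationaryLaw
    infer_instance
  · have := hμ.prob
    exact hS.eq_gaussianOf_of_invariant hB θ μ hμ.invariant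
  · simp only [integral_stationaryLaw hf.continuous]
    exact differentiable_stationaryMean hB hf'
  · obtain ⟨C, hψ⟩ := HasCompactSupport.exists_polyBdd (n := 2) hφ hc
    rw [generator_eq (hφ.differentiable two_ne_zero)]
    exact hS.tendsto_generator hψ θ x x'
  · simp only [hS.v1_eq hB hf']
    exact hS.isClassicalSolution hB hf' θ
  · simp only [hS.v1_eq hB hf']
    obtain ⟨_, _, -, h2⟩ := exists_polyBdd_solution (β := β) hB hf'
    exact (h2 (x, x')).differentiable le_rfl
  · simp only [hS.v1_eq hB hf']
    exact exists_solution_bound hB hf'
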